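/- **Conventions.** Let $m>0$, $\nu\in\{2,3\}$, $\mathbf p=-i\nabla$, and $H_0=\frac1{2m}\mathbf p^2=-\frac1{2m}\Delta$, which is self-adjoint on the Sobolev space $W^2$. The Hilbert space is $\mathcal H=L^2(\mathbb R^\nu,\mathbb C^2)$ for the Pauli operator and $\mathcal H=L^2(\mathbb R^\nu,\mathbb C)$ for the Schrödinger operator; $W^k\subset\mathcal H$ denotes the $L^2$-Sobolev space of order $k$. Write $\sigma=(\sigma_1,\sigma_2,\sigma_3)$ for the Pauli matrices; for $\nu=2$, a scalar field $B$ is identified with $(0,0,B)$, so that $\sigma\cdot B=B\,\sigma_3$, and $\operatorname{curl}A=\partial_1A_2-\partial_2A_1$. * A magnetic field $B:\mathbb R^2\to\mathbb R$ or $B:\mathbb R^3\to\mathbb R^3$ is of *medium decay* if $B\in L^p(\mathbb R^\nu)$ for some $p>\nu$, $|B(x)|\le C|x|^{-\mu}$ for some $\mu>3/2$ and (almost all) large $|x|$, and, if $\nu=3$, $\operatorname{div}B=0$ in $\mathcal S'$. * A vector potential $A:\mathbb R^\nu\to\mathbb R^\nu$ is of *medium range* if it is continuous, $|A(x)|\le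 C|x|^{-\mu}$ for some $\mu>1/2$ and all $x\ne0$, and $\int_0^\infty\sup\{|A(x)\cdot x|/|x| : |x|\ge r\}\,dr<\infty$. * A measurable function $A_0:\mathbb R^\nu\to\mathbb R$ is a scalar potential of *short range* if multiplication by $A_0$ is Kato-small with respect to $H_0$ (that is, $\|A_0\psi\|\le a\|H_0\psi\|+b\|\psi\|$ for all $\psi\in W^2$, with some $a<1$ and $b\ge 0$) and $\int_0^\infty\|A_0(H_0+i)^{-1}F(|x|\ge r)\|\,dr<\infty$, where $F(|x|\ge r)$ is multiplication by the characteristic function of $\{|x|\ge r\}$. **Lemma (Pauli and Schrödinger operators).** Let $B$ be a magnetic field of medium decay, $A$ a vector potential of medium range with $\operatorname{curl}A=B$ in $\mathcal S'$, and $A_0$ a scalar potential of short range. For $\psi\in W^1$ let $$q_A(\psi,\psi)=\frac1{2m}\big\|(\mathbf p-A)\psi\big\|^2+\Big(\psi,\big(-\tfrac1{2m}\,\sigma\cdot B+A_0\big)\psi\Big).$$ 1. The form $q_A$ is well-defined on $W^1$, and there is a unique self-adjoint operator $H$ such that its form domain is $W^1$ and its quadratic form equals $q_A$. (The Pauli operator.)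 2. Suppose that $A'=A+\nabla\lambda$ is of medium range as well, where $\lambda:\mathbb R^\nu\to\mathbb R$ is a $C^1$ function, and let $H'$ be the operator defined by $q_{A'}$ as in item 1 (with the same $B$ and $A_0$). Then $D(H')=e^{i\lambda}D(H)$ and $H'=e^{i\lambda}He^{-i\lambda}$. 3. Suppose that the distribution $\operatorname{div}A\in\mathcal S'$ is a bounded function. Then $D(H)=W^2$, and for all $\psi\in W^2$ $$H\psi=\frac1{2m}\Big[\mathbf p^2-2A\cdot\mathbf p+i\operatorname{div}A+A^2-\sigma\cdot B\Big]\psi+A_0\psi .$$ For the Schrödinger operator the term $-\sigma\cdot B$ is omitted throughout; the same assertions 1–3 hold for every medium-range $A$ and short-range $A_0$, without any assumption that the distribution $\operatorname{curl}A$ is a function. -/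

import Mathlib

open MeasureTheory Filter Topology
open scoped ENNReal SchwartzMap LineDeriv Laplacian

namespace MagneticHamiltonian

noncomputable section

/-! ### Spaces -/

/-- The configuration space `ℝ^ν`. -/
abbrev Pos (ν : ℕ) : Type := EuclideanSpace ℝ (Fin ν)

/-- The space of spin states of a particle of spin `1/2`. -/
abbrev Spinor : Type := EuclideanSpace ℂ (Fin 2)

/-- The Hilbert space `L²(ℝ^ν, F)`; here `F = ℂ` (Schrödinger) or `F = ℂ²` (Pauli). -/
abbrev L2 (ν : ℕ) (F : Type) [NormedAddCommGroup F] : Type :=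
  Lp F 2 (volume : Measure (Pos ν))

variable {ν : ℕ} {F : Type} [NormedAddCommGroup F] [InnerProductSpace ℂ F] [CompleteSpace F]

/-- The Sobolev space `W^k ⊆ L²(ℝ^ν, F)`. -/
def sobolev (ν : ℕ) (F : Type) [NormedAddCommGroup F] [InnerProductSpace ℂ F] [CompleteSpace F]
    (k : ℕ) : Set (L2 ν F) :=
  {ψ | TemperedDistribution.MemSobolev (k : ℝ) 2 (ψ : 𝓢'(Pos ν, F))}

open scoped Classical in
/-- The distributional derivative `∂_j ψ` as an element of `L²`
(with value `0` if it is not in `L²`, which does not happen on `W^1`). -/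
def partialL2 (j : Fin ν) (ψ : L2 ν F) : L2 ν F :=
  if h : ∃ g : L2 ν F, ∂_{EuclideanSpace.single j (1 : ℝ)} (ψ : 𝓢'(Pos ν, F)) = (g : 𝓢'(Pos ν, F))
  then h.choose else 0

open scoped Classical in
/-- The distributional Laplacian `Δψ` as an element of `L²`
(with value `0` if it is not in `L²`, which does not happen on `W^2`). -/
def laplacianL2 (ψ : L2 ν F) : L2 ν F :=
  if h : ∃ g : L2 ν F, Δ (ψ : 𝓢'(Pos ν, F)) = (g : 𝓢'(Pos ν, F)) then h.choose else 0

/-- The free Hamiltonian `H₀ = -Δ / (2m)`, to be used on its domain `W^2`. -/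
def freeHamiltonian (m : ℝ) (ψ : L2 ν F) : L2 ν F :=
  -((1 / (2 * m) : ℝ) : ℂ) • laplacianL2 ψ

/-- The classical partial derivative `∂_j f (x)`. -/
def pd {G : Type} [NormedAddCommGroup G] [NormedSpace ℝ G] (j : Fin ν) (f : Pos ν → G)
    (x : Pos ν) : G :=
  fderiv ℝ f x (EuclideanSpace.single j (1 : ℝ))

/-! ### Potentials and fields -/

/-- The operator norm of `A₀ (H₀ + i)⁻¹ F(|x| ≥ r)` on `L²(ℝ^ν, ℂ)`, as an element of `[0, ∞]`.
Here `u = (H₀ + i)⁻¹ F(|x| ≥ r) f` is expressed as `u ∈ W^2` and `(H₀ + i) u = F(|x| ≥ r) f`. -/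
def enssNorm (m : ℝ) (A₀ : Pos ν → ℝ) (r : ℝ) : ℝ≥0∞ :=
  ⨆ (f : L2 ν ℂ) (u : L2 ν ℂ) (_ : ‖f‖ ≤ 1) (_ : u ∈ sobolev ν ℂ 2)
    (_ : (freeHamiltonian m u + Complex.I • u : L2 ν ℂ) =ᵐ[volume]
      Set.indicator {x : Pos ν | r ≤ ‖x‖} f),
    eLpNorm (fun x => A₀ x • u x) 2 volume

/-- A scalar potential of short range: a measurable real function `A₀` that is Kato-small with
respect to `H₀` (relatively bounded with relative bound `< 1`) and satisfies the Enss condition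
`∫₀^∞ ‖A₀ (H₀ + i)⁻¹ F(|x| ≥ r)‖ dr < ∞`. -/
structure ShortRange (m : ℝ) (A₀ : Pos ν → ℝ) : Prop where
  measurable : AEMeasurable A₀ volume
  kato : ∃ a b : ℝ, 0 ≤ a ∧ a < 1 ∧ 0 ≤ b ∧ ∀ ψ ∈ sobolev ν ℂ 2,
    eLpNorm (fun x => A₀ x • ψ x) 2 volume ≤
      ENNReal.ofReal (a * ‖freeHamiltonian m ψ‖ + b * ‖ψ‖)
  enss : ∫⁻ r in Set.Ioi (0 : ℝ), enssNorm m A₀ r < ∞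

/-- A vector potential of medium range. -/
structure MediumRange (A : Pos ν → Pos ν) : Prop where
  continuous : Continuous A
  decay : ∃ C μ : ℝ, 1 / 2 < μ ∧ ∀ x, x ≠ 0 → ‖A x‖ ≤ C * ‖x‖ ^ (-μ)
  longitudinal : ∫⁻ r in Set.Ioi (0 : ℝ),
    (⨆ (x : Pos ν) (_ : r ≤ ‖x‖), ENNReal.ofReal (|inner ℝ (A x) x| / ‖x‖)) < ∞

/-- `D = div A` in `𝓢'`. -/
def IsDiv (A : Pos ν → Pos ν) (D : Pos ν → ℝ) : Prop :=
  ∀ φ : 𝓢(Pos ν, ℝ), -∫ x, ∑ j, A x j * pd j φ x = ∫ x, D x * φ x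

/-- The integrability and decay conditions for a field `B` on `ℝ^ν` of medium decay:
`B ∈ L^p` for some `p > ν`, and `|B(x)| ≤ C |x|^{-μ}` for some `μ > 3/2` and large `|x|`. -/
structure DecayCondition {G : Type} [NormedAddCommGroup G] (B : Pos ν → G) : Prop where
  memLp : ∃ p : ℝ≥0∞, (ν : ℝ≥0∞) < p ∧ MemLp B p volume
  decay : ∃ C μ R : ℝ, 3 / 2 < μ ∧ 0 < R ∧
    ∀ᵐ x ∂(volume : Measure (Pos ν)), R ≤ ‖x‖ → ‖B x‖ ≤ C * ‖x‖ ^ (-μ)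

/-- A magnetic field of medium decay on `ℝ²`. -/
def MediumDecay2 (B : Pos 2 → ℝ) : Prop := DecayCondition B

/-- A magnetic field of medium decay on `ℝ³`; in addition, `div B = 0` in `𝓢'`. -/
def MediumDecay3 (B : Pos 3 → Pos 3) : Prop := DecayCondition B ∧ IsDiv B 0

/-- `curl A = B` in `𝓢'(ℝ²)`, where `curl A = ∂₁A₂ - ∂₂A₁`. -/
def IsCurl2 (A : Pos 2 → Pos 2) (B : Pos 2 → ℝ) : Prop :=
  ∀ φ : 𝓢(Pos 2, ℝ), ∫ x, (A x 0 * pd 1 φ x - A x 1 * pd 0 φ x) = ∫ x, B x * φ x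

/-- The curl of a differentiable vector field on `ℝ³`. -/
def curl3 (f : Pos 3 → Pos 3) (x : Pos 3) : Pos 3 :=
  !₂[pd 1 f x 2 - pd 2 f x 1, pd 2 f x 0 - pd 0 f x 2, pd 0 f x 1 - pd 1 f x 0]

/-- `curl A = B` in `𝓢'(ℝ³, ℝ³)`. -/
def IsCurl3 (A B : Pos 3 → Pos 3) : Prop :=
  ∀ φ : 𝓢(Pos 3, Pos 3), ∫ x, inner ℝ (A x) (curl3 φ x) = ∫ x, inner ℝ (B x) (φ x)

/-- The Pauli matrices. -/
def pauli : Fin 3 → Matrix (Fin 2) (Fin 2) ℂ :=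
  ![!![0, 1; 1, 0], !![0, -Complex.I; Complex.I, 0], !![1, 0; 0, -1]]

/-- The matrix `σ·B(x)` for a magnetic field on `ℝ³`. -/
def spin3 (B : Pos 3 → Pos 3) (x : Pos 3) : Spinor →L[ℂ] Spinor :=
  Matrix.toEuclideanCLM (n := Fin 2) (𝕜 := ℂ) (∑ i, ((B x i : ℝ) : ℂ) • pauli i)

/-- The matrix `σ·B(x) = B(x) σ₃` for a magnetic field on `ℝ²`, where the scalar `B(x)` is
identified with the vector `(0, 0, B(x))`. -/
def spin2 (B : Pos 2 → ℝ) (x : Pos 2) : Spinor →L[ℂ] Spinor :=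
  Matrix.toEuclideanCLM (n := Fin 2) (𝕜 := ℂ) (((B x : ℝ) : ℂ) • pauli 2)

/-! ### Quadratic forms and Hamiltonians -/

/-- `u n` is a sequence in the domain of `H` that converges to `ψ` and is Cauchy for the quadratic
form `(u, H u)`. -/
def FormApprox {𝓗 : Type} [NormedAddCommGroup 𝓗] [InnerProductSpace ℂ 𝓗]
    (H : 𝓗 →ₗ.[ℂ] 𝓗) (ψ : 𝓗) (u : ℕ → H.domain) : Prop :=
  Tendsto (fun n => (u n : 𝓗)) atTop (𝓝 ψ) ∧
    Tendsto (fun p : ℕ × ℕ =>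
      (inner ℂ ((u p.1 - u p.2 : H.domain) : 𝓗) (H (u p.1 - u p.2))).re) atTop (𝓝 0)

/-- `H` is a self-adjoint operator with form domain `Q`, and its quadratic form equals `q`:
the form domain is obtained from the domain of `H` by completion with respect to the form
`(u, H u)`, and the form is extended to it by continuity.

(Constant sequences show `(u, H u) = q u` on the domain of `H`. So if `q` is bounded below
by a multiple of `‖u‖²`, then such an `H` is bounded below, and this is the usual notion.) -/
structure HasForm {𝓗 : Type} [NormedAddCommGroup 𝓗] [InnerProductSpace ℂ 𝓗] [CompleteSpace 𝓗]
    (H : 𝓗 →ₗ.[ℂ] 𝓗) (Q : Set 𝓗) (q : 𝓗 → ℝ) : Prop where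
  selfAdjoint : IsSelfAdjoint H
  mem_iff : ∀ ψ, ψ ∈ Q ↔ ∃ u, FormApprox H ψ u
  tendsto : ∀ ψ ∈ Q, ∀ u, FormApprox H ψ u →
    Tendsto (fun n => (inner ℂ (u n : 𝓗) (H (u n))).re) atTop (𝓝 (q ψ))

/-- The potential `(-(1/2m) σ·B + A₀)(x)`, applied to a vector `v`; `Z` stands for `σ·B`. -/
def potential (m : ℝ) (Z : Pos ν → F →L[ℂ] F) (A₀ : Pos ν → ℝ) (x : Pos ν) (v : F) : F :=
  -((1 / (2 * m) : ℝ) : ℂ) • Z x v + (A₀ x : ℂ) • v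

/-- The quadratic form
`q_A(ψ, ψ) = (1/2m) ‖(p - A)ψ‖² + (ψ, (-(1/2m) σ·B + A₀)ψ)` with `p = -i∇`, for `ψ ∈ W^1`. -/
def formQ (m : ℝ) (A : Pos ν → Pos ν) (Z : Pos ν → F →L[ℂ] F) (A₀ : Pos ν → ℝ)
    (ψ : L2 ν F) : ℝ :=
  1 / (2 * m) * (∑ j, ∫ x, ‖-Complex.I • partialL2 j ψ x - (A x j : ℂ) • ψ x‖ ^ 2) +
    (∫ x, inner ℂ (ψ x) (potential m Z A₀ x (ψ x))).re

/-- `H` is the Hamiltonian with the potentials `A`, `A₀` and the spin term `Z`: it is self-adjoint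
with form domain `W^1`, and its quadratic form is `q_A`. -/
def IsHamiltonian (m : ℝ) (A : Pos ν → Pos ν) (Z : Pos ν → F →L[ℂ] F) (A₀ : Pos ν → ℝ)
    (H : L2 ν F →ₗ.[ℂ] L2 ν F) : Prop :=
  HasForm H (sobolev ν F 1) (formQ m A Z A₀)

/-- The expanded expression
`(1/2m) [p² - 2 A·p + i div A + A² - σ·B] ψ + A₀ ψ` with `p = -i∇`, `D = div A`, `ψ ∈ W^2`. -/
def expandedHamiltonian (m : ℝ) (A : Pos ν → Pos ν) (D : Pos ν → ℝ) (Z : Pos ν → F →L[ℂ] F)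
    (A₀ : Pos ν → ℝ) (ψ : L2 ν F) (x : Pos ν) : F :=
  ((1 / (2 * m) : ℝ) : ℂ) •
      (-laplacianL2 ψ x - (2 : ℂ) • ∑ j, (A x j : ℂ) • (-Complex.I • partialL2 j ψ x)
        + (Complex.I * (D x : ℂ)) • ψ x + ((‖A x‖ ^ 2 : ℝ) : ℂ) • ψ x - Z x (ψ x))
    + (A₀ x : ℂ) • ψ x

theorem memLp_phase (lam : C(Pos ν, ℝ)) (ψ : L2 ν F) :
    MemLp (fun x => Complex.exp (Complex.I * (lam x : ℂ)) • ψ x) 2 volume := by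
  have hc : Continuous fun x : Pos ν => Complex.exp (Complex.I * (lam x : ℂ)) := by fun_prop
  refine (Lp.memLp ψ).of_le (hc.aestronglyMeasurable.smul (Lp.aestronglyMeasurable ψ)) ?_
  filter_upwards with x
  rw [norm_smul, mul_comm Complex.I, Complex.norm_exp_ofReal_mul_I, one_mul]

/-- Multiplication with `e^{iλ(x)}` on `L²(ℝ^ν, F)`. -/
def phase (lam : C(Pos ν, ℝ)) : L2 ν F →ₗ[ℂ] L2 ν F where
  toFun ψ := (memLp_phase lam ψ).toLp _
  map_add' ψ φ := by
    rw [← MemLp.toLp_add]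
    refine MemLp.toLp_congr _ _ ?_
    filter_upwards [Lp.coeFn_add ψ φ] with x hx
    simp only [Pi.add_apply, hx, smul_add]
  map_smul' c ψ := by
    rw [RingHom.id_apply, ← MemLp.toLp_const_smul]
    refine MemLp.toLp_congr _ _ ?_
    filter_upwards [Lp.coeFn_smul c ψ] with x hx
    simp only [Pi.smul_apply, hx]
    rw [smul_comm]

/-- The assertions about the Hamiltonian with the vector potential `A`, the spin term `Z`
and the scalar potential `A₀`. -/
structure HamiltonianAssertions (m : ℝ) (A : Pos ν → Pos ν) (Z : Pos ν → F →L[ℂ] F)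
    (A₀ : Pos ν → ℝ) : Prop where
  /-- The integrals in `q_A` converge on `W^1`. -/
  form_wellDefined : ∀ ψ ∈ sobolev ν F 1,
    (∀ j, MemLp (fun x => -Complex.I • partialL2 j ψ x - (A x j : ℂ) • ψ x) 2 volume) ∧
    Integrable (fun x => inner ℂ (ψ x) (potential m Z A₀ x (ψ x))) volume
  /-- There is a unique self-adjoint operator with form domain `W^1` and form `q_A`. -/
  existsUnique : ∃! H : L2 ν F →ₗ.[ℂ] L2 ν F, IsHamiltonian m A Z A₀ H
  /-- If `A' = A + grad λ` is of medium range, then `D(H') = e^{iλ} D(H)` and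
  `H' = e^{iλ} H e^{-iλ}`. -/
  gauge : ∀ (lam : C(Pos ν, ℝ)) (A' : Pos ν → Pos ν),
    (∀ x, HasGradientAt lam (A' x - A x) x) → MediumRange A' →
    ∀ H H' : L2 ν F →ₗ.[ℂ] L2 ν F, IsHamiltonian m A Z A₀ H → IsHamiltonian m A' Z A₀ H' →
      H'.domain = H.domain.map (phase lam) ∧
      ∀ (ψ : H'.domain) (φ : H.domain), (φ : L2 ν F) = phase (-lam) (ψ : L2 ν F) →
        H' ψ = phase lam (H φ)
  /-- If `div A` is a bounded function, then `D(H) = W^2`, and `H` is given by the expanded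
  expression. -/
  expanded : ∀ D : Pos ν → ℝ, MemLp D ∞ volume → IsDiv A D →
    ∀ H : L2 ν F →ₗ.[ℂ] L2 ν F, IsHamiltonian m A Z A₀ H →
      (H.domain : Set (L2 ν F)) = sobolev ν F 2 ∧
      ∀ ψ : H.domain, (H ψ : L2 ν F) =ᵐ[volume] expandedHamiltonian m A D Z A₀ (ψ : L2 ν F)

end

end MagneticHamiltonian

open MagneticHamiltonian

namespace MagneticHamiltonian

set_option linter.unusedSectionVars false

noncomputable section

/-! ### Bounded below quadratic forms on the range of an injective self-adjoint operator -/

section Abstract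

variable {𝓗 : Type} [NormedAddCommGroup 𝓗] [InnerProductSpace ℂ 𝓗] [CompleteSpace 𝓗]

/-! Put `S = (H₀ + c)^{-1/2}` and `R = S² = (H₀ + c)⁻¹`, realised as Fourier multipliers. Then `W^1`
is the range of `S`, `W^2` is the range of `R`, and `q_A(S f) = re ⟪f, K f⟫` with a bounded
self-adjoint `K`. The theory of closed semibounded forms thereby reduces to bounded operators. If
`re ⟪f, K f⟫ + c' ‖S f‖² ≥ δ ‖f‖²`, then `K + c' S²` has a bounded inverse `N`. The relation `{(S g,
w) | K g = S w}` is the graph of a self-adjoint operator, whose resolvent at `-c'` is `S N S`. It is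
the only operator with this form (`CoercivePair.existsUnique`), because every competitor is
contained in it by polarisation, and a self-adjoint operator has no proper self-adjoint extension.

Coercivity (`Admissible.coercivePair`) is a KLMN argument. The vector potential is bounded, so it
costs only an arbitrarily small part of the kinetic energy and a multiple of `‖S f‖²`. The potential
is bounded relative to `H₀` with bound `< 1`, and `‖S V S‖ ≤ ‖V S²‖` turns this operator bound into
a form bound with the same constant. The spin term has relative bound `0`: it lies in some `L^p`
with `p ≥ 2`, and `W^2` embeds into `L^∞` for `ν < 4` (`relBounded_of_memLp`).

Gauge covariance follows from the weak description of the graph in `Admissible.mem_graph_iff`,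
because multiplication by `e^{iλ}` preserves `W^1` and carries the form of `A` into that of `A'`
(`sesqForm_phase`).

If `div A` is bounded, testing it against `|η|²` and polarising gives the commutation rule that
expands `(p - A)²` (`Admissible.divergence_identity`). Hence `H` extends the expanded expression on
`W^2`. For large `c` that expression plus `c`, composed with `R`, is at distance `< 1` from the
identity, hence invertible. Since `H + c` is injective, `D(H)` cannot exceed the range of `R`
(`Admissible.expanded`). -/

/-- If `S` and `V` are self-adjoint, then `‖S V S‖ ≤ ‖V S²‖`. -/
theorem norm_mul_mul_le_of_isSelfAdjoint {S V : 𝓗 →L[ℂ] 𝓗} (hS : IsSelfAdjoint S)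
    (hV : IsSelfAdjoint V) : ‖S * V * S‖ ≤ ‖V * S * S‖ := by
  have hsa : IsSelfAdjoint (S * V * S) := by
    rw [isSelfAdjoint_iff, star_mul, star_mul, hS.star_eq, hV.star_eq, mul_assoc]
  -- The norm of the self-adjoint `S V S` is its spectral radius, and `S (V S)` and `(V S) S` have
  -- the same nonzero spectrum.
  have h1 : spectralRadius ℂ (S * V * S) ≤ spectralRadius ℂ (V * S * S) := by
    refine iSup₂_le fun k hk => ?_
    rcases eq_or_ne k 0 with rfl | hk0
    · simp
    · have : k ∈ spectrum ℂ (S * (V * S)) \ {0} := ⟨by rwa [← mul_assoc], hk0⟩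
      rw [spectrum.nonzero_mul_comm] at this
      exact le_iSup₂ (f := fun k (_ : k ∈ spectrum ℂ (V * S * S)) => (‖k‖₊ : ℝ≥0∞)) k this.1
  rcases subsingleton_or_nontrivial 𝓗 with h | h
  · rw [Subsingleton.elim (S * V * S) (V * S * S)]
  · have h2 := hsa.spectralRadius_eq_nnnorm
    rw [h2] at h1
    have h3 := h1.trans (spectrum.spectralRadius_le_nnnorm (V * S * S))
    exact_mod_cast h3

/-- Self-adjoint operators without proper self-adjoint extensions. -/
theorem eq_of_le_of_isSelfAdjoint {H T : 𝓗 →ₗ.[ℂ] 𝓗} (hH : IsSelfAdjoint H)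
    (hT : IsSelfAdjoint T) (hle : H ≤ T) : H = T := by
  refine le_antisymm hle ?_
  have h1 : T.IsFormalAdjoint T := by
    have := LinearPMap.adjoint_isFormalAdjoint hT.dense_domain
    rwa [LinearPMap.isSelfAdjoint_def.1 hT] at this
  -- Symmetry of `T`, restricted to `D(H)` on one side, gives `T ≤ H† = H`.
  have h2 : H.IsFormalAdjoint T := by
    intro x y
    have hx := hle.2 (x := x) (y := ⟨x, hle.1 x.2⟩) rfl
    rw [hx]
    exact h1 _ y
  have := h2.le_adjoint hH.dense_domain
  rwa [LinearPMap.isSelfAdjoint_def.1 hH] at this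

/-- The form `re ⟪f, K f⟫`, transported to the range of `S`, is symmetric, closed and
bounded below. -/
structure CoercivePair (S K : 𝓗 →L[ℂ] 𝓗) (c δ : ℝ) : Prop where
  selfAdjoint_left : IsSelfAdjoint S
  injective : Function.Injective S
  selfAdjoint_right : IsSelfAdjoint K
  pos : 0 < δ
  coercive : ∀ f, δ * ‖f‖ ^ 2 ≤ (inner ℂ f (K f)).re + c * ‖S f‖ ^ 2

variable {S K : 𝓗 →L[ℂ] 𝓗} {c δ : ℝ}

theorem inner_apply_eq_of_isSelfAdjoint {T : 𝓗 →L[ℂ] 𝓗} (hT : IsSelfAdjoint T) (f g : 𝓗) :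
    inner ℂ (T f) g = inner ℂ f (T g) :=
  hT.isSymmetric f g

/-- Lax–Milgram: coercivity bounds the numerical range of the self-adjoint `K + c S²` away from `0`.
-/
theorem CoercivePair.exists_inverse (h : CoercivePair S K c δ) :
    ∃ N : 𝓗 →L[ℂ] 𝓗, IsSelfAdjoint N ∧
      (∀ f, N (K f + (c : ℂ) • S (S f)) = f) ∧ (∀ f, K (N f) + (c : ℂ) • S (S (N f)) = f) := by
  set M : 𝓗 →L[ℂ] 𝓗 := K + (c : ℂ) • (S * S)
  have hM : IsUnit M := by
    refine ContinuousLinearMap.isUnit_of_forall_le_norm_inner_map M (c := ⟨δ, h.pos.le⟩)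
      h.pos fun x => ?_
    have h1 := h.coercive x
    have h2 : (inner ℂ (M x) x).re = (inner ℂ x (K x)).re + c * ‖S x‖ ^ 2 := by
      have : inner ℂ (S (S x)) x = ((‖S x‖ ^ 2 : ℝ) : ℂ) := by
        rw [inner_apply_eq_of_isSelfAdjoint h.selfAdjoint_left, inner_self_eq_norm_sq_to_K]
        norm_cast
      rw [show M x = K x + (c : ℂ) • S (S x) from rfl, inner_add_left, inner_smul_left, this,
        inner_apply_eq_of_isSelfAdjoint h.selfAdjoint_right, Complex.conj_ofReal, Complex.add_re,
        ← Complex.ofReal_mul, Complex.ofReal_re]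
    calc ‖x‖ ^ 2 * δ ≤ (inner ℂ (M x) x).re := by rw [h2]; linarith
      _ ≤ _ := Complex.re_le_norm _
  have hMsa : IsSelfAdjoint M := by
    refine h.selfAdjoint_right.add ?_
    rw [isSelfAdjoint_iff, star_smul, star_mul, h.selfAdjoint_left.star_eq]
    simp
  obtain ⟨u, hu⟩ := hM
  refine ⟨(↑u⁻¹ : 𝓗 →L[ℂ] 𝓗), ?_, fun f => ?_, fun f => ?_⟩
  · have : star u = u := Units.ext (by rw [Units.coe_star, hu, hMsa.star_eq])
    rw [isSelfAdjoint_iff, ← Units.coe_star_inv, this]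
  · have := congrArg (fun T : 𝓗 →L[ℂ] 𝓗 => T f) (Units.inv_mul u)
    simpa [hu, M] using this
  · have := congrArg (fun T : 𝓗 →L[ℂ] 𝓗 => T f) (Units.mul_inv u)
    simpa [hu, M] using this

/-- The graph of the operator with the form `re ⟪f, K f⟫` on the range of `S`. -/
def formGraph (S K : 𝓗 →L[ℂ] 𝓗) : Submodule ℂ (𝓗 × 𝓗) where
  carrier := {p | ∃ g, S g = p.1 ∧ K g = S p.2}
  add_mem' := by
    rintro p q ⟨g, h1, h2⟩ ⟨g', h1', h2'⟩
    exact ⟨g + g', by simp [h1, h1'], by simp [h2, h2']⟩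
  zero_mem' := ⟨0, by simp, by simp⟩
  smul_mem' := by
    rintro a p ⟨g, h1, h2⟩
    exact ⟨a • g, by simp [h1], by simp [h2]⟩

theorem mem_formGraph {u w : 𝓗} : (u, w) ∈ formGraph S K ↔ ∃ g, S g = u ∧ K g = S w := Iff.rfl

/-- The relation is single-valued because `S g = 0` forces `g = 0`, after which `S w = 0` forces `w
= 0`. -/
theorem CoercivePair.graph_toLinearPMap (h : CoercivePair S K c δ) :
    (formGraph S K).toLinearPMap.graph = formGraph S K := by
  refine Submodule.toLinearPMap_graph_eq _ ?_
  rintro ⟨x, y⟩ ⟨g, h1, h2⟩ (rfl : x = 0)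
  have hg : g = 0 := h.injective (by simpa using h1)
  subst hg
  exact h.injective (by simpa using h2.symm)

theorem dense_range_of_isSelfAdjoint (hS : IsSelfAdjoint S) (hinj : Function.Injective S) :
    DenseRange S := by
  have h1 : (S.range)ᗮ = ⊥ := by
    rw [ContinuousLinearMap.orthogonal_range, ← ContinuousLinearMap.star_eq_adjoint, hS.star_eq]
    exact LinearMap.ker_eq_bot.2 hinj
  have h2 := (Submodule.topologicalClosure_eq_top_iff (K := S.range)).2 h1
  have h3 := Submodule.dense_iff_topologicalClosure_eq_top.2 h2
  exact h3

/-- The operator domain is a form core. Approximating `K f + c S² f` by vectors `S k` and applying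
`N` gives approximants of `f`, for which `K N (S k) = S (k - c S N (S k))` stays in the range of
`S`. -/
theorem CoercivePair.exists_seq_tendsto (h : CoercivePair S K c δ) (f : 𝓗) :
    ∃ g w : ℕ → 𝓗, Tendsto g atTop (𝓝 f) ∧ ∀ n, K (g n) = S (w n) := by
  obtain ⟨N, hN, hN1, hN2⟩ := h.exists_inverse
  have hd := dense_range_of_isSelfAdjoint h.selfAdjoint_left h.injective
  obtain ⟨v, hv, hv'⟩ := mem_closure_iff_seq_limit.1 (hd (K f + (c : ℂ) • S (S f)))
  choose k hk using hv
  refine ⟨fun n => N (v n), fun n => k n - (c : ℂ) • S (N (v n)), ?_, fun n => ?_⟩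
  · have := (N.continuous.tendsto _).comp hv'
    rwa [hN1] at this
  · have := hN2 (v n)
    rw [map_sub, map_smul, hk, eq_sub_iff_add_eq]
    exact this

/-- The operator has the everywhere defined symmetric resolvent `S N S` at `-c`, so membership of
`(u, w)` in the graph is the single equation `u = S N S (w + c u)`, and the adjoint graph satisfies
the same equation. -/
theorem CoercivePair.isSelfAdjoint_toLinearPMap (h : CoercivePair S K c δ) :
    IsSelfAdjoint (formGraph S K).toLinearPMap := by
  obtain ⟨N, hN, hN1, hN2⟩ := h.exists_inverse
  have hmem : ∀ u w : 𝓗, (u, w) ∈ formGraph S K ↔ u = S (N (S (w + (c : ℂ) • u))) := by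
    intro u w
    rw [mem_formGraph]
    constructor
    · rintro ⟨g, rfl, h2⟩
      rw [map_add, map_smul, ← h2, hN1]
    · intro hu
      refine ⟨N (S (w + (c : ℂ) • u)), hu.symm, ?_⟩
      have := hN2 (S (w + (c : ℂ) • u))
      rw [← hu, map_add, map_smul] at this
      simpa using this
  have hdense : Dense ((formGraph S K).toLinearPMap.domain : Set 𝓗) := by
    intro x
    have hd := dense_range_of_isSelfAdjoint h.selfAdjoint_left h.injective
    refine closure_minimal ?_ isClosed_closure (hd x)
    rintro _ ⟨f, rfl⟩
    obtain ⟨g, w, hg, hw⟩ := h.exists_seq_tendsto f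
    refine mem_closure_of_tendsto ((S.continuous.tendsto _).comp hg)
      (Eventually.of_forall fun n => ?_)
    refine LinearPMap.mem_domain_of_mem_graph (y := w n) ?_
    rw [h.graph_toLinearPMap]
    exact ⟨g n, rfl, hw n⟩
  rw [LinearPMap.isSelfAdjoint_def]
  refine LinearPMap.eq_of_eq_graph ?_
  rw [LinearPMap.adjoint_graph_eq_graph_adjoint hdense, h.graph_toLinearPMap]
  ext ⟨x, y⟩
  rw [Submodule.mem_adjoint_iff, hmem]
  have hG : ∀ a b, inner ℂ (S (N (S a))) b = inner ℂ a (S (N (S b))) := by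
    intro a b
    rw [inner_apply_eq_of_isSelfAdjoint h.selfAdjoint_left, inner_apply_eq_of_isSelfAdjoint hN,
      inner_apply_eq_of_isSelfAdjoint h.selfAdjoint_left]
  constructor
  · intro hxy
    refine ext_inner_left ℂ fun k => ?_
    -- These pairs, for arbitrary `k`, exhaust the graph, so testing against them identifies `x`
    -- weakly.
    have := hxy (S (N (S k))) (k - (c : ℂ) • S (N (S k))) ((hmem _ _).2 (by simp))
    simp only [inner_sub_left, inner_smul_left, Complex.conj_ofReal, hG] at this
    rw [map_add, map_smul, map_add, map_smul, map_add, map_smul, inner_add_right,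
      inner_smul_right]
    linear_combination this
  · intro hx a b hab
    have ha := (hmem _ _).1 hab
    have h1 : inner ℂ (b + (c : ℂ) • a) x = inner ℂ a (y + (c : ℂ) • x) := by
      conv_lhs => rw [hx]
      rw [← hG, ← ha]
    simp only [inner_add_left, inner_add_right, inner_smul_left, inner_smul_right,
      Complex.conj_ofReal] at h1
    linear_combination h1

/-- This is closedness of the form: coercivity makes the preimages under `S` of a form-Cauchy
sequence Cauchy in norm. -/
theorem CoercivePair.cauchySeq_of_formApprox (h : CoercivePair S K c δ) {H : 𝓗 →ₗ.[ℂ] 𝓗}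
    (hH : ∀ (u : H.domain) (g : 𝓗), (u : 𝓗) = S g →
      (inner ℂ (u : 𝓗) (H u)).re = (inner ℂ g (K g)).re)
    {ψ : 𝓗} {u : ℕ → H.domain} (hu : FormApprox H ψ u) {g : ℕ → 𝓗}
    (hg : ∀ n, (u n : 𝓗) = S (g n)) : ∃ f, Tendsto g atTop (𝓝 f) ∧ S f = ψ := by
  suffices hc : CauchySeq g by
    obtain ⟨f, hf⟩ := cauchySeq_tendsto_of_complete hc
    refine ⟨f, hf, tendsto_nhds_unique ((S.continuous.tendsto _).comp hf) ?_⟩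
    simpa [Function.comp_def, ← hg] using hu.1
  have h1 : Tendsto (fun p : ℕ × ℕ => ‖S (g p.1 - g p.2)‖) atTop (𝓝 0) := by
    have : CauchySeq fun n => (u n : 𝓗) := hu.1.cauchySeq
    have := cauchySeq_iff_tendsto_dist_atTop_0.1 this
    simpa [dist_eq_norm, hg] using this
  have h2 : Tendsto (fun p : ℕ × ℕ => (inner ℂ (g p.1 - g p.2) (K (g p.1 - g p.2))).re)
      atTop (𝓝 0) := by
    refine hu.2.congr fun p => hH _ _ ?_
    simp [hg]
  rw [cauchySeq_iff_tendsto_dist_atTop_0]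
  have h3 : Tendsto (fun p : ℕ × ℕ => δ⁻¹ *
      ((inner ℂ (g p.1 - g p.2) (K (g p.1 - g p.2))).re + c * ‖S (g p.1 - g p.2)‖ ^ 2))
      atTop (𝓝 0) := by
    simpa using (h2.add ((h1.pow 2).const_mul c)).const_mul δ⁻¹
  have h4 : Tendsto (fun p : ℕ × ℕ => ‖g p.1 - g p.2‖ ^ 2) atTop (𝓝 0) := by
    refine squeeze_zero (fun _ => by positivity) (fun p => ?_) h3
    rw [le_inv_mul_iff₀ h.pos]
    exact h.coercive _
  simpa [dist_eq_norm] using h4.sqrt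

theorem CoercivePair.hasForm (h : CoercivePair S K c δ) {q : 𝓗 → ℝ}
    (hq : ∀ f, q (S f) = (inner ℂ f (K f)).re) :
    HasForm (formGraph S K).toLinearPMap (Set.range S) q := by
  set H := (formGraph S K).toLinearPMap
  have hgr : ∀ u : H.domain, ∃ g, S g = u ∧ K g = S (H u) := fun u => by
    have := H.mem_graph u
    rw [h.graph_toLinearPMap] at this
    exact this
  have hH : ∀ (u : H.domain) (g : 𝓗), (u : 𝓗) = S g →
      (inner ℂ (u : 𝓗) (H u)).re = (inner ℂ g (K g)).re := by
    intro u g hu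
    obtain ⟨g', h1, h2⟩ := hgr u
    have : g' = g := h.injective (h1.trans hu)
    subst this
    rw [hu, inner_apply_eq_of_isSelfAdjoint h.selfAdjoint_left, h2]
  choose G hG hG' using hgr
  refine ⟨h.isSelfAdjoint_toLinearPMap, fun ψ => ⟨?_, ?_⟩, ?_⟩
  · rintro ⟨f, rfl⟩
    obtain ⟨g, w, hg, hw⟩ := h.exists_seq_tendsto f
    have hd : ∀ n, S (g n) ∈ H.domain := fun n => by
      refine LinearPMap.mem_domain_of_mem_graph (y := w n) ?_
      rw [h.graph_toLinearPMap]
      exact ⟨g n, rfl, hw n⟩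
    refine ⟨fun n => ⟨S (g n), hd n⟩, (S.continuous.tendsto _).comp hg, ?_⟩
    have h1 : Tendsto (fun p : ℕ × ℕ => g p.1 - g p.2) atTop (𝓝 0) := by
      have := (hg.comp tendsto_fst).sub (hg.comp tendsto_snd)
      rw [sub_self, prod_atTop_atTop_eq] at this
      exact this
    have h2 : Tendsto (fun p : ℕ × ℕ => (inner ℂ (g p.1 - g p.2) (K (g p.1 - g p.2))).re)
        atTop (𝓝 0) := by
      have hcont : Continuous fun x : 𝓗 => (inner ℂ x (K x)).re := by fun_prop
      have := (hcont.tendsto 0).comp h1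
      rwa [map_zero, inner_zero_left] at this
    refine h2.congr fun p => (hH _ _ ?_).symm
    simp
  · rintro ⟨u, hu⟩
    obtain ⟨f, -, hf⟩ := h.cauchySeq_of_formApprox hH hu (fun n => (hG (u n)).symm)
    exact ⟨f, hf⟩
  · rintro ψ - u hu
    obtain ⟨f, hf, rfl⟩ := h.cauchySeq_of_formApprox hH hu (fun n => (hG (u n)).symm)
    rw [hq]
    have hcont : Continuous fun x : 𝓗 => (inner ℂ x (K x)).re := by fun_prop
    refine ((hcont.tendsto f).comp hf).congr fun n => (hH _ _ (hG (u n)).symm).symm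

/-- By maximality of self-adjoint operators it suffices to show `K g = S (H u)` whenever `u = S g`
lies in `D(H)`. This is checked on the form core formed by `D(H)` itself. -/
theorem CoercivePair.eq_of_hasForm (h : CoercivePair S K c δ) {q : 𝓗 → ℝ}
    (hq : ∀ f, q (S f) = (inner ℂ f (K f)).re) {H : 𝓗 →ₗ.[ℂ] 𝓗}
    (hH : HasForm H (Set.range S) q) : H = (formGraph S K).toLinearPMap := by
  refine eq_of_le_of_isSelfAdjoint hH.selfAdjoint h.isSelfAdjoint_toLinearPMap ?_
  refine LinearPMap.le_of_le_graph ?_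
  rw [h.graph_toLinearPMap]
  -- Constant sequences show that `D(H)` lies in the form domain and that `q` is `(u, H u)` there.
  have hconst : ∀ u : H.domain, FormApprox H (u : 𝓗) fun _ => u := fun u =>
    ⟨tendsto_const_nhds, by simp⟩
  have hex : ∀ u : H.domain, ∃ g, S g = u := fun u => (hH.mem_iff _).2 ⟨_, hconst u⟩
  choose G hG using hex
  have hval : ∀ (u : H.domain) (g : 𝓗), (u : 𝓗) = S g →
      (inner ℂ (u : 𝓗) (H u)).re = (inner ℂ g (K g)).re := by
    intro u g hu
    have := tendsto_nhds_unique (hH.tendsto _ ⟨g, hu.symm⟩ _ (hconst u)) tendsto_const_nhds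
    rw [← this, hu, hq]
  have hsymm : H.IsFormalAdjoint H := by
    have := LinearPMap.adjoint_isFormalAdjoint hH.selfAdjoint.dense_domain
    rwa [LinearPMap.isSelfAdjoint_def.1 hH.selfAdjoint] at this
  have hG_add : ∀ u v, G (u + v) = G u + G v := fun u v => h.injective (by simp [hG])
  -- Polarisation: the values at `u + v`, `u` and `v`, together with symmetry of `H` and `K`,
  -- determine the real part; replacing `v` by `i v` then gives the imaginary part.
  have hre : ∀ u v : H.domain,
      (inner ℂ (v : 𝓗) (H u)).re = (inner ℂ (G v) (K (G u))).re := by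
    intro u v
    have h1 := hval (u + v) _ (hG _).symm
    have hu := hval u _ (hG _).symm
    have hv := hval v _ (hG _).symm
    rw [hG_add] at h1
    simp only [LinearPMap.map_add, Submodule.coe_add, map_add, inner_add_left, inner_add_right,
      Complex.add_re] at h1
    have e1 : (inner ℂ (u : 𝓗) (H v)).re = (inner ℂ (v : 𝓗) (H u)).re := by
      rw [← hsymm u v, ← inner_conj_symm, Complex.conj_re]
    have e2 : (inner ℂ (G u) (K (G v))).re = (inner ℂ (G v) (K (G u))).re := by
      rw [← inner_apply_eq_of_isSelfAdjoint h.selfAdjoint_right, ← inner_conj_symm,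
        Complex.conj_re]
    linarith
  have hinner : ∀ u v : H.domain, inner ℂ (v : 𝓗) (H u) = inner ℂ (G v) (K (G u)) := by
    intro u v
    refine Complex.ext (hre u v) ?_
    have := hre u (Complex.I • v)
    have hI : G (Complex.I • v) = Complex.I • G v := h.injective (by simp [hG])
    rw [hI] at this
    simpa [inner_smul_left] using this
  rintro ⟨u', w⟩ huw
  obtain ⟨u, rfl, rfl⟩ := (LinearPMap.mem_graph_iff H).1 huw
  refine ⟨G u, hG u, ext_inner_left ℂ fun f => ?_⟩
  -- Each `S f` is a form limit of vectors in `D(H)`, so the identity on `D(H)` extends to all test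
  -- vectors `f`.
  obtain ⟨v, hv⟩ := (hH.mem_iff (S f)).1 ⟨f, rfl⟩
  obtain ⟨f', hf', hSf⟩ := h.cauchySeq_of_formApprox hval hv (fun n => (hG (v n)).symm)
  obtain rfl : f' = f := h.injective hSf
  have h1 : Tendsto (fun n => inner ℂ (G (v n)) (K (G u))) atTop (𝓝 (inner ℂ f' (K (G u)))) :=
    hf'.inner tendsto_const_nhds
  have h2 : Tendsto (fun n => inner ℂ (v n : 𝓗) (H u)) atTop (𝓝 (inner ℂ (S f') (H u))) :=
    hv.1.inner tendsto_const_nhds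
  simp only [hinner] at h2
  rw [tendsto_nhds_unique h1 h2, inner_apply_eq_of_isSelfAdjoint h.selfAdjoint_left]

theorem CoercivePair.existsUnique (h : CoercivePair S K c δ) {q : 𝓗 → ℝ}
    (hq : ∀ f, q (S f) = (inner ℂ f (K f)).re) :
    ∃! H : 𝓗 →ₗ.[ℂ] 𝓗, HasForm H (Set.range S) q :=
  ⟨_, h.hasForm hq, fun _ hH => h.eq_of_hasForm hq hH⟩

theorem CoercivePair.mem_graph_iff (h : CoercivePair S K c δ) {q : 𝓗 → ℝ}
    (hq : ∀ f, q (S f) = (inner ℂ f (K f)).re) {H : 𝓗 →ₗ.[ℂ] 𝓗}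
    (hH : HasForm H (Set.range S) q) {u w : 𝓗} :
    (u, w) ∈ H.graph ↔ ∃ g, S g = u ∧ K g = S w := by
  rw [h.eq_of_hasForm hq hH, h.graph_toLinearPMap, mem_formGraph]

end Abstract

end

noncomputable section

variable {ν : ℕ} {F : Type} [NormedAddCommGroup F] [InnerProductSpace ℂ F] [CompleteSpace F]

/-! ### Multiplication operators on `L²` -/

/-- Pointwise multiplication with `L`, after `T`, is bounded on `L²` with norm at most `C`. -/
structure PointwiseBound (L : Pos ν → F →L[ℂ] F) (T : L2 ν F →L[ℂ] L2 ν F) (C : ℝ) : Prop where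
  nonneg : 0 ≤ C
  aestronglyMeasurable : AEStronglyMeasurable L volume
  bound : ∀ f, eLpNorm (fun x => L x (T f x)) 2 volume ≤ ENNReal.ofReal (C * ‖f‖)

variable {L : Pos ν → F →L[ℂ] F} {T : L2 ν F →L[ℂ] L2 ν F} {C : ℝ}

theorem aestronglyMeasurable_clm_apply (hL : AEStronglyMeasurable L volume) {u : Pos ν → F}
    (hu : AEStronglyMeasurable u volume) :
    AEStronglyMeasurable (fun x => L x (u x)) volume :=
  (ContinuousLinearMap.apply ℂ F).flip.aestronglyMeasurable_comp₂ hL hu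

theorem PointwiseBound.memLp (h : PointwiseBound L T C) (f : L2 ν F) :
    MemLp (fun x => L x (T f x)) 2 volume :=
  ⟨aestronglyMeasurable_clm_apply h.aestronglyMeasurable (Lp.aestronglyMeasurable _),
    (h.bound f).trans_lt ENNReal.ofReal_lt_top⟩

open scoped Classical in
/-- The operator `f ↦ L · T f` on `L²`, with value `0` if it is not bounded. -/
def pmul (L : Pos ν → F →L[ℂ] F) (T : L2 ν F →L[ℂ] L2 ν F) : L2 ν F →L[ℂ] L2 ν F :=
  if h : ∃ C, PointwiseBound L T C then
    LinearMap.mkContinuous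
      { toFun := fun f => (h.choose_spec.memLp f).toLp _
        map_add' := fun f g => by
          rw [← MemLp.toLp_add]
          refine MemLp.toLp_congr _ _ ?_
          rw [map_add]
          filter_upwards [Lp.coeFn_add (T f) (T g)] with x hx
          simp only [Pi.add_apply, hx, map_add]
        map_smul' := fun a f => by
          rw [RingHom.id_apply, ← MemLp.toLp_const_smul]
          refine MemLp.toLp_congr _ _ ?_
          rw [map_smul]
          filter_upwards [Lp.coeFn_smul a (T f)] with x hx
          simp only [Pi.smul_apply, hx, map_smul] }
      h.choose
      (fun f => by
        have h' := h.choose_spec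
        refine (Lp.norm_toLp _ (h'.memLp f)).le.trans ?_
        refine ENNReal.toReal_le_of_le_ofReal ?_ (h'.bound f)
        exact mul_nonneg h'.nonneg (norm_nonneg _))
  else 0

theorem PointwiseBound.coeFn_pmul (h : PointwiseBound L T C) (f : L2 ν F) :
    pmul L T f =ᵐ[volume] fun x => L x (T f x) := by
  have h' : ∃ C, PointwiseBound L T C := ⟨C, h⟩
  rw [pmul, dif_pos h']
  exact (h'.choose_spec.memLp f).coeFn_toLp

theorem PointwiseBound.norm_pmul_le (h : PointwiseBound L T C) : ‖pmul L T‖ ≤ C := by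
  refine ContinuousLinearMap.opNorm_le_bound _ h.nonneg fun f => ?_
  rw [Lp.norm_def, eLpNorm_congr_ae (h.coeFn_pmul f)]
  exact ENNReal.toReal_le_of_le_ofReal (mul_nonneg h.nonneg (norm_nonneg _)) (h.bound f)

theorem pointwiseBound_of_ae_bound (T : L2 ν F →L[ℂ] L2 ν F) (hC : 0 ≤ C)
    (hL : AEStronglyMeasurable L volume) (hb : ∀ᵐ x, ‖L x‖ ≤ C) :
    PointwiseBound L T (C * ‖T‖) where
  nonneg := by positivity
  aestronglyMeasurable := hL
  bound f := by
    have h1 : eLpNorm (fun x => L x (T f x)) 2 volume ≤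
        ENNReal.ofReal C * eLpNorm (T f) 2 volume := by
      refine eLpNorm_le_mul_eLpNorm_of_ae_le_mul ?_ 2
      filter_upwards [hb] with x hx
      exact (L x).le_of_opNorm_le hx _
    refine h1.trans ?_
    have h2 : eLpNorm (T f) 2 volume = ENNReal.ofReal ‖T f‖ := by
      rw [Lp.norm_def, ENNReal.ofReal_toReal (Lp.eLpNorm_ne_top _)]
    rw [h2, ← ENNReal.ofReal_mul hC]
    refine ENNReal.ofReal_le_ofReal ?_
    rw [mul_assoc]
    exact mul_le_mul_of_nonneg_left (T.le_opNorm f) hC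

theorem L2_inner_eq (f g : L2 ν F) : inner ℂ f g = ∫ x, inner ℂ (f x) (g x) :=
  MeasureTheory.L2.inner_def f g

theorem isSelfAdjoint_pmul_one (h : PointwiseBound L 1 C) (hL : ∀ᵐ x, IsSelfAdjoint (L x)) :
    IsSelfAdjoint (pmul L 1) := by
  rw [ContinuousLinearMap.isSelfAdjoint_iff_isSymmetric]
  intro f g
  rw [ContinuousLinearMap.coe_coe, L2_inner_eq, L2_inner_eq]
  refine integral_congr_ae ?_
  filter_upwards [h.coeFn_pmul f, h.coeFn_pmul g, hL] with x h1 h2 h3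
  rw [h1, h2]
  exact h3.isSymmetric _ _

/-- A real function, as a function with values in the multiples of the identity. -/
def scalarOp (F : Type) [NormedAddCommGroup F] [InnerProductSpace ℂ F] (v : Pos ν → ℝ)
    (x : Pos ν) : F →L[ℂ] F :=
  (v x : ℂ) • ContinuousLinearMap.id ℂ F

theorem scalarOp_apply (v : Pos ν → ℝ) (x : Pos ν) (y : F) :
    scalarOp F v x y = (v x : ℂ) • y := rfl

theorem isSelfAdjoint_scalarOp (v : Pos ν → ℝ) (x : Pos ν) : IsSelfAdjoint (scalarOp F v x) := by
  rw [ContinuousLinearMap.isSelfAdjoint_iff_isSymmetric]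
  intro a b
  simp only [ContinuousLinearMap.coe_coe, scalarOp_apply, inner_smul_left, inner_smul_right,
    Complex.conj_ofReal]

theorem aestronglyMeasurable_scalarOp {v : Pos ν → ℝ} (hv : AEMeasurable v volume) :
    AEStronglyMeasurable (scalarOp F v) volume :=
  (Complex.measurable_ofReal.comp_aemeasurable hv).aestronglyMeasurable.smul_const _

theorem norm_scalarOp_le (v : Pos ν → ℝ) (x : Pos ν) : ‖scalarOp F v x‖ ≤ |v x| := by
  refine ContinuousLinearMap.opNorm_le_bound _ (abs_nonneg _) fun y => ?_
  rw [scalarOp_apply, norm_smul, Complex.norm_real, Real.norm_eq_abs]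

theorem pointwiseBound_scalarOp {v : Pos ν → ℝ} (hv : AEMeasurable v volume)
    (hC : ∀ x, |v x| ≤ C) (T : L2 ν F →L[ℂ] L2 ν F) :
    PointwiseBound (scalarOp F v) T (C * ‖T‖) :=
  pointwiseBound_of_ae_bound T ((abs_nonneg _).trans (hC 0)) (aestronglyMeasurable_scalarOp hv)
    (Eventually.of_forall fun x => (norm_scalarOp_le v x).trans (hC x))

/-! ### Fourier multipliers on `L²` -/

/-- Bounded measurable real symbols. -/
structure BddSymbol (g : Pos ν → ℝ) : Prop where
  measurable : Measurable g
  bdd : ∃ C, ∀ ξ, |g ξ| ≤ C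

theorem BddSymbol.mul {g h : Pos ν → ℝ} (hg : BddSymbol g) (hh : BddSymbol h) :
    BddSymbol fun ξ => g ξ * h ξ := by
  obtain ⟨C, hC⟩ := hg.bdd
  obtain ⟨D, hD⟩ := hh.bdd
  refine ⟨hg.measurable.mul hh.measurable, C * D, fun ξ => ?_⟩
  rw [abs_mul]
  exact mul_le_mul (hC ξ) (hD ξ) (abs_nonneg _) ((abs_nonneg _).trans (hC ξ))

theorem bddSymbol_one : BddSymbol fun _ : Pos ν => (1 : ℝ) :=
  ⟨measurable_const, 1, fun _ => by simp⟩

open FourierTransform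

/-- The Fourier multiplier with the bounded real symbol `g`, as an operator on `L²`. -/
def fmul (g : Pos ν → ℝ) : L2 ν F →L[ℂ] L2 ν F :=
  ((Lp.fourierTransformₗᵢ (Pos ν) F).symm : L2 ν F →L[ℂ] L2 ν F) ∘L
    (pmul (scalarOp F g) 1) ∘L ((Lp.fourierTransformₗᵢ (Pos ν) F) : L2 ν F →L[ℂ] L2 ν F)

variable {g h : Pos ν → ℝ}

theorem fourier_fmul (g : Pos ν → ℝ) (f : L2 ν F) :
    𝓕 (fmul g f) = pmul (scalarOp F g) 1 (𝓕 f) :=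
  (Lp.fourierTransformₗᵢ (Pos ν) F).apply_symm_apply _

theorem BddSymbol.coeFn_pmul (hg : BddSymbol g) (f : L2 ν F) :
    pmul (scalarOp F g) 1 f =ᵐ[volume] fun ξ => (g ξ : ℂ) • f ξ := by
  obtain ⟨C, hC⟩ := hg.bdd
  exact (pointwiseBound_scalarOp hg.measurable.aemeasurable hC 1).coeFn_pmul f

theorem BddSymbol.coeFn_fourier_fmul (hg : BddSymbol g) (f : L2 ν F) :
    (𝓕 (fmul g f) : L2 ν F) =ᵐ[volume] fun ξ => (g ξ : ℂ) • (𝓕 f : L2 ν F) ξ := by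
  rw [fourier_fmul]
  exact hg.coeFn_pmul _

theorem fourier_L2_injective : Function.Injective fun f : L2 ν F => (𝓕 f : L2 ν F) :=
  (Lp.fourierTransformₗᵢ (Pos ν) F).injective

theorem BddSymbol.fmul_eq (hg : BddSymbol g) {f u : L2 ν F}
    (hu : (𝓕 u : L2 ν F) =ᵐ[volume] fun ξ => (g ξ : ℂ) • (𝓕 f : L2 ν F) ξ) : fmul g f = u :=
  fourier_L2_injective (Lp.ext ((hg.coeFn_fourier_fmul f).trans hu.symm))

theorem fmul_fmul (hg : BddSymbol g) (hh : BddSymbol h) (f : L2 ν F) :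
    fmul g (fmul h f) = fmul (fun ξ => g ξ * h ξ) f := by
  refine ((hg.mul hh).fmul_eq ?_).symm
  filter_upwards [hg.coeFn_fourier_fmul (fmul h f), hh.coeFn_fourier_fmul f] with ξ h1 h2
  rw [h1, h2, smul_smul, Complex.ofReal_mul]

theorem fmul_one (f : L2 ν F) : fmul (fun _ => 1) f = f :=
  bddSymbol_one.fmul_eq (by simp)

theorem fmul_add (hg : BddSymbol g) (hh : BddSymbol h) (f : L2 ν F) :
    fmul g f + fmul h f = fmul (fun ξ => g ξ + h ξ) f := by
  obtain ⟨C, hC⟩ := hg.bdd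
  obtain ⟨D, hD⟩ := hh.bdd
  have hb : BddSymbol fun ξ => g ξ + h ξ :=
    ⟨hg.measurable.add hh.measurable, C + D, fun ξ =>
      (abs_add_le _ _).trans (add_le_add (hC ξ) (hD ξ))⟩
  refine (hb.fmul_eq ?_).symm
  rw [FourierTransform.fourier_add]
  filter_upwards [hg.coeFn_fourier_fmul f, hh.coeFn_fourier_fmul f,
    Lp.coeFn_add (𝓕 (fmul g f)) (𝓕 (fmul h f))] with ξ h1 h2 h3
  rw [h3, Pi.add_apply, h1, h2, ← add_smul, Complex.ofReal_add]

theorem fmul_const_mul (hg : BddSymbol g) (a : ℝ) (f : L2 ν F) :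
    fmul (fun ξ => a * g ξ) f = (a : ℂ) • fmul g f := by
  have hb : BddSymbol fun ξ => a * g ξ :=
    (⟨measurable_const, |a|, fun _ => le_rfl⟩ : BddSymbol fun _ : Pos ν => a).mul hg
  refine hb.fmul_eq ?_
  rw [FourierTransform.fourier_smul]
  filter_upwards [hg.coeFn_fourier_fmul f, Lp.coeFn_smul (a : ℂ) (𝓕 (fmul g f))] with ξ h1 h3
  rw [h3, Pi.smul_apply, h1, smul_smul, Complex.ofReal_mul]

theorem isSelfAdjoint_fmul (hg : BddSymbol g) : IsSelfAdjoint (fmul g : L2 ν F →L[ℂ] L2 ν F) := by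
  obtain ⟨C, hC⟩ := hg.bdd
  have h1 := isSelfAdjoint_pmul_one (F := F)
    (pointwiseBound_scalarOp hg.measurable.aemeasurable hC 1)
    (Eventually.of_forall (isSelfAdjoint_scalarOp g))
  rw [ContinuousLinearMap.isSelfAdjoint_iff_isSymmetric]
  intro f k
  change inner ℂ (fmul g f) k = inner ℂ f (fmul g k)
  rw [← Lp.inner_fourier_eq, ← Lp.inner_fourier_eq f, fourier_fmul, fourier_fmul]
  exact h1.isSymmetric _ _

theorem fmul_injective (hg : BddSymbol g) (h0 : ∀ ξ, g ξ ≠ 0) :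
    Function.Injective (fmul g : L2 ν F →L[ℂ] L2 ν F) := by
  rw [injective_iff_map_eq_zero]
  intro f hf
  refine fourier_L2_injective (Lp.ext ?_)
  have h1 := hg.coeFn_fourier_fmul f
  rw [hf] at h1
  have h2 : 𝓕 (0 : L2 ν F) = 0 := map_zero (Lp.fourierTransformₗᵢ (Pos ν) F)
  dsimp only
  rw [h2] at h1 ⊢
  filter_upwards [h1, Lp.coeFn_zero F 2 (volume : Measure (Pos ν))] with ξ h3 h4
  rw [h4, Pi.zero_apply] at h3 ⊢
  rcases smul_eq_zero.1 h3.symm with h5 | h5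
  · exact absurd (Complex.ofReal_eq_zero.1 h5) (h0 ξ)
  · exact h5

theorem norm_fmul_apply_le {D : ℝ} (hg : BddSymbol g) (hh : BddSymbol h)
    (hgh : ∀ ξ, |g ξ| ≤ D * |h ξ|) (f : L2 ν F) : ‖fmul g f‖ ≤ D * ‖fmul h f‖ := by
  rw [← Lp.norm_fourier_eq, ← Lp.norm_fourier_eq (fmul h f)]
  refine Lp.norm_le_mul_norm_of_ae_le_mul ?_
  filter_upwards [hg.coeFn_fourier_fmul f, hh.coeFn_fourier_fmul f] with ξ h1 h2
  rw [h1, h2, norm_smul, norm_smul, Complex.norm_real, Complex.norm_real, ← mul_assoc]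
  exact mul_le_mul_of_nonneg_right (hgh ξ) (norm_nonneg _)

theorem norm_fmul_apply_le' {D : ℝ} (hg : BddSymbol g) (hgD : ∀ ξ, |g ξ| ≤ D) (f : L2 ν F) :
    ‖fmul g f‖ ≤ D * ‖f‖ := by
  have := norm_fmul_apply_le hg bddSymbol_one
    (fun ξ => by simpa using hgD ξ) f
  rwa [fmul_one] at this

/-! ### Distributional derivatives and Sobolev spaces -/

theorem toTemperedDistribution_injective :
    Function.Injective fun f : L2 ν F => (f : 𝓢'(Pos ν, F)) := by
  have := LinearMap.ker_eq_bot.1 (Lp.ker_toTemperedDistributionCLM_eq_bot (F := F)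
    (μ := (volume : Measure (Pos ν))) (p := 2))
  exact this

theorem smulLeftCLM_coe {p : Pos ν → ℝ} (hp : p.HasTemperateGrowth) {u w : L2 ν F}
    (hw : w =ᵐ[volume] fun ξ => (p ξ : ℂ) • u ξ) :
    TemperedDistribution.smulLeftCLM F (fun ξ => (p ξ : ℂ)) (u : 𝓢'(Pos ν, F)) =
      (w : 𝓢'(Pos ν, F)) := by
  have hp' : (fun ξ => (p ξ : ℂ)).HasTemperateGrowth := by fun_prop
  ext φ
  rw [TemperedDistribution.smulLeftCLM_apply_apply, Lp.toTemperedDistribution_apply,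
    Lp.toTemperedDistribution_apply]
  refine integral_congr_ae ?_
  filter_upwards [hw] with ξ hξ
  rw [hξ, SchwartzMap.smulLeftCLM_apply_apply hp', smul_smul, smul_eq_mul, mul_comm]

/-- This links distributional multipliers to those on `L²`. The symbol `p` may be unbounded, which
covers derivatives, as long as `g` compensates its growth. -/
theorem fourierMultiplierCLM_fmul {p : Pos ν → ℝ} (hp : p.HasTemperateGrowth) (hg : BddSymbol g)
    (hpg : BddSymbol fun ξ => p ξ * g ξ) (f : L2 ν F) :
    TemperedDistribution.fourierMultiplierCLM F (fun ξ => (p ξ : ℂ))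
      (fmul g f : 𝓢'(Pos ν, F)) = (fmul (fun ξ => p ξ * g ξ) f : 𝓢'(Pos ν, F)) := by
  rw [TemperedDistribution.fourierMultiplierCLM_apply, Lp.fourier_toTemperedDistribution_eq,
    smulLeftCLM_coe hp (w := 𝓕 (fmul (fun ξ => p ξ * g ξ) f)),
    Lp.fourierInv_toTemperedDistribution_eq, FourierTransform.fourierInv_fourier_eq]
  filter_upwards [hg.coeFn_fourier_fmul f, hpg.coeFn_fourier_fmul f] with ξ h1 h2
  rw [h1, h2, smul_smul, Complex.ofReal_mul]

theorem coe_smul_L2 (a : ℂ) (f : L2 ν F) :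
    ((a • f : L2 ν F) : 𝓢'(Pos ν, F)) = a • (f : 𝓢'(Pos ν, F)) :=
  map_smul (Lp.toTemperedDistributionCLM F (volume : Measure (Pos ν)) 2) a f

/-- The symbol of `-i ∂_j`. -/
def momentum (j : Fin ν) (ξ : Pos ν) : ℝ := 2 * Real.pi * ξ j

theorem lineDeriv_fmul (j : Fin ν) (hg : BddSymbol g)
    (hpg : BddSymbol fun ξ => momentum j ξ * g ξ) (f : L2 ν F) :
    ∂_{EuclideanSpace.single j (1 : ℝ)} (fmul g f : 𝓢'(Pos ν, F)) =
      ((Complex.I • fmul (fun ξ => momentum j ξ * g ξ) f : L2 ν F) : 𝓢'(Pos ν, F)) := by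
  have hin : ∀ ξ : Pos ν, inner ℝ ξ (EuclideanSpace.single j (1 : ℝ)) = ξ j := fun ξ => by
    simp [EuclideanSpace.inner_single_right]
  have hb : BddSymbol fun ξ : Pos ν => inner ℝ ξ (EuclideanSpace.single j (1 : ℝ)) * g ξ := by
    have := (⟨measurable_const, |(2 * Real.pi)⁻¹|, fun _ => le_rfl⟩ :
      BddSymbol fun _ : Pos ν => (2 * Real.pi)⁻¹).mul hpg
    convert this using 2 with ξ
    rw [hin, momentum]
    field_simp
  rw [TemperedDistribution.lineDeriv_eq_fourierMultiplierCLM,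
    fourierMultiplierCLM_fmul (p := fun ξ => inner ℝ ξ (EuclideanSpace.single j (1 : ℝ)))
      (by fun_prop) hg hb, ← coe_smul_L2]
  congr 1
  have : fmul (fun ξ => momentum j ξ * g ξ) f = ((2 * Real.pi : ℝ) : ℂ) •
      fmul (fun ξ : Pos ν => inner ℝ ξ (EuclideanSpace.single j (1 : ℝ)) * g ξ) f := by
    rw [← fmul_const_mul hb]
    congr 2 with ξ
    rw [hin, momentum]
    ring
  rw [this, smul_smul]
  congr 1
  push_cast
  ring

/-- The representative chosen in `partialL2` is forced, since `L²` embeds injectively into `𝓢'`. -/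
theorem partialL2_eq_of_lineDeriv {j : Fin ν} {ψ w : L2 ν F}
    (hw : ∂_{EuclideanSpace.single j (1 : ℝ)} (ψ : 𝓢'(Pos ν, F)) = (w : 𝓢'(Pos ν, F))) :
    partialL2 j ψ = w := by
  have h : ∃ w : L2 ν F, ∂_{EuclideanSpace.single j (1 : ℝ)} (ψ : 𝓢'(Pos ν, F)) =
    (w : 𝓢'(Pos ν, F)) := ⟨w, hw⟩
  rw [partialL2, dif_pos h]
  exact toTemperedDistribution_injective (h.choose_spec.symm.trans hw)

theorem partialL2_fmul (j : Fin ν) (hg : BddSymbol g)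
    (hpg : BddSymbol fun ξ => momentum j ξ * g ξ) (f : L2 ν F) :
    partialL2 j (fmul g f) = Complex.I • fmul (fun ξ => momentum j ξ * g ξ) f :=
  partialL2_eq_of_lineDeriv (lineDeriv_fmul j hg hpg f)

theorem laplacianL2_fmul (hg : BddSymbol g)
    (hpg : BddSymbol fun ξ => (2 * Real.pi * ‖ξ‖) ^ 2 * g ξ) (f : L2 ν F) :
    laplacianL2 (fmul g f) = -fmul (fun ξ => (2 * Real.pi * ‖ξ‖) ^ 2 * g ξ) f := by
  have hb : BddSymbol fun ξ : Pos ν => ‖ξ‖ ^ 2 * g ξ := by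
    have := (⟨measurable_const, |((2 * Real.pi) ^ 2)⁻¹|, fun _ => le_rfl⟩ :
      BddSymbol fun _ : Pos ν => ((2 * Real.pi) ^ 2)⁻¹).mul hpg
    convert this using 2 with ξ
    field_simp
  have hw : Δ (fmul g f : 𝓢'(Pos ν, F)) =
      ((-fmul (fun ξ => (2 * Real.pi * ‖ξ‖) ^ 2 * g ξ) f : L2 ν F) : 𝓢'(Pos ν, F)) := by
    rw [TemperedDistribution.laplacian_eq_fourierMultiplierCLM,
      fourierMultiplierCLM_fmul (p := fun ξ => ‖ξ‖ ^ 2) (by fun_prop) hg hb, ← Complex.coe_smul,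
      ← coe_smul_L2]
    congr 1
    rw [Complex.ofReal_neg, neg_smul, ← fmul_const_mul hb]
    congr 3 with ξ
    ring
  have h : ∃ w : L2 ν F, Δ (fmul g f : 𝓢'(Pos ν, F)) = (w : 𝓢'(Pos ν, F)) := ⟨_, hw⟩
  rw [laplacianL2, dif_pos h]
  exact toTemperedDistribution_injective (h.choose_spec.symm.trans hw)

/-- A symbol bounded above and below by multiples of `(1 + ‖ξ‖²)^{-k/2}` maps `L²` onto the same
space as the Bessel potential. This permits `(H₀ + c)`-powers in place of Bessel potentials. -/
theorem mem_sobolev_iff {k : ℕ} (hg : BddSymbol g) (h0 : ∀ ξ, g ξ ≠ 0)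
    (h1 : BddSymbol fun ξ => (1 + ‖ξ‖ ^ 2) ^ ((k : ℝ) / 2) * g ξ)
    (h2 : BddSymbol fun ξ => (1 + ‖ξ‖ ^ 2) ^ (-(k : ℝ) / 2) * (g ξ)⁻¹) {ψ : L2 ν F} :
    ψ ∈ sobolev ν F k ↔ ∃ f, fmul g f = ψ := by
  have hpos : ∀ ξ : Pos ν, (0 : ℝ) < 1 + ‖ξ‖ ^ 2 := fun ξ => by positivity
  constructor
  · rintro ⟨f', hf'⟩
    have hb : BddSymbol fun ξ : Pos ν => (1 + ‖ξ‖ ^ 2) ^ (-(k : ℝ) / 2) * 1 := by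
      refine ⟨by fun_prop, 1, fun ξ => ?_⟩
      rw [mul_one, abs_of_nonneg (Real.rpow_nonneg (hpos ξ).le _)]
      refine Real.rpow_le_one_of_one_le_of_nonpos (by nlinarith [sq_nonneg ‖ξ‖]) ?_
      have : (0 : ℝ) ≤ k := k.cast_nonneg
      linarith
    rw [← TemperedDistribution.besselPotential_neg_apply_eq_iff,
      TemperedDistribution.besselPotential] at hf'
    have h3 := fourierMultiplierCLM_fmul
      (p := fun ξ : Pos ν => (1 + ‖ξ‖ ^ 2) ^ (-(k : ℝ) / 2)) (by fun_prop) bddSymbol_one hb f'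
    rw [fmul_one] at h3
    have h4 := toTemperedDistribution_injective (hf'.symm.trans h3)
    refine ⟨fmul (fun ξ => (1 + ‖ξ‖ ^ 2) ^ (-(k : ℝ) / 2) * (g ξ)⁻¹) f', ?_⟩
    rw [h4, fmul_fmul hg h2]
    congr 2 with ξ
    have := h0 ξ
    field_simp
  · rintro ⟨f, rfl⟩
    exact ⟨_, fourierMultiplierCLM_fmul (p := fun ξ : Pos ν => (1 + ‖ξ‖ ^ 2) ^ ((k : ℝ) / 2))
      (by fun_prop) hg h1 f⟩

end

noncomputable section

variable {ν : ℕ} {F : Type} [NormedAddCommGroup F] [InnerProductSpace ℂ F] [CompleteSpace F]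

open FourierTransform

/-! ### The symbols of the free Hamiltonian and its resolvent -/

/-- The symbol of `H₀`. -/
def kinetic (m : ℝ) (ξ : Pos ν) : ℝ := (2 * Real.pi * ‖ξ‖) ^ 2 / (2 * m)

/-- The symbol of `(H₀ + c)⁻¹`. -/
def resolventSymbol (m c : ℝ) (ξ : Pos ν) : ℝ := (kinetic m ξ + c)⁻¹

/-- The symbol of `(H₀ + c)^{-1/2}`. -/
def sqrtResolventSymbol (m c : ℝ) (ξ : Pos ν) : ℝ := √(resolventSymbol m c ξ)

section Symbols

variable {m c : ℝ}

theorem kinetic_nonneg (hm : 0 < m) (ξ : Pos ν) : 0 ≤ kinetic m ξ := by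
  unfold kinetic; positivity

theorem measurable_kinetic : Measurable (kinetic m : Pos ν → ℝ) := by
  unfold kinetic; fun_prop

theorem kinetic_add_pos (hm : 0 < m) (hc : 0 < c) (ξ : Pos ν) : 0 < kinetic m ξ + c :=
  add_pos_of_nonneg_of_pos (kinetic_nonneg hm ξ) hc

theorem resolventSymbol_pos (hm : 0 < m) (hc : 0 < c) (ξ : Pos ν) : 0 < resolventSymbol m c ξ :=
  inv_pos.2 (kinetic_add_pos hm hc ξ)

theorem resolventSymbol_le (hm : 0 < m) (hc : 0 < c) (ξ : Pos ν) :
    resolventSymbol m c ξ ≤ c⁻¹ :=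
  inv_anti₀ hc (by linarith [kinetic_nonneg hm ξ])

theorem kinetic_mul_resolventSymbol_le (hm : 0 < m) (hc : 0 < c) (ξ : Pos ν) :
    kinetic m ξ * resolventSymbol m c ξ ≤ 1 := by
  rw [resolventSymbol, ← div_eq_mul_inv, div_le_one (kinetic_add_pos hm hc ξ)]
  linarith

theorem bddSymbol_resolvent (hm : 0 < m) (hc : 0 < c) :
    BddSymbol (resolventSymbol m c : Pos ν → ℝ) := by
  refine ⟨(measurable_kinetic.add_const c).inv, c⁻¹, fun ξ => ?_⟩
  rw [abs_of_pos (resolventSymbol_pos hm hc ξ)]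
  exact resolventSymbol_le hm hc ξ

theorem abs_kinetic_mul_resolvent_le (hm : 0 < m) (hc : 0 < c) (ξ : Pos ν) :
    |kinetic m ξ * resolventSymbol m c ξ| ≤ 1 := by
  rw [abs_of_nonneg (mul_nonneg (kinetic_nonneg hm ξ) (resolventSymbol_pos hm hc ξ).le)]
  exact kinetic_mul_resolventSymbol_le hm hc ξ

theorem bddSymbol_kinetic_mul_resolvent (hm : 0 < m) (hc : 0 < c) :
    BddSymbol fun ξ : Pos ν => kinetic m ξ * resolventSymbol m c ξ :=
  ⟨measurable_kinetic.mul (bddSymbol_resolvent hm hc).measurable, 1,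
    abs_kinetic_mul_resolvent_le hm hc⟩

theorem bddSymbol_laplacian_mul_resolvent (hm : 0 < m) (hc : 0 < c) :
    BddSymbol fun ξ : Pos ν => (2 * Real.pi * ‖ξ‖) ^ 2 * resolventSymbol m c ξ := by
  have := (⟨measurable_const, |2 * m|, fun _ => le_rfl⟩ :
      BddSymbol fun _ : Pos ν => 2 * m).mul (bddSymbol_kinetic_mul_resolvent hm hc)
  convert this using 2 with ξ
  rw [kinetic]
  field_simp

theorem sqrtResolventSymbol_pos (hm : 0 < m) (hc : 0 < c) (ξ : Pos ν) :
    0 < sqrtResolventSymbol m c ξ :=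
  Real.sqrt_pos.2 (resolventSymbol_pos hm hc ξ)

theorem sqrtResolventSymbol_mul_self (hm : 0 < m) (hc : 0 < c) (ξ : Pos ν) :
    sqrtResolventSymbol m c ξ * sqrtResolventSymbol m c ξ = resolventSymbol m c ξ :=
  Real.mul_self_sqrt (resolventSymbol_pos hm hc ξ).le

theorem measurable_sqrtResolventSymbol (hm : 0 < m) (hc : 0 < c) :
    Measurable (sqrtResolventSymbol m c : Pos ν → ℝ) :=
  (bddSymbol_resolvent hm hc).measurable.sqrt

/-- Boundedness after `(H₀ + c)^{-1/2}` only requires domination of `p²` by `H₀ + c`. -/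
theorem bddSymbol_of_sq_mul_resolvent {p : Pos ν → ℝ} (hm : 0 < m) (hc : 0 < c)
    (hp : Measurable p) {C : ℝ} (hpC : ∀ ξ, p ξ ^ 2 ≤ C * (kinetic m ξ + c)) :
    BddSymbol fun ξ => p ξ * sqrtResolventSymbol m c ξ := by
  refine ⟨hp.mul (measurable_sqrtResolventSymbol hm hc), √C, fun ξ => ?_⟩
  refine Real.abs_le_sqrt ?_
  rw [mul_pow, sq (sqrtResolventSymbol m c ξ), sqrtResolventSymbol_mul_self hm hc,
    resolventSymbol, ← div_eq_mul_inv, div_le_iff₀ (kinetic_add_pos hm hc ξ)]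
  exact hpC ξ

theorem bddSymbol_sqrtResolvent (hm : 0 < m) (hc : 0 < c) :
    BddSymbol (sqrtResolventSymbol m c : Pos ν → ℝ) := by
  have := bddSymbol_of_sq_mul_resolvent (ν := ν) (p := fun _ => 1) (C := c⁻¹) hm hc
    measurable_const (fun ξ => by
      rw [one_pow, mul_add, inv_mul_cancel₀ hc.ne']
      have := mul_nonneg (inv_nonneg.2 hc.le) (kinetic_nonneg hm ξ)
      linarith)
  simpa using this

theorem sum_momentum_sq (ξ : Pos ν) : ∑ j, momentum j ξ ^ 2 = (2 * Real.pi * ‖ξ‖) ^ 2 := by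
  simp only [momentum, mul_pow, EuclideanSpace.norm_sq_eq, Real.norm_eq_abs, sq_abs,
    Finset.mul_sum]

theorem momentum_sq_le (hm : 0 < m) (j : Fin ν) (ξ : Pos ν) :
    momentum j ξ ^ 2 ≤ 2 * m * kinetic m ξ := by
  rw [kinetic, mul_div_cancel₀ _ (by positivity), ← sum_momentum_sq]
  exact Finset.single_le_sum (f := fun j => momentum j ξ ^ 2) (fun _ _ => sq_nonneg _)
    (Finset.mem_univ j)

theorem measurable_momentum (j : Fin ν) : Measurable (momentum j) := by
  unfold momentum; fun_prop

theorem bddSymbol_momentum_mul_sqrtResolvent (hm : 0 < m) (hc : 0 < c) (j : Fin ν) :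
    BddSymbol fun ξ => momentum j ξ * sqrtResolventSymbol m c ξ := by
  refine bddSymbol_of_sq_mul_resolvent (C := 2 * m) hm hc (measurable_momentum j) fun ξ => ?_
  refine (momentum_sq_le hm j ξ).trans ?_
  gcongr
  linarith

theorem bddSymbol_momentum_mul_resolvent (hm : 0 < m) (hc : 0 < c) (j : Fin ν) :
    BddSymbol fun ξ => momentum j ξ * resolventSymbol m c ξ := by
  have := (bddSymbol_momentum_mul_sqrtResolvent hm hc j).mul (bddSymbol_sqrtResolvent hm hc)
  simpa only [mul_assoc, sqrtResolventSymbol_mul_self hm hc] using this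

theorem one_add_norm_sq_le (hm : 0 < m) (hc : 0 < c) (ξ : Pos ν) :
    1 + ‖ξ‖ ^ 2 ≤ (c⁻¹ + 2 * m / (2 * Real.pi) ^ 2) * (kinetic m ξ + c) := by
  have h1 : ‖ξ‖ ^ 2 = 2 * m / (2 * Real.pi) ^ 2 * kinetic m ξ := by
    have := Real.pi_pos.ne'
    rw [kinetic]; field_simp
  have h2 : 0 ≤ c⁻¹ * kinetic m ξ := mul_nonneg (inv_nonneg.2 hc.le) (kinetic_nonneg hm ξ)
  have h3 : 0 ≤ 2 * m / (2 * Real.pi) ^ 2 * c := by positivity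
  have h4 : c⁻¹ * c = 1 := inv_mul_cancel₀ hc.ne'
  nlinarith

theorem kinetic_add_le (hm : 0 < m) (hc : 0 < c) (ξ : Pos ν) :
    kinetic m ξ + c ≤ (c + (2 * Real.pi) ^ 2 / (2 * m)) * (1 + ‖ξ‖ ^ 2) := by
  have h1 : kinetic m ξ = (2 * Real.pi) ^ 2 / (2 * m) * ‖ξ‖ ^ 2 := by
    rw [kinetic]; ring
  have h2 : 0 ≤ (2 * Real.pi) ^ 2 / (2 * m) := by positivity
  have h3 : 0 ≤ c * ‖ξ‖ ^ 2 := by positivity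
  rw [h1]
  linarith

theorem mem_sobolev_one_iff (hm : 0 < m) (hc : 0 < c) {ψ : L2 ν F} :
    ψ ∈ sobolev ν F 1 ↔ ∃ f, fmul (sqrtResolventSymbol m c) f = ψ := by
  have hpos : ∀ ξ : Pos ν, (0 : ℝ) < 1 + ‖ξ‖ ^ 2 := fun ξ => by positivity
  refine mem_sobolev_iff (bddSymbol_sqrtResolvent hm hc)
    (fun ξ => (sqrtResolventSymbol_pos hm hc ξ).ne') ?_ ?_
  · refine bddSymbol_of_sq_mul_resolvent (C := c⁻¹ + 2 * m / (2 * Real.pi) ^ 2) hm hc (by fun_prop)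
      fun ξ => ?_
    rw [Nat.cast_one, ← Real.sqrt_eq_rpow, Real.sq_sqrt (hpos ξ).le]
    exact one_add_norm_sq_le hm hc ξ
  · refine ⟨.mul (by fun_prop) (measurable_sqrtResolventSymbol hm hc).inv,
      √(c + (2 * Real.pi) ^ 2 / (2 * m)), fun ξ => Real.abs_le_sqrt ?_⟩
    rw [Nat.cast_one, neg_div, Real.rpow_neg (hpos ξ).le, ← Real.sqrt_eq_rpow, mul_pow, inv_pow,
      inv_pow, Real.sq_sqrt (hpos ξ).le, sq (sqrtResolventSymbol m c ξ),
      sqrtResolventSymbol_mul_self hm hc, resolventSymbol, inv_inv, inv_mul_le_iff₀ (hpos ξ),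
      mul_comm (1 + ‖ξ‖ ^ 2)]
    exact kinetic_add_le hm hc ξ

theorem mem_sobolev_two_iff (hm : 0 < m) (hc : 0 < c) {ψ : L2 ν F} :
    ψ ∈ sobolev ν F 2 ↔ ∃ f, fmul (resolventSymbol m c) f = ψ := by
  have hpos : ∀ ξ : Pos ν, (0 : ℝ) < 1 + ‖ξ‖ ^ 2 := fun ξ => by positivity
  refine mem_sobolev_iff (bddSymbol_resolvent hm hc)
    (fun ξ => (resolventSymbol_pos hm hc ξ).ne') ?_ ?_
  · refine ⟨.mul (by fun_prop) (bddSymbol_resolvent hm hc).measurable,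
      c⁻¹ + 2 * m / (2 * Real.pi) ^ 2, fun ξ => ?_⟩
    rw [Nat.cast_ofNat, div_self two_ne_zero, Real.rpow_one, resolventSymbol, ← div_eq_mul_inv,
      abs_of_pos (div_pos (hpos ξ) (kinetic_add_pos hm hc ξ)),
      div_le_iff₀ (kinetic_add_pos hm hc ξ)]
    exact one_add_norm_sq_le hm hc ξ
  · refine ⟨.mul (by fun_prop) (bddSymbol_resolvent hm hc).measurable.inv,
      c + (2 * Real.pi) ^ 2 / (2 * m), fun ξ => ?_⟩
    rw [Nat.cast_ofNat, neg_div, div_self two_ne_zero, Real.rpow_neg_one, resolventSymbol,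
      inv_inv, abs_of_pos (mul_pos (inv_pos.2 (hpos ξ)) (kinetic_add_pos hm hc ξ)),
      inv_mul_le_iff₀ (hpos ξ), mul_comm (1 + ‖ξ‖ ^ 2)]
    exact kinetic_add_le hm hc ξ

theorem freeHamiltonian_fmul_resolvent (hm : 0 < m) (hc : 0 < c) (f : L2 ν F) :
    freeHamiltonian m (fmul (resolventSymbol m c) f) =
      fmul (fun ξ => kinetic m ξ * resolventSymbol m c ξ) f := by
  rw [freeHamiltonian, laplacianL2_fmul (bddSymbol_resolvent hm hc)
    (bddSymbol_laplacian_mul_resolvent hm hc), neg_smul, smul_neg, neg_neg,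
    ← fmul_const_mul (bddSymbol_laplacian_mul_resolvent hm hc)]
  congr 2 with ξ
  rw [kinetic]
  ring

theorem fmul_sqrtResolvent_sqrtResolvent (hm : 0 < m) (hc : 0 < c) (f : L2 ν F) :
    fmul (sqrtResolventSymbol m c) (fmul (sqrtResolventSymbol m c) f) =
      fmul (resolventSymbol m c) f := by
  rw [fmul_fmul (bddSymbol_sqrtResolvent hm hc) (bddSymbol_sqrtResolvent hm hc)]
  simp only [sqrtResolventSymbol_mul_self hm hc]

end Symbols

/-! ### Kato-small potentials -/

theorem eLpNorm_two_sq {G : Type} [NormedAddCommGroup G] (u : Pos ν → G) :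
    eLpNorm u 2 volume ^ 2 = ∫⁻ x, ‖u x‖ₑ ^ 2 := by
  have := eLpNorm_nnreal_pow_eq_lintegral (μ := (volume : Measure (Pos ν))) (f := u) (p := 2)
    two_ne_zero
  simpa using this

theorem ofReal_norm_L2 (f : L2 ν F) : ENNReal.ofReal ‖f‖ = eLpNorm f 2 volume := by
  rw [Lp.norm_def, ENNReal.ofReal_toReal (Lp.eLpNorm_ne_top _)]

theorem ofReal_norm_sq_L2 (f : L2 ν F) : ENNReal.ofReal (‖f‖ ^ 2) = ∫⁻ x, ‖f x‖ₑ ^ 2 := by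
  rw [ENNReal.ofReal_pow (norm_nonneg _), ofReal_norm_L2, eLpNorm_two_sq]

theorem norm_sq_L2 (f : L2 ν F) : ‖f‖ ^ 2 = ∫ x, ‖f x‖ ^ 2 := by
  have h1 : inner ℂ f f = ((‖f‖ ^ 2 : ℝ) : ℂ) := by
    rw [inner_self_eq_norm_sq_to_K]; norm_cast
  have h2 : (inner ℂ f f : ℂ) = ((∫ x, ‖f x‖ ^ 2 : ℝ) : ℂ) := by
    rw [L2_inner_eq, ← integral_complex_ofReal]
    refine integral_congr_ae (Eventually.of_forall fun x => ?_)
    dsimp only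
    rw [inner_self_eq_norm_sq_to_K]; norm_cast
  exact_mod_cast h1.symm.trans h2

/-- The Fourier transform acts componentwise, so bounds for scalar functions can be transferred to
`F`-valued ones. -/
theorem compLp_fmul {g : Pos ν → ℝ} (hg : BddSymbol g) (e : F →L[ℂ] ℂ) (f : L2 ν F) :
    e.compLp (fmul g f) = fmul g (e.compLp f) := by
  have hdist : ∀ (u : L2 ν F) (φ : 𝓢(Pos ν, ℂ)), (e.compLp u : 𝓢'(Pos ν, ℂ)) φ =
      e ((u : 𝓢'(Pos ν, F)) φ) := by
    intro u φ
    rw [Lp.toTemperedDistribution_apply, Lp.toTemperedDistribution_apply,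
      ← ContinuousLinearMap.integral_comp_comm]
    · refine integral_congr_ae ?_
      filter_upwards [e.coeFn_compLp u] with x hx
      rw [hx, map_smul]
    · have h1 := (Lp.memLp u).smul (φ.memLp 2 volume) (r := 1)
      exact memLp_one_iff_integrable.1 h1
  have hfour : ∀ u : L2 ν F, 𝓕 (e.compLp u) = e.compLp (𝓕 u) := by
    intro u
    refine toTemperedDistribution_injective ?_
    dsimp only
    rw [← Lp.fourier_toTemperedDistribution_eq]
    ext φ
    rw [TemperedDistribution.fourier_apply, hdist, hdist, ← TemperedDistribution.fourier_apply,
      Lp.fourier_toTemperedDistribution_eq]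
  refine (hg.fmul_eq ?_).symm
  rw [hfour, hfour]
  filter_upwards [e.coeFn_compLp (𝓕 (fmul g f)), e.coeFn_compLp (𝓕 f),
    hg.coeFn_fourier_fmul f] with ξ h1 h2 h3
  rw [h1, h2, h3, map_smul]

/-- The Kato condition concerns scalar functions. Summing the squared bounds over the components in
an orthonormal basis of `F` loses nothing in the constant, so a relative bound `< 1` survives. -/
theorem pointwiseBound_scalarOp_of_scalar [FiniteDimensional ℂ F] {v g : Pos ν → ℝ}
    (hg : BddSymbol g) {C : ℝ} (h : PointwiseBound (scalarOp ℂ v) (fmul g) C)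
    (hv : AEMeasurable v volume) : PointwiseBound (scalarOp F v) (fmul g) C where
  nonneg := h.nonneg
  aestronglyMeasurable := aestronglyMeasurable_scalarOp hv
  bound f := by
    set b := stdOrthonormalBasis ℂ F
    have hsum : ∀ y : F, ‖y‖ₑ ^ 2 = ∑ i, ‖innerSL ℂ (b i) y‖ₑ ^ 2 := by
      intro y
      have := b.sum_sq_norm_inner_right y
      simp only [innerSL_apply_apply, ← ofReal_norm, ← ENNReal.ofReal_pow (norm_nonneg _)]
      rw [← ENNReal.ofReal_sum_of_nonneg (fun _ _ => by positivity), this]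
    have hmeas : ∀ i, AEMeasurable
        (fun x => ‖innerSL ℂ (b i) (scalarOp F v x (fmul g f x))‖ₑ ^ 2) volume := fun i =>
      ((((innerSL ℂ (b i)).continuous.comp_aestronglyMeasurable
        (aestronglyMeasurable_clm_apply (aestronglyMeasurable_scalarOp hv)
          (Lp.aestronglyMeasurable (fmul g f)))).enorm).pow_const 2)
    refine (ENNReal.pow_le_pow_left_iff two_ne_zero).1 ?_
    rw [eLpNorm_two_sq]
    calc ∫⁻ x, ‖scalarOp F v x (fmul g f x)‖ₑ ^ 2
        = ∑ i, ∫⁻ x, ‖innerSL ℂ (b i) (scalarOp F v x (fmul g f x))‖ₑ ^ 2 := by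
          rw [← lintegral_finsetSum' _ fun i _ => hmeas i]
          simp only [hsum]
      _ = ∑ i, eLpNorm (fun x => scalarOp ℂ v x (fmul g ((innerSL ℂ (b i)).compLp f) x))
            2 volume ^ 2 := by
          refine Finset.sum_congr rfl fun i _ => ?_
          rw [eLpNorm_two_sq]
          refine lintegral_congr_ae ?_
          rw [← compLp_fmul hg]
          filter_upwards [(innerSL ℂ (b i)).coeFn_compLp (fmul g f)] with x hx
          rw [hx, scalarOp_apply, scalarOp_apply, map_smul]
      _ ≤ ∑ i, ENNReal.ofReal (C * ‖(innerSL ℂ (b i)).compLp f‖) ^ 2 :=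
          Finset.sum_le_sum fun i _ => pow_le_pow_left' (h.bound _) 2
      _ = ENNReal.ofReal (C ^ 2) * ∑ i, ∫⁻ x, ‖innerSL ℂ (b i) (f x)‖ₑ ^ 2 := by
          rw [Finset.mul_sum]
          refine Finset.sum_congr rfl fun i _ => ?_
          rw [← ENNReal.ofReal_pow (mul_nonneg h.nonneg (norm_nonneg _)), mul_pow,
            ENNReal.ofReal_mul (sq_nonneg C), ofReal_norm_sq_L2]
          congr 1
          refine lintegral_congr_ae ?_
          filter_upwards [(innerSL ℂ (b i)).coeFn_compLp f] with x hx
          rw [hx]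
      _ = ENNReal.ofReal (C * ‖f‖) ^ 2 := by
          rw [← lintegral_finsetSum']
          · simp only [← hsum]
            rw [← ofReal_norm_sq_L2, ← ENNReal.ofReal_mul (sq_nonneg C), ← mul_pow,
              ENNReal.ofReal_pow (mul_nonneg h.nonneg (norm_nonneg _))]
          · intro i _
            exact (((innerSL ℂ (b i)).continuous.comp_aestronglyMeasurable
              (Lp.aestronglyMeasurable f)).enorm).pow_const 2

/-- Multiplication with `v` is bounded relative to `H₀`, with the bounds `a` and `b`. -/
structure RelBounded (m : ℝ) (v : Pos ν → ℝ) (a b : ℝ) : Prop where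
  nonneg_left : 0 ≤ a
  nonneg_right : 0 ≤ b
  aemeasurable : AEMeasurable v volume
  bound : ∀ ψ ∈ sobolev ν ℂ 2, eLpNorm (fun x => v x • ψ x) 2 volume ≤
    ENNReal.ofReal (a * ‖freeHamiltonian m ψ‖ + b * ‖ψ‖)

variable {m c a b : ℝ} {v : Pos ν → ℝ}

/-- Here `‖H₀ (H₀ + c)⁻¹‖ ≤ 1` and `‖(H₀ + c)⁻¹‖ ≤ 1/c`; the resulting constant approaches `a` as
`c` grows. -/
theorem RelBounded.pointwiseBound_resolvent [FiniteDimensional ℂ F] (h : RelBounded m v a b)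
    (hm : 0 < m) (hc : 0 < c) :
    PointwiseBound (scalarOp F v) (fmul (resolventSymbol m c)) (a + b * c⁻¹) := by
  have ha := h.nonneg_left
  have hb := h.nonneg_right
  refine pointwiseBound_scalarOp_of_scalar (bddSymbol_resolvent hm hc)
    ⟨by positivity, aestronglyMeasurable_scalarOp h.aemeasurable, fun f => ?_⟩ h.aemeasurable
  refine (h.bound _ ((mem_sobolev_two_iff hm hc).2 ⟨f, rfl⟩)).trans (ENNReal.ofReal_le_ofReal ?_)
  rw [freeHamiltonian_fmul_resolvent hm hc]
  have h1 := norm_fmul_apply_le' (bddSymbol_kinetic_mul_resolvent hm hc)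
    (abs_kinetic_mul_resolvent_le hm hc) f
  have h2 := norm_fmul_apply_le' (D := c⁻¹) (bddSymbol_resolvent hm hc) (fun ξ => by
    rw [abs_of_pos (resolventSymbol_pos hm hc ξ)]; exact resolventSymbol_le hm hc ξ) f
  calc _ ≤ a * (1 * ‖f‖) + b * (c⁻¹ * ‖f‖) := by gcongr
    _ = _ := by ring

/-- A nonnegative potential that is bounded relative to `H₀ + c` is form-bounded with the same
constant. -/
theorem lintegral_mul_sq_le (hm : 0 < m) (hc : 0 < c) (hv0 : ∀ x, 0 ≤ v x) {C : ℝ}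
    (h : PointwiseBound (scalarOp F v) (fmul (resolventSymbol m c)) C)
    (hv : AEMeasurable v volume) (f : L2 ν F) :
    ∫⁻ x, ENNReal.ofReal (v x) * ‖fmul (sqrtResolventSymbol m c) f x‖ₑ ^ 2 ≤
      ENNReal.ofReal (C * ‖f‖ ^ 2) := by
  set S : L2 ν F →L[ℂ] L2 ν F := fmul (sqrtResolventSymbol m c)
  -- Truncation makes multiplication a bounded self-adjoint operator `V`, to which `‖S V S‖ ≤ ‖V
  -- S²‖` applies. The bound is uniform in `n`, and monotone convergence removes the cutoff.
  set w : ℕ → Pos ν → ℝ := fun n x => min (v x) n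
  have hw0 : ∀ n x, 0 ≤ w n x := fun n x => le_min (hv0 x) n.cast_nonneg
  have hwm : ∀ n, AEMeasurable (w n) volume := fun n => hv.min aemeasurable_const
  have hwb : ∀ n, PointwiseBound (scalarOp F (w n)) 1 (n * ‖(1 : L2 ν F →L[ℂ] L2 ν F)‖) :=
    fun n => pointwiseBound_scalarOp (hwm n)
      (fun x => by rw [abs_of_nonneg (hw0 n x)]; exact min_le_right _ _) 1
  have hS : IsSelfAdjoint S := isSelfAdjoint_fmul (bddSymbol_sqrtResolvent hm hc)
  have hbound : ∀ n, ∫⁻ x, ENNReal.ofReal (w n x) * ‖S f x‖ₑ ^ 2 ≤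
      ENNReal.ofReal (C * ‖f‖ ^ 2) := by
    intro n
    set V : L2 ν F →L[ℂ] L2 ν F := pmul (scalarOp F (w n)) 1
    have hV : IsSelfAdjoint V :=
      isSelfAdjoint_pmul_one (hwb n) (Eventually.of_forall (isSelfAdjoint_scalarOp _))
    have h1 : ‖V * S * S‖ ≤ C := by
      refine ContinuousLinearMap.opNorm_le_bound _ h.nonneg fun k => ?_
      have e1 : (V * S * S) k = V (fmul (resolventSymbol m c) k) := by
        rw [← fmul_sqrtResolvent_sqrtResolvent hm hc]; rfl
      rw [e1, ← ENNReal.ofReal_le_ofReal_iff (mul_nonneg h.nonneg (norm_nonneg _)),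
        ofReal_norm_L2, eLpNorm_congr_ae ((hwb n).coeFn_pmul _)]
      refine le_trans (eLpNorm_mono fun x => ?_) (h.bound k)
      rw [scalarOp_apply, scalarOp_apply, norm_smul, norm_smul, Complex.norm_real,
        Complex.norm_real, Real.norm_of_nonneg (hw0 n x), Real.norm_of_nonneg (hv0 x)]
      exact mul_le_mul_of_nonneg_right (min_le_left _ _) (norm_nonneg _)
    have h2 : ‖inner ℂ f ((S * V * S) f)‖ ≤ C * ‖f‖ ^ 2 := by
      refine (norm_inner_le_norm _ _).trans ?_
      have := (S * V * S).le_of_opNorm_le ((norm_mul_mul_le_of_isSelfAdjoint hS hV).trans h1) f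
      nlinarith [norm_nonneg f]
    have h3 : inner ℂ f ((S * V * S) f) = ((∫ x, w n x * ‖S f x‖ ^ 2 : ℝ) : ℂ) := by
      change inner ℂ f (S (V (S f))) = _
      rw [← inner_apply_eq_of_isSelfAdjoint hS, L2_inner_eq, ← integral_complex_ofReal]
      refine integral_congr_ae ?_
      filter_upwards [(hwb n).coeFn_pmul (S f)] with x hx
      rw [hx, scalarOp_apply, inner_smul_right, show (1 : L2 ν F →L[ℂ] L2 ν F) (S f) = S f from rfl,
        inner_self_eq_norm_sq_to_K]
      push_cast
      rfl
    have h4 : ∫⁻ x, ENNReal.ofReal (w n x) * ‖S f x‖ₑ ^ 2 =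
        ∫⁻ x, ENNReal.ofReal (w n x * ‖S f x‖ ^ 2) := by
      refine lintegral_congr fun x => ?_
      rw [ENNReal.ofReal_mul (hw0 n x), ENNReal.ofReal_pow (norm_nonneg _), ofReal_norm]
    have hint : Integrable (fun x => w n x * ‖S f x‖ ^ 2) volume := by
      refine Integrable.bdd_mul (c := n) (Lp.memLp (S f)).norm.integrable_sq
        (hwm n).aestronglyMeasurable (Eventually.of_forall fun x => ?_)
      rw [Real.norm_of_nonneg (hw0 n x)]
      exact min_le_right _ _
    rw [h4, ← ofReal_integral_eq_lintegral_ofReal hint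
      (Eventually.of_forall fun x => mul_nonneg (hw0 n x) (sq_nonneg _))]
    refine ENNReal.ofReal_le_ofReal ?_
    rw [h3, Complex.norm_real] at h2
    exact (le_abs_self _).trans h2
  refine le_of_tendsto' (lintegral_tendsto_of_tendsto_of_monotone
    (f := fun n x => ENNReal.ofReal (w n x) * ‖S f x‖ₑ ^ 2) (fun n => ?_) ?_ ?_) hbound
  · exact (hwm n).ennreal_ofReal.mul ((Lp.aestronglyMeasurable (S f)).enorm.pow_const 2)
  · refine Eventually.of_forall fun x n k hnk => ?_
    dsimp only [w]
    gcongr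
  · refine Eventually.of_forall fun x => tendsto_const_nhds.congr' ?_
    filter_upwards [eventually_ge_atTop ⌈v x⌉₊] with n hn
    rw [show w n x = v x from min_eq_left ((Nat.le_ceil _).trans (by exact_mod_cast hn))]

/-- The form bound is read as a norm bound for `√v` after `(H₀ + c)^{-1/2}`. Splitting the potential
into two such square roots makes its form a bounded operator. -/
theorem pointwiseBound_sqrt (hm : 0 < m) (hc : 0 < c) (hv0 : ∀ x, 0 ≤ v x) {C : ℝ}
    (h : PointwiseBound (scalarOp F v) (fmul (resolventSymbol m c)) C)
    (hv : AEMeasurable v volume) :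
    PointwiseBound (scalarOp F fun x => √(v x)) (fmul (sqrtResolventSymbol m c)) √C where
  nonneg := Real.sqrt_nonneg _
  aestronglyMeasurable := aestronglyMeasurable_scalarOp hv.sqrt
  bound f := by
    refine (ENNReal.pow_le_pow_left_iff two_ne_zero).1 ?_
    rw [eLpNorm_two_sq, ← ENNReal.ofReal_pow (mul_nonneg (Real.sqrt_nonneg _) (norm_nonneg _)),
      mul_pow, Real.sq_sqrt h.nonneg]
    refine le_trans (le_of_eq (lintegral_congr fun x => ?_)) (lintegral_mul_sq_le hm hc hv0 h hv f)
    rw [scalarOp_apply, enorm_smul, mul_pow, ← ofReal_norm ((_ : ℝ) : ℂ),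
      Complex.norm_real, Real.norm_of_nonneg (Real.sqrt_nonneg _),
      ← ENNReal.ofReal_pow (Real.sqrt_nonneg _), Real.sq_sqrt (hv0 x)]

end

noncomputable section

variable {ν : ℕ} {F : Type} [NormedAddCommGroup F] [InnerProductSpace ℂ F] [CompleteSpace F]

open FourierTransform

/-! ### The form operator -/

/-- The operator norm bound `(1/2m) ‖Z x‖ + |A₀ x|` of the potential. -/
def potentialBound (m : ℝ) (Z : Pos ν → F →L[ℂ] F) (A₀ : Pos ν → ℝ) (x : Pos ν) : ℝ :=
  1 / (2 * m) * ‖Z x‖ + |A₀ x|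

/-- Bounded continuous vector potentials and Kato-small, symmetric scalar terms. -/
structure Admissible (m : ℝ) (A : Pos ν → Pos ν) (Z : Pos ν → F →L[ℂ] F)
    (A₀ : Pos ν → ℝ) : Prop where
  pos : 0 < m
  continuous : Continuous A
  bounded : ∃ C, ∀ x, ‖A x‖ ≤ C
  measurable_spin : AEStronglyMeasurable Z volume
  selfAdjoint_spin : ∀ x, IsSelfAdjoint (Z x)
  measurable_scalar : AEMeasurable A₀ volume
  relBounded : ∃ a b, a < 1 ∧ RelBounded m (potentialBound m Z A₀) a b

/-- The potential as an operator on the spin space. -/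
def potentialOp (m : ℝ) (Z : Pos ν → F →L[ℂ] F) (A₀ : Pos ν → ℝ) (x : Pos ν) : F →L[ℂ] F :=
  -((1 / (2 * m) : ℝ) : ℂ) • Z x + scalarOp F A₀ x

/-- The sesquilinear form of `q_A`. -/
def sesqForm (m : ℝ) (A : Pos ν → Pos ν) (Z : Pos ν → F →L[ℂ] F) (A₀ : Pos ν → ℝ)
    (φ ψ : L2 ν F) : ℂ :=
  ((1 / (2 * m) : ℝ) : ℂ) * (∑ j, ∫ x, inner ℂ
      (-Complex.I • partialL2 j φ x - (A x j : ℂ) • φ x)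
      (-Complex.I • partialL2 j ψ x - (A x j : ℂ) • ψ x)) +
    ∫ x, inner ℂ (φ x) (potential m Z A₀ x (ψ x))

variable {m c : ℝ} {A : Pos ν → Pos ν} {Z : Pos ν → F →L[ℂ] F} {A₀ : Pos ν → ℝ}

theorem potentialOp_apply (x : Pos ν) (y : F) :
    potentialOp m Z A₀ x y = potential m Z A₀ x y := rfl

theorem potentialBound_nonneg (hm : 0 < m) (x : Pos ν) : 0 ≤ potentialBound m Z A₀ x := by
  unfold potentialBound; positivity

theorem norm_potentialOp_le (hm : 0 < m) (x : Pos ν) :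
    ‖potentialOp m Z A₀ x‖ ≤ potentialBound m Z A₀ x := by
  refine (norm_add_le _ _).trans (add_le_add ?_ (norm_scalarOp_le _ _))
  rw [norm_smul, norm_neg, Complex.norm_real, Real.norm_of_nonneg (by positivity)]

/-- The operator `(p - A)_j (H₀ + c)^{-1/2}`. -/
def kineticFactor (m c : ℝ) (A : Pos ν → Pos ν) (j : Fin ν) : L2 ν F →L[ℂ] L2 ν F :=
  fmul (fun ξ => momentum j ξ * sqrtResolventSymbol m c ξ) -
    pmul (scalarOp F fun x => A x j) (fmul (sqrtResolventSymbol m c))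

/-- The square root of the bound of the potential, after `(H₀ + c)^{-1/2}`. -/
def potentialFactor (m c : ℝ) (Z : Pos ν → F →L[ℂ] F) (A₀ : Pos ν → ℝ) :
    L2 ν F →L[ℂ] L2 ν F :=
  pmul (scalarOp F fun x => √(potentialBound m Z A₀ x)) (fmul (sqrtResolventSymbol m c))

/-- The potential divided by its bound. -/
def potentialPhase (m : ℝ) (Z : Pos ν → F →L[ℂ] F) (A₀ : Pos ν → ℝ) (x : Pos ν) : F →L[ℂ] F :=
  ((potentialBound m Z A₀ x)⁻¹ : ℂ) • potentialOp m Z A₀ x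

/-- The operator `K` with `q_A((H₀ + c)^{-1/2} f) = (f, K f)`. -/
def formOp (m c : ℝ) (A : Pos ν → Pos ν) (Z : Pos ν → F →L[ℂ] F) (A₀ : Pos ν → ℝ) :
    L2 ν F →L[ℂ] L2 ν F :=
  ((1 / (2 * m) : ℝ) : ℂ) • ∑ j, star (kineticFactor m c A j : L2 ν F →L[ℂ] L2 ν F) *
      kineticFactor m c A j +
    star (potentialFactor m c Z A₀) * pmul (potentialPhase m Z A₀) 1 * potentialFactor m c Z A₀

theorem Admissible.abs_component_le {C : ℝ} (hC : ∀ x, ‖A x‖ ≤ C) (j : Fin ν) (x : Pos ν) :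
    |A x j| ≤ C :=
  (PiLp.norm_apply_le (A x) j).trans (hC x)

theorem Admissible.continuous_component (h : Admissible m A Z A₀) (j : Fin ν) :
    Continuous fun x => A x j := by
  have := h.continuous
  fun_prop

theorem Admissible.pointwiseBound_component (h : Admissible m A Z A₀) {C : ℝ}
    (hC : ∀ x, ‖A x‖ ≤ C) (j : Fin ν) (T : L2 ν F →L[ℂ] L2 ν F) :
    PointwiseBound (scalarOp F fun x => A x j) T (C * ‖T‖) :=
  pointwiseBound_scalarOp (h.continuous_component j).measurable.aemeasurable
    (Admissible.abs_component_le hC j) T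

theorem Admissible.coeFn_kineticFactor (h : Admissible m A Z A₀) (hc : 0 < c) (j : Fin ν)
    (f : L2 ν F) : kineticFactor m c A j f =ᵐ[volume] fun x =>
      -Complex.I • partialL2 j (fmul (sqrtResolventSymbol m c) f) x -
        (A x j : ℂ) • fmul (sqrtResolventSymbol m c) f x := by
  obtain ⟨C, hC⟩ := h.bounded
  have h1 : fmul (fun ξ => momentum j ξ * sqrtResolventSymbol m c ξ) f =
      -Complex.I • partialL2 j (fmul (sqrtResolventSymbol m c) f) := by
    rw [partialL2_fmul j (bddSymbol_sqrtResolvent h.pos hc)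
      (bddSymbol_momentum_mul_sqrtResolvent h.pos hc j), smul_smul]
    simp
  have h2 : kineticFactor m c A j f = fmul (fun ξ => momentum j ξ * sqrtResolventSymbol m c ξ) f -
    pmul (scalarOp F fun x => A x j) (fmul (sqrtResolventSymbol m c)) f := rfl
  rw [h2, h1]
  filter_upwards [Lp.coeFn_sub (-Complex.I • partialL2 j (fmul (sqrtResolventSymbol m c) f))
    (pmul (scalarOp F fun x => A x j) (fmul (sqrtResolventSymbol m c)) f),
    Lp.coeFn_smul (-Complex.I) (partialL2 j (fmul (sqrtResolventSymbol m c) f)),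
    (h.pointwiseBound_component hC j (fmul (sqrtResolventSymbol m c))).coeFn_pmul f]
    with x e1 e2 e3
  rw [e1, Pi.sub_apply, e2, e3, Pi.smul_apply, scalarOp_apply]

theorem Admissible.aestronglyMeasurable_potentialOp (h : Admissible m A Z A₀) :
    AEStronglyMeasurable (potentialOp m Z A₀) volume :=
  (h.measurable_spin.const_smul (-((1 / (2 * m) : ℝ) : ℂ))).add (aestronglyMeasurable_scalarOp h.measurable_scalar)

theorem Admissible.aemeasurable_potentialBound (h : Admissible m A Z A₀) :
    AEMeasurable (potentialBound m Z A₀) volume := by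
  obtain ⟨a, b, -, hab⟩ := h.relBounded
  exact hab.aemeasurable

theorem Admissible.isSelfAdjoint_potentialOp (h : Admissible m A Z A₀) (x : Pos ν) :
    IsSelfAdjoint (potentialOp m Z A₀ x) := by
  refine IsSelfAdjoint.add ?_ (isSelfAdjoint_scalarOp _ _)
  rw [isSelfAdjoint_iff, star_smul, (h.selfAdjoint_spin x).star_eq]
  simp

theorem norm_potentialPhase_le (hm : 0 < m) (x : Pos ν) : ‖potentialPhase m Z A₀ x‖ ≤ 1 := by
  rw [potentialPhase, ← Complex.ofReal_inv, norm_smul, Complex.norm_real,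
    Real.norm_of_nonneg (inv_nonneg.2 (potentialBound_nonneg hm x))]
  exact inv_mul_le_one_of_le₀ (norm_potentialOp_le hm x) (potentialBound_nonneg hm x)

theorem Admissible.pointwiseBound_potentialPhase (h : Admissible m A Z A₀) :
    PointwiseBound (potentialPhase m Z A₀) 1 (1 * ‖(1 : L2 ν F →L[ℂ] L2 ν F)‖) := by
  refine pointwiseBound_of_ae_bound _ zero_le_one ?_
    (Eventually.of_forall (norm_potentialPhase_le h.pos))
  have h1 : AEStronglyMeasurable (fun x => ((potentialBound m Z A₀ x)⁻¹ : ℂ)) volume :=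
    ((Complex.measurable_ofReal.comp_aemeasurable
      h.aemeasurable_potentialBound).inv).aestronglyMeasurable
  exact h1.smul h.aestronglyMeasurable_potentialOp

theorem potentialBound_smul_potentialPhase (hm : 0 < m) (x : Pos ν) :
    (potentialBound m Z A₀ x : ℂ) • potentialPhase m Z A₀ x = potentialOp m Z A₀ x := by
  -- Where the bound vanishes, `potentialPhase` is `0` because of `0⁻¹ = 0`, and the potential
  -- vanishes there as well.
  rcases (potentialBound_nonneg (Z := Z) (A₀ := A₀) hm x).eq_or_lt with h0 | h0
  · have h1 := norm_potentialOp_le (Z := Z) (A₀ := A₀) hm x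
    rw [← h0, norm_le_zero_iff] at h1
    rw [h1, ← h0, Complex.ofReal_zero, zero_smul]
  · rw [potentialPhase, smul_smul, mul_inv_cancel₀ (Complex.ofReal_ne_zero.2 h0.ne'), one_smul]

theorem Admissible.isSelfAdjoint_pmul_potentialPhase (h : Admissible m A Z A₀) :
    IsSelfAdjoint (pmul (potentialPhase m Z A₀) 1) := by
  refine isSelfAdjoint_pmul_one h.pointwiseBound_potentialPhase
    (Eventually.of_forall fun x => ?_)
  rw [isSelfAdjoint_iff, potentialPhase, star_smul, (h.isSelfAdjoint_potentialOp x).star_eq]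
  simp

theorem Admissible.isSelfAdjoint_formOp (h : Admissible m A Z A₀) :
    IsSelfAdjoint (formOp m c A Z A₀) := by
  refine IsSelfAdjoint.add ?_ ?_
  · rw [isSelfAdjoint_iff, star_smul, star_sum]
    simp
  · rw [isSelfAdjoint_iff, star_mul, star_mul, star_star,
      h.isSelfAdjoint_pmul_potentialPhase.star_eq, mul_assoc]

theorem inner_formOp (f g : L2 ν F) :
    inner ℂ f (formOp m c A Z A₀ g) =
      ((1 / (2 * m) : ℝ) : ℂ) *
        ∑ j, inner ℂ (kineticFactor m c A j f) (kineticFactor m c A j g) +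
      inner ℂ (potentialFactor m c Z A₀ f)
        (pmul (potentialPhase m Z A₀) 1 (potentialFactor m c Z A₀ g)) := by
  have h1 : formOp m c A Z A₀ g = ((1 / (2 * m) : ℝ) : ℂ) •
      ∑ j, (star (kineticFactor m c A j : L2 ν F →L[ℂ] L2 ν F)) (kineticFactor m c A j g) +
      (star (potentialFactor m c Z A₀))
        (pmul (potentialPhase m Z A₀) 1 (potentialFactor m c Z A₀ g)) := by
    simp [formOp]
  simp only [h1, inner_add_right, inner_smul_right, inner_sum,
    ContinuousLinearMap.star_eq_adjoint, ContinuousLinearMap.adjoint_inner_right]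

/-- The constant `c` is large enough that the potential is form-bounded with a constant `< 1`
relative to `H₀ + c`. -/
def LargeShift (m : ℝ) (Z : Pos ν → F →L[ℂ] F) (A₀ : Pos ν → ℝ) (c C : ℝ) : Prop :=
  0 < c ∧ C < 1 ∧
    PointwiseBound (scalarOp F (potentialBound m Z A₀)) (fmul (resolventSymbol m c)) C

theorem Admissible.exists_largeShift [FiniteDimensional ℂ F] (h : Admissible m A Z A₀) :
    ∃ c C, LargeShift m Z A₀ c C := by
  obtain ⟨a, b, ha, hab⟩ := h.relBounded
  have hb := hab.nonneg_right
  -- With this shift, `a + b / c = a + (1 - a) b / (b + 1) < 1`.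
  have hc : 0 < (b + 1) / (1 - a) := div_pos (by linarith) (by linarith)
  refine ⟨(b + 1) / (1 - a), _, hc, ?_, hab.pointwiseBound_resolvent h.pos hc⟩
  rw [← div_eq_mul_inv, div_div_eq_mul_div]
  have : b * (1 - a) / (b + 1) < 1 - a := by
    rw [div_lt_iff₀ (by linarith)]
    nlinarith
  linarith

variable {C : ℝ}

theorem Admissible.pointwiseBound_potentialFactor (h : Admissible m A Z A₀)
    (hL : LargeShift m Z A₀ c C) :
    PointwiseBound (scalarOp F fun x => √(potentialBound m Z A₀ x))
      (fmul (sqrtResolventSymbol m c)) √C :=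
  pointwiseBound_sqrt h.pos hL.1 (potentialBound_nonneg h.pos) hL.2.2
    h.aemeasurable_potentialBound

/-- The two square roots of the bound recombine with the phase to the original potential pointwise.
-/
theorem Admissible.inner_potential_ae (h : Admissible m A Z A₀) (hL : LargeShift m Z A₀ c C)
    (f g : L2 ν F) :
    (fun x => inner ℂ (potentialFactor m c Z A₀ f x)
        (pmul (potentialPhase m Z A₀) 1 (potentialFactor m c Z A₀ g) x)) =ᵐ[volume]
      fun x => inner ℂ (fmul (sqrtResolventSymbol m c) f x)
        (potential m Z A₀ x (fmul (sqrtResolventSymbol m c) g x)) := by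
  have hN := h.pointwiseBound_potentialFactor hL
  filter_upwards [hN.coeFn_pmul f, hN.coeFn_pmul g,
    h.pointwiseBound_potentialPhase.coeFn_pmul (potentialFactor m c Z A₀ g)] with x h1 h2 h3
  rw [h3, show (1 : L2 ν F →L[ℂ] L2 ν F) (potentialFactor m c Z A₀ g) =
    potentialFactor m c Z A₀ g from rfl, potentialFactor, h1, h2, scalarOp_apply, scalarOp_apply,
    map_smul, inner_smul_left, inner_smul_right, ← mul_assoc, Complex.conj_ofReal,
    ← Complex.ofReal_mul, Real.mul_self_sqrt (potentialBound_nonneg h.pos x), ← inner_smul_right,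
    ← potentialOp_apply, ← potentialBound_smul_potentialPhase h.pos]
  rfl

theorem Admissible.inner_formOp_eq_sesqForm (h : Admissible m A Z A₀)
    (hL : LargeShift m Z A₀ c C) (f g : L2 ν F) :
    inner ℂ f (formOp m c A Z A₀ g) = sesqForm m A Z A₀ (fmul (sqrtResolventSymbol m c) f)
      (fmul (sqrtResolventSymbol m c) g) := by
  rw [inner_formOp, sesqForm]
  congr 1
  · congr 1
    refine Finset.sum_congr rfl fun j _ => ?_
    rw [L2_inner_eq]
    refine integral_congr_ae ?_
    filter_upwards [h.coeFn_kineticFactor hL.1 j f, h.coeFn_kineticFactor hL.1 j g] with x h1 h2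
    rw [h1, h2]
  · rw [L2_inner_eq]
    exact integral_congr_ae (h.inner_potential_ae hL f g)

theorem sesqForm_self_re (ψ : L2 ν F) :
    (sesqForm m A Z A₀ ψ ψ).re = formQ m A Z A₀ ψ := by
  rw [sesqForm, formQ, Complex.add_re, Complex.re_ofReal_mul, Complex.re_sum]
  congr 2
  refine Finset.sum_congr rfl fun j _ => ?_
  simp only [inner_self_eq_norm_sq_to_K]
  have : ∀ x, ((‖-Complex.I • partialL2 j ψ x - (A x j : ℂ) • ψ x‖ : ℂ)) ^ 2 =
      ((‖-Complex.I • partialL2 j ψ x - (A x j : ℂ) • ψ x‖ ^ 2 : ℝ) : ℂ) := fun x => by push_cast; rfl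
  simp only [RCLike.ofReal_eq_complex_ofReal, this]
  rw [integral_complex_ofReal, Complex.ofReal_re]

/-! ### Kinetic energy and coercivity of the form -/

theorem norm_fmul_sq {g : Pos ν → ℝ} (hg : BddSymbol g) (f : L2 ν F) :
    ‖fmul g f‖ ^ 2 = ∫ ξ, g ξ ^ 2 * ‖(𝓕 f : L2 ν F) ξ‖ ^ 2 := by
  rw [← Lp.norm_fourier_eq, norm_sq_L2]
  refine integral_congr_ae ?_
  filter_upwards [hg.coeFn_fourier_fmul f] with ξ hξ
  rw [hξ, norm_smul, mul_pow, Complex.norm_real, Real.norm_eq_abs, sq_abs]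

theorem integrable_symbol_sq {g : Pos ν → ℝ} (hg : BddSymbol g) (f : L2 ν F) :
    Integrable (fun ξ => g ξ ^ 2 * ‖(𝓕 f : L2 ν F) ξ‖ ^ 2) volume := by
  refine (Lp.memLp (𝓕 (fmul g f))).norm.integrable_sq.congr ?_
  filter_upwards [hg.coeFn_fourier_fmul f] with ξ hξ
  rw [hξ, norm_smul, mul_pow, Complex.norm_real, Real.norm_eq_abs, sq_abs]

/-- By Plancherel this is `∑ p_j² / (2m) + c = H₀ + c`, whose product with the square of the symbol
of `(H₀ + c)^{-1/2}` is `1`. -/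
theorem kinetic_energy_identity (hm : 0 < m) (hc : 0 < c) (f : L2 ν F) :
    1 / (2 * m) * ∑ j, ‖fmul (fun ξ => momentum j ξ * sqrtResolventSymbol m c ξ) f‖ ^ 2 +
      c * ‖fmul (sqrtResolventSymbol m c) f‖ ^ 2 = ‖f‖ ^ 2 := by
  have hP := bddSymbol_momentum_mul_sqrtResolvent (ν := ν) hm hc
  have hS := bddSymbol_sqrtResolvent (ν := ν) hm hc
  rw [← Lp.norm_fourier_eq f, norm_sq_L2 (𝓕 f)]
  simp only [norm_fmul_sq (hP _), norm_fmul_sq hS]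
  rw [← integral_finsetSum _ fun j _ => integrable_symbol_sq (hP j) f, ← integral_const_mul,
    ← integral_const_mul, ← integral_add
      ((integrable_finsetSum _ fun j _ => integrable_symbol_sq (hP j) f).const_mul _)
      ((integrable_symbol_sq hS f).const_mul _)]
  refine integral_congr_ae (Eventually.of_forall fun ξ => ?_)
  have h1 := sqrtResolventSymbol_mul_self (ν := ν) hm hc ξ
  have h2 := kinetic_add_pos hm hc ξ
  have h3 : 1 / (2 * m) * (2 * Real.pi * ‖ξ‖) ^ 2 = kinetic m ξ := by rw [kinetic]; ring
  have h4 : (kinetic m ξ + c) * resolventSymbol m c ξ = 1 := mul_inv_cancel₀ h2.ne'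
  dsimp only
  simp only [mul_pow, ← Finset.sum_mul, sum_momentum_sq, sq (sqrtResolventSymbol m c ξ), h1]
  rw [← mul_pow, ← mul_pow]
  linear_combination (resolventSymbol m c ξ * ‖(𝓕 f : L2 ν F) ξ‖ ^ 2) * h3 +
    ‖(𝓕 f : L2 ν F) ξ‖ ^ 2 * h4

/-- Young's inequality with a small `ε`: the vector potential costs only a fraction `ε` of the
kinetic energy. -/
theorem norm_sub_sq_ge {G : Type} [NormedAddCommGroup G] [InnerProductSpace ℂ G] (p q : G)
    {ε : ℝ} (hε : 0 < ε) : (1 - ε) * ‖p‖ ^ 2 - ε⁻¹ * ‖q‖ ^ 2 ≤ ‖p - q‖ ^ 2 := by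
  have h1 : (‖p‖ - ‖q‖) ^ 2 ≤ ‖p - q‖ ^ 2 :=
    sq_le_sq' (by linarith [norm_sub_norm_le q p, norm_sub_rev p q]) (norm_sub_norm_le p q)
  have h2 : 2 * (‖p‖ * ‖q‖) ≤ ε * ‖p‖ ^ 2 + ε⁻¹ * ‖q‖ ^ 2 := by
    have h3 : 0 ≤ ε⁻¹ * (ε * ‖p‖ - ‖q‖) ^ 2 := by positivity
    have h4 : ε⁻¹ * (ε * ‖p‖ - ‖q‖) ^ 2 =
        ε * ‖p‖ ^ 2 + ε⁻¹ * ‖q‖ ^ 2 - 2 * (‖p‖ * ‖q‖) := by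
      field_simp
      ring
    linarith
  nlinarith [sq_nonneg ‖q‖]

/-- The kinetic term yields `(1 - ε) ‖f‖²` and the potential takes away at most `C ‖f‖²` with `C <
1`. All remaining terms are multiples of `‖S f‖²` and are absorbed into the shift. -/
theorem Admissible.coercivePair (h : Admissible m A Z A₀) (hL : LargeShift m Z A₀ c C) :
    ∃ c' δ, CoercivePair (fmul (sqrtResolventSymbol m c)) (formOp m c A Z A₀) c' δ := by
  obtain ⟨D, hD⟩ := h.bounded
  obtain ⟨hc, hC, hV⟩ := hL
  have hm := h.pos
  -- Then `C = 1 - 2 ε`, so that `(1 - ε) - C = ε` is left as the coercivity constant.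
  set ε := (1 - C) / 2 with hεdef
  have hε : 0 < ε := by rw [hεdef]; linarith
  have hε1 : ε ≤ 1 := by rw [hεdef]; linarith [hV.nonneg]
  set S : L2 ν F →L[ℂ] L2 ν F := fmul (sqrtResolventSymbol m c)
  -- The first summand compensates the shift in the kinetic energy identity, the second the `ν`
  -- error terms `ε⁻¹ D² ‖S f‖²` caused by the components of `A`.
  refine ⟨c + 1 / (2 * m) * ν * (ε⁻¹ * D ^ 2), ε, isSelfAdjoint_fmul (bddSymbol_sqrtResolvent hm hc),
    fmul_injective (bddSymbol_sqrtResolvent hm hc)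
      fun ξ => (sqrtResolventSymbol_pos hm hc ξ).ne', h.isSelfAdjoint_formOp, hε, fun f => ?_⟩
  set P : Fin ν → L2 ν F := fun j => fmul (fun ξ => momentum j ξ * sqrtResolventSymbol m c ξ) f
  have hkin : ∀ j, (1 - ε) * ‖P j‖ ^ 2 - ε⁻¹ * (D ^ 2 * ‖S f‖ ^ 2) ≤
      ‖kineticFactor m c A j f‖ ^ 2 := by
    intro j
    refine le_trans ?_ (norm_sub_sq_ge (P j) (pmul (scalarOp F fun x => A x j) S f) hε)
    have h1 : ‖pmul (scalarOp F fun x => A x j) S f‖ ≤ D * ‖S f‖ := by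
      refine Lp.norm_le_mul_norm_of_ae_le_mul ?_
      filter_upwards [(h.pointwiseBound_component hD j S).coeFn_pmul f] with x hx
      rw [hx, scalarOp_apply, norm_smul, Complex.norm_real]
      exact mul_le_mul_of_nonneg_right (Admissible.abs_component_le hD j x) (norm_nonneg _)
    have h2 : ‖pmul (scalarOp F fun x => A x j) S f‖ ^ 2 ≤ D ^ 2 * ‖S f‖ ^ 2 := by
      rw [← mul_pow]; exact pow_le_pow_left₀ (norm_nonneg _) h1 2
    have := mul_le_mul_of_nonneg_left h2 (inv_nonneg.2 hε.le)
    linarith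
  have hsum : (1 - ε) * ∑ j, ‖P j‖ ^ 2 - ν * (ε⁻¹ * (D ^ 2 * ‖S f‖ ^ 2)) ≤
      ∑ j, ‖kineticFactor m c A j f‖ ^ 2 := by
    have := Finset.sum_le_sum fun j (_ : j ∈ Finset.univ) => hkin j
    rwa [Finset.sum_sub_distrib, ← Finset.mul_sum, Finset.sum_const, Finset.card_univ,
      Fintype.card_fin, nsmul_eq_mul] at this
  have hpot : -(C * ‖f‖ ^ 2) ≤ (inner ℂ (potentialFactor m c Z A₀ f)
      (pmul (potentialPhase m Z A₀) 1 (potentialFactor m c Z A₀ f))).re := by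
    have h1 := (h.pointwiseBound_potentialFactor ⟨hc, hC, hV⟩).norm_pmul_le
    have h2 := ContinuousLinearMap.le_of_opNorm_le _ h1 f
    have h3 : ‖pmul (potentialPhase m Z A₀) 1 (potentialFactor m c Z A₀ f)‖ ≤
        1 * ‖potentialFactor m c Z A₀ f‖ := by
      refine Lp.norm_le_mul_norm_of_ae_le_mul ?_
      filter_upwards [h.pointwiseBound_potentialPhase.coeFn_pmul (potentialFactor m c Z A₀ f)]
        with x hx
      rw [hx]
      exact ContinuousLinearMap.le_of_opNorm_le _ (norm_potentialPhase_le hm x) _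
    have h4 := (Complex.abs_re_le_norm _).trans (norm_inner_le_norm (𝕜 := ℂ)
      (potentialFactor m c Z A₀ f)
      (pmul (potentialPhase m Z A₀) 1 (potentialFactor m c Z A₀ f)))
    have h5 : ‖potentialFactor m c Z A₀ f‖ ^ 2 ≤ C * ‖f‖ ^ 2 := by
      have := pow_le_pow_left₀ (norm_nonneg _) h2 2
      rwa [mul_pow, Real.sq_sqrt hV.nonneg] at this
    have h6 := mul_le_mul_of_nonneg_left h3 (norm_nonneg (potentialFactor m c Z A₀ f))
    have h7 := (abs_le.1 h4).1
    nlinarith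
  have hre : (inner ℂ f (formOp m c A Z A₀ f)).re =
      1 / (2 * m) * ∑ j, ‖kineticFactor m c A j f‖ ^ 2 +
      (inner ℂ (potentialFactor m c Z A₀ f)
        (pmul (potentialPhase m Z A₀) 1 (potentialFactor m c Z A₀ f))).re := by
    rw [inner_formOp, Complex.add_re, Complex.re_ofReal_mul, Complex.re_sum]
    congr 2
    refine Finset.sum_congr rfl fun j _ => ?_
    rw [inner_self_eq_norm_sq_to_K]
    norm_cast
  have hid : 1 / (2 * m) * ∑ j, ‖P j‖ ^ 2 + c * ‖S f‖ ^ 2 = ‖f‖ ^ 2 :=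
    kinetic_energy_identity hm hc f
  have h2m : 0 ≤ 1 / (2 * m) := by positivity
  have hsum' := mul_le_mul_of_nonneg_left hsum h2m
  have hSf : 0 ≤ ε * (c * ‖S f‖ ^ 2) := by positivity
  have hC2 : C = 1 - 2 * ε := by rw [hεdef]; ring
  rw [hre]
  rw [hC2] at hpot
  have hid' := congrArg (fun t => (1 - ε) * t) hid
  linarith

theorem range_sqrtResolvent (hm : 0 < m) (hc : 0 < c) :
    Set.range (fmul (sqrtResolventSymbol m c) : L2 ν F →L[ℂ] L2 ν F) = sobolev ν F 1 := by
  ext ψ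
  exact (mem_sobolev_one_iff hm hc).symm

theorem Admissible.formQ_eq (h : Admissible m A Z A₀) (hL : LargeShift m Z A₀ c C) (f : L2 ν F) :
    formQ m A Z A₀ (fmul (sqrtResolventSymbol m c) f) = (inner ℂ f (formOp m c A Z A₀ f)).re := by
  rw [h.inner_formOp_eq_sesqForm hL, sesqForm_self_re]

/-! ### The Hamiltonian and its graph -/

variable [FiniteDimensional ℂ F]

theorem Admissible.form_wellDefined (h : Admissible m A Z A₀) {ψ : L2 ν F}
    (hψ : ψ ∈ sobolev ν F 1) :
    (∀ j, MemLp (fun x => -Complex.I • partialL2 j ψ x - (A x j : ℂ) • ψ x) 2 volume) ∧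
    Integrable (fun x => inner ℂ (ψ x) (potential m Z A₀ x (ψ x))) volume := by
  obtain ⟨c, C, hL⟩ := h.exists_largeShift
  obtain ⟨f, rfl⟩ := (mem_sobolev_one_iff h.pos hL.1).1 hψ
  exact ⟨fun j => (Lp.memLp _).ae_eq (h.coeFn_kineticFactor hL.1 j f),
    (L2.integrable_inner (𝕜 := ℂ) _ _).congr (h.inner_potential_ae hL f f)⟩

theorem Admissible.existsUnique (h : Admissible m A Z A₀) :
    ∃! H : L2 ν F →ₗ.[ℂ] L2 ν F, IsHamiltonian m A Z A₀ H := by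
  obtain ⟨c, C, hL⟩ := h.exists_largeShift
  obtain ⟨c', δ, hp⟩ := h.coercivePair hL
  have := hp.existsUnique (q := formQ m A Z A₀) (h.formQ_eq hL)
  rwa [range_sqrtResolvent h.pos hL.1] at this

/-- This is the first representation theorem. The description no longer mentions the auxiliary shift
`c`, so it can be used to compare Hamiltonians and to change `c`. -/
theorem Admissible.mem_graph_iff (h : Admissible m A Z A₀) {H : L2 ν F →ₗ.[ℂ] L2 ν F}
    (hH : IsHamiltonian m A Z A₀ H) {u w : L2 ν F} :
    (u, w) ∈ H.graph ↔ u ∈ sobolev ν F 1 ∧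
      ∀ φ ∈ sobolev ν F 1, sesqForm m A Z A₀ φ u = inner ℂ φ w := by
  obtain ⟨c, C, hL⟩ := h.exists_largeShift
  obtain ⟨c', δ, hp⟩ := h.coercivePair hL
  have hr := range_sqrtResolvent (F := F) (ν := ν) h.pos hL.1
  rw [IsHamiltonian, ← hr] at hH
  rw [hp.mem_graph_iff (h.formQ_eq hL) hH, ← hr]
  constructor
  · rintro ⟨g, rfl, hg⟩
    refine ⟨⟨g, rfl⟩, ?_⟩
    rintro _ ⟨f, rfl⟩
    rw [← h.inner_formOp_eq_sesqForm hL, hg,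
      inner_apply_eq_of_isSelfAdjoint hp.selfAdjoint_left]
  · rintro ⟨⟨g, rfl⟩, hg⟩
    refine ⟨g, rfl, ext_inner_left ℂ fun f => ?_⟩
    rw [h.inner_formOp_eq_sesqForm hL, hg _ ⟨f, rfl⟩,
      inner_apply_eq_of_isSelfAdjoint hp.selfAdjoint_left]

/-- Semiboundedness makes `H + c` injective for every `c > c'`, which is how the domain is
identified later. -/
theorem Admissible.exists_lower_bound (h : Admissible m A Z A₀) :
    ∃ c', ∀ H : L2 ν F →ₗ.[ℂ] L2 ν F, IsHamiltonian m A Z A₀ H → ∀ u w, (u, w) ∈ H.graph →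
      0 ≤ (inner ℂ u w).re + c' * ‖u‖ ^ 2 := by
  obtain ⟨c, C, hL⟩ := h.exists_largeShift
  obtain ⟨c', δ, hp⟩ := h.coercivePair hL
  refine ⟨c', fun H hH u w huw => ?_⟩
  obtain ⟨hu, hw⟩ := (h.mem_graph_iff hH).1 huw
  obtain ⟨g, rfl⟩ := (mem_sobolev_one_iff h.pos hL.1).1 hu
  rw [← hw _ hu, ← h.inner_formOp_eq_sesqForm hL]
  exact (mul_nonneg hp.pos.le (sq_nonneg _)).trans (hp.coercive g)

end

noncomputable section

variable {ν : ℕ} {F : Type} [NormedAddCommGroup F] [InnerProductSpace ℂ F] [CompleteSpace F]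

open FourierTransform

/-! ### Density of Schwartz functions in `W^1` -/

section Density

variable {m c : ℝ}

/-- Up to the constant `√c⁻¹` the symbol is `(1 + ‖α ξ‖²)^{-1/2}` with a rescaled variable. -/
theorem hasTemperateGrowth_sqrtResolvent (hm : 0 < m) (hc : 0 < c) :
    (sqrtResolventSymbol m c : Pos ν → ℝ).HasTemperateGrowth := by
  have hpos : ∀ ξ : Pos ν, (0 : ℝ) < 1 + ‖ξ‖ ^ 2 := fun ξ => by positivity
  set α : ℝ := 2 * Real.pi / √(2 * m * c)
  have hα : α ^ 2 = (2 * Real.pi) ^ 2 / (2 * m * c) := by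
    rw [div_pow, Real.sq_sqrt (by positivity)]
  have h1 : (fun ξ : Pos ν => α • ξ).HasTemperateGrowth := by fun_prop
  have h2 := (Function.hasTemperateGrowth_one_add_norm_sq_rpow (Pos ν) (-(1 / 2))).comp h1
  have h3 : (fun _ : Pos ν => √c⁻¹).HasTemperateGrowth := by fun_prop
  suffices key : (sqrtResolventSymbol m c : Pos ν → ℝ) =
      (fun _ => √c⁻¹) * ((fun ξ => (1 + ‖ξ‖ ^ 2) ^ (-(1 / 2 : ℝ))) ∘ fun ξ => α • ξ) by
    rw [key]
    exact h3.mul h2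
  funext ξ
  rw [Pi.mul_apply, Function.comp_apply, Real.rpow_neg (hpos _).le, ← Real.sqrt_eq_rpow,
    ← Real.sqrt_inv, ← Real.sqrt_mul (inv_nonneg.2 hc.le), sqrtResolventSymbol, resolventSymbol,
    ← mul_inv]
  congr 2
  rw [norm_smul, mul_pow, Real.norm_eq_abs, sq_abs, hα, kinetic]
  field_simp
  ring

theorem fmul_toLp {g : Pos ν → ℝ} (hg : BddSymbol g) (hg' : g.HasTemperateGrowth)
    (f : 𝓢(Pos ν, F)) : ∃ η : 𝓢(Pos ν, F), fmul g (f.toLp 2 volume) = η.toLp 2 volume := by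
  refine ⟨SchwartzMap.fourierMultiplierCLM F (fun ξ => (g ξ : ℂ)) f,
    toTemperedDistribution_injective ?_⟩
  dsimp only
  have hb : BddSymbol fun ξ => g ξ * 1 := hg.mul bddSymbol_one
  have h1 := fourierMultiplierCLM_fmul hg' bddSymbol_one hb (f.toLp 2 volume)
  simp only [mul_one, fmul_one] at h1
  rw [← h1, Lp.toTemperedDistribution_toLp_eq, Lp.toTemperedDistribution_toLp_eq,
    TemperedDistribution.fourierMultiplierCLM_toTemperedDistributionCLM_eq (by fun_prop)]

/-- The operator `(H₀ + c)^{-1/2}` maps Schwartz functions to Schwartz functions. Hence closed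
identities on `W^1`, parametrised by `f`, only need to be checked where both `f` and its image are
Schwartz. -/
theorem schwartz_induction (hm : 0 < m) (hc : 0 < c) {p : L2 ν F → Prop}
    (hp : IsClosed {f | p f})
    (h : ∀ f η : 𝓢(Pos ν, F),
      fmul (sqrtResolventSymbol m c) (f.toLp 2 volume) = η.toLp 2 volume → p (f.toLp 2 volume))
    (f : L2 ν F) : p f := by
  refine DenseRange.induction_on (p := p) (SchwartzMap.denseRange_toLpCLM (F := F)
    (μ := (volume : Measure (Pos ν))) (p := 2) ENNReal.ofNat_ne_top) f hp fun f => ?_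
  obtain ⟨η, hη⟩ := fmul_toLp (bddSymbol_sqrtResolvent hm hc)
    (hasTemperateGrowth_sqrtResolvent hm hc) f
  exact h f η hη

theorem partialL2_toLp (j : Fin ν) (η : 𝓢(Pos ν, F)) :
    partialL2 j (η.toLp 2 volume) =
      (∂_{EuclideanSpace.single j (1 : ℝ)} η : 𝓢(Pos ν, F)).toLp 2 volume := by
  refine partialL2_eq_of_lineDeriv ?_
  rw [Lp.toTemperedDistribution_toLp_eq, Lp.toTemperedDistribution_toLp_eq,
    TemperedDistribution.lineDerivOp_toTemperedDistributionCLM_eq]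

end Density

/-! ### Characterization of `W^1` by partial derivatives -/

theorem fourierMultiplierCLM_coe {p : Pos ν → ℝ} (hp : p.HasTemperateGrowth) (hb : BddSymbol p)
    (f : L2 ν F) :
    TemperedDistribution.fourierMultiplierCLM F (fun ξ => (p ξ : ℂ)) (f : 𝓢'(Pos ν, F)) =
      (fmul p f : 𝓢'(Pos ν, F)) := by
  have h1 := fourierMultiplierCLM_fmul hp bddSymbol_one (hb.mul bddSymbol_one) f
  simpa only [mul_one, fmul_one] using h1

theorem coe_add_L2 (f g : L2 ν F) :
    ((f + g : L2 ν F) : 𝓢'(Pos ν, F)) = (f : 𝓢'(Pos ν, F)) + (g : 𝓢'(Pos ν, F)) :=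
  map_add (Lp.toTemperedDistributionCLM F (volume : Measure (Pos ν)) 2) f g

theorem coe_sum_L2 {ι : Type} (s : Finset ι) (f : ι → L2 ν F) :
    ((∑ i ∈ s, f i : L2 ν F) : 𝓢'(Pos ν, F)) = ∑ i ∈ s, (f i : 𝓢'(Pos ν, F)) :=
  map_sum (Lp.toTemperedDistributionCLM F (volume : Measure (Pos ν)) 2) f s

/-- With `J = (1 + ‖ξ‖²)^{-1/2}` one has `(1 + ‖ξ‖²)^{1/2} = J + ∑ ξ_j (J ξ_j)`. The multipliers `J`
and `J ξ_j` are bounded, and the remaining factors `ξ_j` are the given derivatives divided by `2πi`.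
-/
theorem mem_sobolev_one_of_lineDeriv {ψ : L2 ν F} (w : Fin ν → L2 ν F)
    (hw : ∀ j, ∂_{EuclideanSpace.single j (1 : ℝ)} (ψ : 𝓢'(Pos ν, F)) =
      (w j : 𝓢'(Pos ν, F))) : ψ ∈ sobolev ν F 1 := by
  have hpos : ∀ ξ : Pos ν, (0 : ℝ) < 1 + ‖ξ‖ ^ 2 := fun ξ => by positivity
  set J : Pos ν → ℝ := fun ξ => (1 + ‖ξ‖ ^ 2) ^ (-(1 : ℝ) / 2)
  have hJ : J.HasTemperateGrowth := by fun_prop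
  have hJsq : ∀ ξ, J ξ ^ 2 * (1 + ‖ξ‖ ^ 2) = 1 := by
    intro ξ
    simp only [J]
    rw [neg_div, Real.rpow_neg (hpos ξ).le, ← Real.sqrt_eq_rpow, inv_pow,
      Real.sq_sqrt (hpos ξ).le, inv_mul_cancel₀ (hpos ξ).ne']
  have hJ0 : ∀ ξ, 0 < J ξ := fun ξ => Real.rpow_pos_of_pos (hpos ξ) _
  have hJb : BddSymbol J := by
    refine ⟨by fun_prop, 1, fun ξ => ?_⟩
    rw [← sq_le_one_iff_abs_le_one]
    nlinarith [hJsq ξ, sq_nonneg ‖ξ‖, sq_nonneg (J ξ), mul_nonneg (sq_nonneg (J ξ)) (sq_nonneg ‖ξ‖)]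
  set e : Fin ν → Pos ν → ℝ := fun j ξ => inner ℝ ξ (EuclideanSpace.single j (1 : ℝ))
  have he : ∀ j ξ, e j ξ = ξ j := fun j ξ => by simp [e, EuclideanSpace.inner_single_right]
  have het : ∀ j, (e j).HasTemperateGrowth := fun j => by simp only [e]; fun_prop
  have hJe : ∀ j, BddSymbol fun ξ => J ξ * e j ξ := by
    intro j
    have hmeas : Measurable (e j) := by simp only [e]; fun_prop
    refine ⟨hJb.measurable.mul hmeas, 1, fun ξ => ?_⟩
    rw [← sq_le_one_iff_abs_le_one, mul_pow, he]
    have h1 : ξ j ^ 2 ≤ ‖ξ‖ ^ 2 := by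
      rw [← sq_abs]
      exact pow_le_pow_left₀ (abs_nonneg _) (PiLp.norm_apply_le ξ j) 2
    nlinarith [hJsq ξ, sq_nonneg (J ξ), mul_le_mul_of_nonneg_left h1 (sq_nonneg (J ξ))]
  have key : (fun ξ : Pos ν => (((1 + ‖ξ‖ ^ 2) ^ (((1 : ℕ) : ℝ) / 2) : ℝ) : ℂ)) =
      (fun ξ => (J ξ : ℂ)) + fun ξ => ∑ j, ((e j ξ : ℂ) * ((J ξ * e j ξ : ℝ) : ℂ)) := by
    ext ξ
    rw [Pi.add_apply]
    norm_cast
    have h1 : ∑ j, e j ξ * (J ξ * e j ξ) = J ξ * ‖ξ‖ ^ 2 := by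
      rw [EuclideanSpace.norm_sq_eq, Finset.mul_sum]
      refine Finset.sum_congr rfl fun j _ => ?_
      rw [he, Real.norm_eq_abs, sq_abs]
      ring
    have h2 : (1 + ‖ξ‖ ^ 2) ^ ((1 : ℝ) / 2) * J ξ = 1 := by
      simp only [J]
      rw [← Real.rpow_add (hpos ξ)]
      norm_num
    rw [h1]
    have h3 := hJsq ξ
    have h4 := (hJ0 ξ).ne'
    apply mul_right_cancel₀ h4
    rw [h2, ← h3]
    ring
  have hterm : ∀ j, (fun ξ => (e j ξ : ℂ) * ((J ξ * e j ξ : ℝ) : ℂ)).HasTemperateGrowth := by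
    intro j
    have h1 := het j
    have h2 := (hJ.mul (het j))
    have h3 : (fun ξ => J ξ * e j ξ).HasTemperateGrowth := h2
    fun_prop
  refine ⟨fmul J ψ + ∑ j, fmul (fun ξ => J ξ * e j ξ)
    ((2 * Real.pi * Complex.I)⁻¹ • w j), ?_⟩
  have h2pi : (2 * Real.pi * Complex.I : ℂ) ≠ 0 := Complex.two_pi_I_ne_zero
  rw [TemperedDistribution.besselPotential, key, TemperedDistribution.fourierMultiplierCLM_apply,
    TemperedDistribution.smulLeftCLM_add (by fun_prop)
      (Function.HasTemperateGrowth.sum fun j _ => hterm j),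
    TemperedDistribution.smulLeftCLM_sum fun j _ => hterm j, coe_add_L2, coe_sum_L2,
    ← fourierMultiplierCLM_coe hJ hJb]
  simp only [add_apply, sum_apply, FourierTransform.fourierInv_add,
    FourierTransform.fourierInv_sum]
  congr 1
  refine Finset.sum_congr rfl fun j _ => ?_
  have h3 : (fun ξ => J ξ * e j ξ).HasTemperateGrowth := hJ.mul (het j)
  have h4 : (fun ξ => ((J ξ * e j ξ : ℝ) : ℂ)).HasTemperateGrowth := by fun_prop
  have h5 : (fun ξ => ((e j ξ : ℝ) : ℂ)).HasTemperateGrowth := by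
    have := het j
    fun_prop
  rw [← fourierMultiplierCLM_coe h3 (hJe j), coe_smul_L2, ← hw j,
    TemperedDistribution.lineDeriv_eq_fourierMultiplierCLM, smul_smul, inv_mul_cancel₀ h2pi,
    one_smul, TemperedDistribution.fourierMultiplierCLM_fourierMultiplierCLM_apply h5 h4]
  rfl

/-! ### Gauge transformations -/

section Gauge

variable (lam : C(Pos ν, ℝ))

theorem coeFn_phase (ψ : L2 ν F) :
    phase lam ψ =ᵐ[volume] fun x => Complex.exp (Complex.I * (lam x : ℂ)) • ψ x :=
  (memLp_phase lam ψ).coeFn_toLp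

theorem norm_exp_phase (x : Pos ν) : ‖Complex.exp (Complex.I * (lam x : ℂ))‖ = 1 := by
  rw [mul_comm, Complex.norm_exp_ofReal_mul_I]

theorem norm_phase (ψ : L2 ν F) : ‖phase lam ψ‖ = ‖ψ‖ := by
  rw [Lp.norm_def, Lp.norm_def]
  congr 1
  refine eLpNorm_congr_norm_ae ?_
  filter_upwards [coeFn_phase lam ψ] with x hx
  rw [hx, norm_smul, norm_exp_phase, one_mul]

theorem continuous_phase : Continuous (phase lam : L2 ν F →ₗ[ℂ] L2 ν F) :=
  ((phase lam).mkContinuous 1 fun ψ => by rw [norm_phase, one_mul]).continuous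

theorem phase_phase_neg (ψ : L2 ν F) : phase lam (phase (-lam) ψ) = ψ := by
  refine Lp.ext ?_
  filter_upwards [coeFn_phase lam (phase (-lam) ψ), coeFn_phase (-lam) ψ] with x h1 h2
  rw [h1, h2, smul_smul, ← Complex.exp_add]
  simp

theorem inner_phase_phase (φ ψ : L2 ν F) : inner ℂ (phase lam φ) (phase lam ψ) = inner ℂ φ ψ := by
  rw [L2_inner_eq, L2_inner_eq]
  refine integral_congr_ae ?_
  filter_upwards [coeFn_phase lam φ, coeFn_phase lam ψ] with x h1 h2
  rw [h1, h2, inner_smul_left, inner_smul_right, ← mul_assoc, Complex.conj_mul',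
    norm_exp_phase]
  simp

variable {lam} {G : Pos ν → Pos ν}

theorem hasLineDerivAt_phase (hG : ∀ x, HasGradientAt lam (G x) x) (η : 𝓢(Pos ν, F)) (j : Fin ν)
    (x : Pos ν) :
    HasLineDerivAt ℝ (fun x => Complex.exp (Complex.I * (lam x : ℂ)) • η x)
      (Complex.exp (Complex.I * (lam x : ℂ)) •
        ((∂_{EuclideanSpace.single j (1 : ℝ)} η : 𝓢(Pos ν, F)) x +
          (Complex.I * (G x j : ℂ)) • η x)) x (EuclideanSpace.single j (1 : ℝ)) := by
  have h1 : HasLineDerivAt ℝ lam (G x j) x (EuclideanSpace.single j (1 : ℝ)) := by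
    have := (hG x).hasFDerivAt.hasLineDerivAt (EuclideanSpace.single j (1 : ℝ))
    simpa [EuclideanSpace.inner_single_right] using this
  have h2 : HasLineDerivAt ℝ η ((∂_{EuclideanSpace.single j (1 : ℝ)} η : 𝓢(Pos ν, F)) x) x
      (EuclideanSpace.single j (1 : ℝ)) := by
    rw [SchwartzMap.lineDerivOp_apply_eq_fderiv]
    exact (η.differentiableAt).hasFDerivAt.hasLineDerivAt _
  unfold HasLineDerivAt at h1 h2 ⊢
  have h3 := (((h1.ofReal_comp).const_mul Complex.I).cexp).smul h2
  refine h3.congr_deriv ?_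
  simp only [zero_smul, add_zero]
  rw [smul_add, smul_smul]

/-- Since `λ` need not be smooth, `e^{iλ} η` need not be Schwartz. The product rule holds pointwise,
and integration by parts along lines, with integrable products, makes it distributional. -/
theorem lineDeriv_phase_toLp (hG : ∀ x, HasGradientAt lam (G x) x) (hGc : Continuous G)
    {D : ℝ} (hD : ∀ x, ‖G x‖ ≤ D) (j : Fin ν) (η : 𝓢(Pos ν, F)) :
    ∂_{EuclideanSpace.single j (1 : ℝ)} (phase lam (η.toLp 2 volume) : 𝓢'(Pos ν, F)) =
      ((phase lam ((∂_{EuclideanSpace.single j (1 : ℝ)} η : 𝓢(Pos ν, F)).toLp 2 volume) +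
        Complex.I • pmul (scalarOp F fun x => G x j) 1 (phase lam (η.toLp 2 volume)) : L2 ν F) :
          𝓢'(Pos ν, F)) := by
  have hGj : Continuous fun x => G x j := by fun_prop
  have hpb : PointwiseBound (scalarOp F fun x => G x j) 1 (D * ‖(1 : L2 ν F →L[ℂ] L2 ν F)‖) :=
    pointwiseBound_scalarOp hGj.measurable.aemeasurable
      (fun x => (PiLp.norm_apply_le (G x) j).trans (hD x)) 1
  set u : L2 ν F := phase lam (η.toLp 2 volume)
  set w : L2 ν F := phase lam ((∂_{EuclideanSpace.single j (1 : ℝ)} η : 𝓢(Pos ν, F)).toLp 2 volume) +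
        Complex.I • pmul (scalarOp F fun x => G x j) 1 u
  have hu : u =ᵐ[volume] fun x => Complex.exp (Complex.I * (lam x : ℂ)) • η x := by
    filter_upwards [coeFn_phase lam (η.toLp 2 volume), η.coeFn_toLp 2 volume] with x h1 h2
    rw [h1, h2]
  have hw : w =ᵐ[volume] fun x => Complex.exp (Complex.I * (lam x : ℂ)) •
        ((∂_{EuclideanSpace.single j (1 : ℝ)} η : 𝓢(Pos ν, F)) x +
          (Complex.I * (G x j : ℂ)) • η x) := by
    filter_upwards [Lp.coeFn_add (phase lam
        ((∂_{EuclideanSpace.single j (1 : ℝ)} η : 𝓢(Pos ν, F)).toLp 2 volume))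
        (Complex.I • pmul (scalarOp F fun x => G x j) 1 u),
      Lp.coeFn_smul Complex.I (pmul (scalarOp F fun x => G x j) 1 u), hpb.coeFn_pmul u, hu,
      coeFn_phase lam ((∂_{EuclideanSpace.single j (1 : ℝ)} η : 𝓢(Pos ν, F)).toLp 2 volume),
      (∂_{EuclideanSpace.single j (1 : ℝ)} η : 𝓢(Pos ν, F)).coeFn_toLp 2 volume]
      with x h1 h2 h3 h4 h5 h6
    rw [h1, Pi.add_apply, h2, Pi.smul_apply, h3, h5, h6, scalarOp_apply,
      show (1 : L2 ν F →L[ℂ] L2 ν F) u = u from rfl, h4, smul_add, smul_smul, smul_smul,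
      smul_smul]
    congr 2
    ring
  ext φ
  rw [TemperedDistribution.lineDerivOp_apply_apply, map_neg, Lp.toTemperedDistribution_apply,
    Lp.toTemperedDistribution_apply]
  have hint : ∀ (φ : 𝓢(Pos ν, ℂ)) (u : L2 ν F), Integrable (fun x => φ x • u x) volume := by
    intro φ u
    have h1 := (Lp.memLp u).smul (φ.memLp 2 volume) (r := 1)
    exact memLp_one_iff_integrable.1 h1
  have e1 : ∫ x, (∂_{EuclideanSpace.single j (1 : ℝ)} φ : 𝓢(Pos ν, ℂ)) x • u x =
      ∫ x, ContinuousLinearMap.lsmul ℝ ℂ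
        ((∂_{EuclideanSpace.single j (1 : ℝ)} φ : 𝓢(Pos ν, ℂ)) x)
        (Complex.exp (Complex.I * (lam x : ℂ)) • η x) := by
    refine integral_congr_ae ?_
    filter_upwards [hu] with x hx
    rw [hx]; rfl
  have e2 : ∫ x, φ x • w x = ∫ x, ContinuousLinearMap.lsmul ℝ ℂ (φ x)
      (Complex.exp (Complex.I * (lam x : ℂ)) •
        ((∂_{EuclideanSpace.single j (1 : ℝ)} η : 𝓢(Pos ν, F)) x +
          (Complex.I * (G x j : ℂ)) • η x)) := by
    refine integral_congr_ae ?_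
    filter_upwards [hw] with x hx
    rw [hx]; rfl
  rw [e1, e2, integral_bilinear_hasLineDerivAt_right_eq_neg_left_of_integrable
    (f := φ) (f' := (∂_{EuclideanSpace.single j (1 : ℝ)} φ : 𝓢(Pos ν, ℂ)))
    (v := EuclideanSpace.single j (1 : ℝ))]
  · refine (hint (∂_{EuclideanSpace.single j (1 : ℝ)} φ) u).congr ?_
    filter_upwards [hu] with x hx
    rw [hx]; rfl
  · refine (hint φ w).congr ?_
    filter_upwards [hw] with x hx
    rw [hx]; rfl
  · refine (hint φ u).congr ?_
    filter_upwards [hu] with x hx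
    rw [hx]; rfl
  · intro x _
    rw [SchwartzMap.lineDerivOp_apply_eq_fderiv]
    exact (φ.differentiableAt).hasFDerivAt.hasLineDerivAt _
  · intro x _
    exact hasLineDerivAt_phase hG η j x

theorem lineDeriv_phase (hG : ∀ x, HasGradientAt lam (G x) x) (hGc : Continuous G)
    {D : ℝ} (hD : ∀ x, ‖G x‖ ≤ D) (j : Fin ν) {ψ : L2 ν F} (hψ : ψ ∈ sobolev ν F 1) :
    ∂_{EuclideanSpace.single j (1 : ℝ)} (phase lam ψ : 𝓢'(Pos ν, F)) =
      ((phase lam (partialL2 j ψ) +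
        Complex.I • pmul (scalarOp F fun x => G x j) 1 (phase lam ψ) : L2 ν F) :
          𝓢'(Pos ν, F)) := by
  obtain ⟨f, rfl⟩ := (mem_sobolev_one_iff one_pos one_pos).1 hψ
  have hS := bddSymbol_sqrtResolvent (ν := ν) (m := 1) (c := 1) one_pos one_pos
  have hP := bddSymbol_momentum_mul_sqrtResolvent (ν := ν) (m := 1) (c := 1) one_pos one_pos j
  refine schwartz_induction (m := 1) (c := 1) one_pos one_pos (p := fun f =>
    ∂_{EuclideanSpace.single j (1 : ℝ)} (phase lam (fmul (sqrtResolventSymbol 1 1) f) :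
      𝓢'(Pos ν, F)) =
      ((phase lam (partialL2 j (fmul (sqrtResolventSymbol 1 1) f)) +
        Complex.I • pmul (scalarOp F fun x => G x j) 1
          (phase lam (fmul (sqrtResolventSymbol 1 1) f)) : L2 ν F) : 𝓢'(Pos ν, F))) ?_ ?_ f
  · have hph : Continuous fun f : L2 ν F => phase lam (fmul (sqrtResolventSymbol 1 1) f) :=
      (continuous_phase lam).comp (fmul _).continuous
    simp only [partialL2_fmul j hS hP]
    refine isClosed_eq ?_ ?_
    · exact ((LineDeriv.lineDerivOpCLM ℂ 𝓢'(Pos ν, F) (EuclideanSpace.single j (1 : ℝ))).continuous.comp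
        (Lp.toTemperedDistributionCLM F volume 2).continuous).comp hph
    · refine (Lp.toTemperedDistributionCLM F (volume : Measure (Pos ν)) 2).continuous.comp ?_
      refine ((continuous_phase lam).comp ((fmul _).continuous.const_smul Complex.I)).add ?_
      exact ((pmul _ 1).continuous.comp hph).const_smul Complex.I
  · intro f η hη
    rw [hη, partialL2_toLp]
    exact lineDeriv_phase_toLp hG hGc hD j η

theorem phase_mem_sobolev_one (hG : ∀ x, HasGradientAt lam (G x) x) (hGc : Continuous G)
    {D : ℝ} (hD : ∀ x, ‖G x‖ ≤ D) {ψ : L2 ν F} (hψ : ψ ∈ sobolev ν F 1) :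
    phase lam ψ ∈ sobolev ν F 1 :=
  mem_sobolev_one_of_lineDeriv _ fun j => lineDeriv_phase hG hGc hD j hψ

variable {m : ℝ} {A A' : Pos ν → Pos ν} {Z : Pos ν → F →L[ℂ] F} {A₀ : Pos ν → ℝ}

/-- The term `∇λ` from the product rule cancels against `A' - A`. -/
theorem covariant_phase_ae (hG : ∀ x, HasGradientAt lam (A' x - A x) x)
    (hGc : Continuous fun x => A' x - A x) {D : ℝ} (hD : ∀ x, ‖A' x - A x‖ ≤ D) (j : Fin ν)
    {ψ : L2 ν F} (hψ : ψ ∈ sobolev ν F 1) :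
    ∀ᵐ x, -Complex.I • partialL2 j (phase lam ψ) x - (A' x j : ℂ) • phase lam ψ x =
      Complex.exp (Complex.I * (lam x : ℂ)) •
        (-Complex.I • partialL2 j ψ x - (A x j : ℂ) • ψ x) := by
  have hpb : PointwiseBound (scalarOp F fun x => (A' x - A x) j) 1
      (D * ‖(1 : L2 ν F →L[ℂ] L2 ν F)‖) :=
    pointwiseBound_scalarOp
      (show Continuous fun x => (A' x - A x) j by fun_prop).measurable.aemeasurable
      (fun x => (PiLp.norm_apply_le (A' x - A x) j).trans (hD x)) 1
  rw [partialL2_eq_of_lineDeriv (lineDeriv_phase hG hGc hD j hψ)]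
  filter_upwards [Lp.coeFn_add (phase lam (partialL2 j ψ))
      (Complex.I • pmul (scalarOp F fun x => (A' x - A x) j) 1 (phase lam ψ)),
    Lp.coeFn_smul Complex.I (pmul (scalarOp F fun x => (A' x - A x) j) 1 (phase lam ψ)),
    hpb.coeFn_pmul (phase lam ψ), coeFn_phase lam ψ, coeFn_phase lam (partialL2 j ψ)]
    with x h1 h2 h3 h4 h5
  rw [h1, Pi.add_apply, h2, Pi.smul_apply, h3, h5, scalarOp_apply,
    show (1 : L2 ν F →L[ℂ] L2 ν F) (phase lam ψ) = phase lam ψ from rfl, h4, smul_add,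
    smul_smul (-Complex.I) Complex.I, neg_mul, Complex.I_mul_I, neg_neg, one_smul,
    PiLp.sub_apply, Complex.ofReal_sub]
  module

theorem sesqForm_phase (hG : ∀ x, HasGradientAt lam (A' x - A x) x)
    (hGc : Continuous fun x => A' x - A x) {D : ℝ} (hD : ∀ x, ‖A' x - A x‖ ≤ D)
    {φ ψ : L2 ν F} (hφ : φ ∈ sobolev ν F 1) (hψ : ψ ∈ sobolev ν F 1) :
    sesqForm m A' Z A₀ (phase lam φ) (phase lam ψ) = sesqForm m A Z A₀ φ ψ := by
  have hin : ∀ (x : Pos ν) (a b : F), inner ℂ (Complex.exp (Complex.I * (lam x : ℂ)) • a)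
      (Complex.exp (Complex.I * (lam x : ℂ)) • b) = inner ℂ a b := by
    intro x a b
    rw [inner_smul_left, inner_smul_right, ← mul_assoc, Complex.conj_mul', norm_exp_phase]
    simp
  rw [sesqForm, sesqForm]
  congr 1
  · congr 1
    refine Finset.sum_congr rfl fun j _ => integral_congr_ae ?_
    filter_upwards [covariant_phase_ae hG hGc hD j hφ, covariant_phase_ae hG hGc hD j hψ]
      with x h1 h2
    rw [h1, h2, hin]
  · refine integral_congr_ae ?_
    filter_upwards [coeFn_phase lam φ, coeFn_phase lam ψ] with x h1 h2
    rw [h1, h2, ← potentialOp_apply, map_smul, hin, potentialOp_apply]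

variable [FiniteDimensional ℂ F]

theorem Admissible.phase_mem_graph (h : Admissible m A Z A₀) (h' : Admissible m A' Z A₀)
    (hG : ∀ x, HasGradientAt lam (A' x - A x) x) {H H' : L2 ν F →ₗ.[ℂ] L2 ν F}
    (hH : IsHamiltonian m A Z A₀ H) (hH' : IsHamiltonian m A' Z A₀ H') {u w : L2 ν F}
    (huw : (u, w) ∈ H.graph) : (phase lam u, phase lam w) ∈ H'.graph := by
  obtain ⟨C, hC⟩ := h.bounded
  obtain ⟨C', hC'⟩ := h'.bounded
  have hD : ∀ x, ‖A' x - A x‖ ≤ C' + C := fun x =>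
    (norm_sub_le _ _).trans (add_le_add (hC' x) (hC x))
  have hGc : Continuous fun x => A' x - A x := h'.continuous.sub h.continuous
  have hG' : ∀ x, HasGradientAt (-lam : C(Pos ν, ℝ)) (-(A' x - A x)) x := by
    intro x
    rw [hasGradientAt_iff_hasFDerivAt, map_neg]
    exact (hG x).hasFDerivAt.neg
  obtain ⟨hu, hw⟩ := (h.mem_graph_iff hH).1 huw
  refine (h'.mem_graph_iff hH').2 ⟨phase_mem_sobolev_one hG hGc hD hu, fun φ hφ => ?_⟩
  have hφ' : phase (-lam) φ ∈ sobolev ν F 1 :=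
    phase_mem_sobolev_one hG' hGc.neg (fun x => by rw [norm_neg]; exact hD x) hφ
  rw [← phase_phase_neg lam φ, sesqForm_phase hG hGc hD hφ' hu, inner_phase_phase, hw _ hφ']

/-- One inclusion of graphs suffices, because the roles of `A` and `A'` are exchanged by passing to
`-λ`. -/
theorem Admissible.gauge (h : Admissible m A Z A₀) (h' : Admissible m A' Z A₀)
    (hG : ∀ x, HasGradientAt lam (A' x - A x) x) {H H' : L2 ν F →ₗ.[ℂ] L2 ν F}
    (hH : IsHamiltonian m A Z A₀ H) (hH' : IsHamiltonian m A' Z A₀ H') :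
    H'.domain = H.domain.map (phase lam) ∧
      ∀ (ψ : H'.domain) (φ : H.domain), (φ : L2 ν F) = phase (-lam) (ψ : L2 ν F) →
        H' ψ = phase lam (H φ) := by
  have hG' : ∀ x, HasGradientAt (-lam : C(Pos ν, ℝ)) (A x - A' x) x := by
    intro x
    rw [← neg_sub, hasGradientAt_iff_hasFDerivAt, map_neg]
    exact (hG x).hasFDerivAt.neg
  refine ⟨?_, fun ψ φ hφ => ?_⟩
  · ext ψ
    rw [Submodule.mem_map]
    constructor
    · intro hψ
      have := h'.phase_mem_graph h hG' hH' hH (H'.mem_graph ⟨ψ, hψ⟩)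
      exact ⟨_, LinearPMap.mem_domain_of_mem_graph this, phase_phase_neg lam ψ⟩
    · rintro ⟨φ, hφ, rfl⟩
      exact LinearPMap.mem_domain_of_mem_graph
        (h.phase_mem_graph h' hG hH hH' (H.mem_graph ⟨φ, hφ⟩))
  · have h1 := h.phase_mem_graph h' hG hH hH' (H.mem_graph φ)
    rw [hφ, phase_phase_neg] at h1
    exact H'.mem_graph_snd_inj (H'.mem_graph ψ) h1 rfl

end Gauge

end

noncomputable section

variable {ν : ℕ} {F : Type} [NormedAddCommGroup F] [InnerProductSpace ℂ F] [CompleteSpace F]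

open FourierTransform

/-! ### The expanded Hamiltonian -/

theorem bddSymbol_sum {ι : Type} (s : Finset ι) {g : ι → Pos ν → ℝ}
    (hg : ∀ i, BddSymbol (g i)) : BddSymbol fun ξ => ∑ i ∈ s, g i ξ := by
  choose C hC using fun i => (hg i).bdd
  refine ⟨Finset.measurable_fun_sum s fun i _ => (hg i).measurable, ∑ i ∈ s, C i, fun ξ => ?_⟩
  exact (Finset.abs_sum_le_sum_abs _ _).trans (Finset.sum_le_sum fun i _ => hC i ξ)

theorem fmul_sum {ι : Type} (s : Finset ι) {g : ι → Pos ν → ℝ} (hg : ∀ i, BddSymbol (g i))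
    (f : L2 ν F) : ∑ i ∈ s, fmul (g i) f = fmul (fun ξ => ∑ i ∈ s, g i ξ) f := by
  classical
  induction s using Finset.induction_on with
  | empty =>
    simp only [Finset.sum_empty]
    have h1 := fmul_const_mul (bddSymbol_one (ν := ν)) 0 f
    simpa using h1.symm
  | insert i s hi ih =>
    simp only [Finset.sum_insert hi]
    rw [ih, fmul_add (hg i) (bddSymbol_sum s hg)]

theorem pmul_apply_eq {L : Pos ν → F →L[ℂ] F} {T : L2 ν F →L[ℂ] L2 ν F} {C C' : ℝ}
    (h : PointwiseBound L T C) (h' : PointwiseBound L 1 C') (f : L2 ν F) :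
    pmul L T f = pmul L 1 (T f) :=
  Lp.ext ((h.coeFn_pmul f).trans (h'.coeFn_pmul (T f)).symm)

theorem pointwiseBound_of_memLp_top {D : Pos ν → ℝ} (hD : MemLp D ∞ volume) {C : ℝ}
    (hC : ∀ᵐ x, ‖D x‖ ≤ C) (hC0 : 0 ≤ C) (T : L2 ν F →L[ℂ] L2 ν F) :
    PointwiseBound (scalarOp F D) T (C * ‖T‖) := by
  refine pointwiseBound_of_ae_bound T hC0 (aestronglyMeasurable_scalarOp hD.1.aemeasurable) ?_
  filter_upwards [hC] with x hx
  exact (norm_scalarOp_le D x).trans hx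

theorem exists_ae_bound_of_memLp_top {D : Pos ν → ℝ} (hD : MemLp D ∞ volume) :
    ∃ C, 0 ≤ C ∧ ∀ᵐ x, ‖D x‖ ≤ C := by
  refine ⟨(eLpNorm D ∞ volume).toReal, ENNReal.toReal_nonneg, ?_⟩
  have h1 := hD.2.ne
  rw [eLpNorm_exponent_top] at h1 ⊢
  filter_upwards [enorm_ae_le_eLpNormEssSup D volume] with x hx
  have := ENNReal.toReal_mono h1 hx
  rwa [toReal_enorm] at this

variable {m c : ℝ} {A : Pos ν → Pos ν} {Z : Pos ν → F →L[ℂ] F} {A₀ : Pos ν → ℝ}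
  {D : Pos ν → ℝ}

/-- Multiplication with the component `A_j`. -/
def componentMul (A : Pos ν → Pos ν) (j : Fin ν) : L2 ν F →L[ℂ] L2 ν F :=
  pmul (scalarOp F fun x => A x j) 1

theorem Admissible.coeFn_componentMul (h : Admissible m A Z A₀) (j : Fin ν) (u : L2 ν F) :
    componentMul A j u =ᵐ[volume] fun x => (A x j : ℂ) • u x := by
  obtain ⟨C, hC⟩ := h.bounded
  exact (h.pointwiseBound_component hC j 1).coeFn_pmul u

theorem Admissible.isSelfAdjoint_componentMul (h : Admissible m A Z A₀) (j : Fin ν) :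
    IsSelfAdjoint (componentMul A j : L2 ν F →L[ℂ] L2 ν F) := by
  obtain ⟨C, hC⟩ := h.bounded
  exact isSelfAdjoint_pmul_one (h.pointwiseBound_component hC j 1)
    (Eventually.of_forall (isSelfAdjoint_scalarOp _))

/-- The real inner product space underlying a complex one. -/
local instance realInnerProductSpace : InnerProductSpace ℝ F := InnerProductSpace.complexToReal

theorem inner_scalar_smul_add (a : ℝ) (d η : F) :
    inner ℂ d ((a : ℂ) • η) + inner ℂ η ((a : ℂ) • d) =
      ((a * (inner ℝ η d + inner ℝ d η) : ℝ) : ℂ) := by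
  have h1 : inner ℂ d η + inner ℂ η d = ((inner ℝ η d + inner ℝ d η : ℝ) : ℂ) := by
    have h2 := congrArg Complex.im (inner_conj_symm (𝕜 := ℂ) d η)
    have h3 : inner ℝ η d = (inner ℂ η d).re := rfl
    have h4 : inner ℝ d η = (inner ℂ d η).re := rfl
    rw [Complex.conj_im] at h2
    rw [h3, h4]
    refine Complex.ext ?_ ?_
    · rw [Complex.add_re, Complex.ofReal_re, add_comm]
    · rw [Complex.add_im, Complex.ofReal_im, ← h2, neg_add_cancel]
  rw [inner_smul_right, inner_smul_right, ← mul_add, h1, Complex.ofReal_mul]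

/-- The equation `div A = D` is tested against the real Schwartz function `|η|²`, whose derivative
is `2 re ⟪η, ∂_j η⟫`. -/
theorem Admissible.divergence_toLp (h : Admissible m A Z A₀) (hD : MemLp D ∞ volume)
    (hdiv : IsDiv A D) (η : 𝓢(Pos ν, F)) :
    ∑ j, (inner ℂ ((∂_{EuclideanSpace.single j (1 : ℝ)} η : 𝓢(Pos ν, F)).toLp 2 volume)
          (componentMul A j (η.toLp 2 volume)) +
        inner ℂ (η.toLp 2 volume)
          (componentMul A j ((∂_{EuclideanSpace.single j (1 : ℝ)} η : 𝓢(Pos ν, F)).toLp 2 volume))) +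
      inner ℂ (η.toLp 2 volume) (pmul (scalarOp F D) 1 (η.toLp 2 volume)) = 0 := by
  set φ : 𝓢(Pos ν, ℝ) := SchwartzMap.pairing (innerSL ℝ (E := F)) η η
  have hφ : ∀ x, φ x = inner ℝ (η x) (η x) := fun x => rfl
  have hpd : ∀ j x, pd j φ x =
      inner ℝ (η x) ((∂_{EuclideanSpace.single j (1 : ℝ)} η : 𝓢(Pos ν, F)) x) +
        inner ℝ ((∂_{EuclideanSpace.single j (1 : ℝ)} η : 𝓢(Pos ν, F)) x) (η x) := by
    intro j x
    rw [pd, SchwartzMap.lineDerivOp_apply_eq_fderiv, show (φ : Pos ν → ℝ) = fun x =>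
      inner ℝ (η x) (η x) from funext hφ]
    exact fderiv_inner_apply ℝ η.differentiableAt η.differentiableAt _
  have hint : ∀ j, Integrable (fun x => A x j * pd j φ x) volume := by
    intro j
    obtain ⟨C, hC⟩ := h.bounded
    have h1 : Integrable (∂_{EuclideanSpace.single j (1 : ℝ)} φ : 𝓢(Pos ν, ℝ)) volume :=
      SchwartzMap.integrable _
    have h2 : Integrable (pd j φ) volume := h1.congr (Eventually.of_forall fun x => by
      rw [SchwartzMap.lineDerivOp_apply_eq_fderiv]; rfl)
    exact h2.bdd_mul (h.continuous_component j).aestronglyMeasurable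
      (Eventually.of_forall fun x => Admissible.abs_component_le hC j x)
  have h1 : ∀ j, inner ℂ ((∂_{EuclideanSpace.single j (1 : ℝ)} η : 𝓢(Pos ν, F)).toLp 2 volume)
        (componentMul A j (η.toLp 2 volume)) + inner ℂ (η.toLp 2 volume) (componentMul A j
          ((∂_{EuclideanSpace.single j (1 : ℝ)} η : 𝓢(Pos ν, F)).toLp 2 volume)) =
      ((∫ x, A x j * pd j φ x : ℝ) : ℂ) := by
    intro j
    rw [L2_inner_eq, L2_inner_eq, ← integral_add (L2.integrable_inner _ _)
      (L2.integrable_inner _ _), ← integral_complex_ofReal]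
    refine integral_congr_ae ?_
    filter_upwards [h.coeFn_componentMul j (η.toLp 2 volume), h.coeFn_componentMul j
        ((∂_{EuclideanSpace.single j (1 : ℝ)} η : 𝓢(Pos ν, F)).toLp 2 volume),
      η.coeFn_toLp 2 volume,
      (∂_{EuclideanSpace.single j (1 : ℝ)} η : 𝓢(Pos ν, F)).coeFn_toLp 2 volume]
      with x e1 e2 e3 e4
    rw [e1, e2, e3, e4, inner_scalar_smul_add, hpd]
  have h2 : inner ℂ (η.toLp 2 volume) (pmul (scalarOp F D) 1 (η.toLp 2 volume)) =
      ((∫ x, D x * φ x : ℝ) : ℂ) := by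
    obtain ⟨C, hC0, hC⟩ := exists_ae_bound_of_memLp_top hD
    rw [L2_inner_eq, ← integral_complex_ofReal]
    refine integral_congr_ae ?_
    filter_upwards [(pointwiseBound_of_memLp_top (F := F) hD hC hC0 1).coeFn_pmul
      (η.toLp 2 volume), η.coeFn_toLp 2 volume] with x e1 e3
    rw [e1, show (1 : L2 ν F →L[ℂ] L2 ν F) (η.toLp 2 volume) = η.toLp 2 volume from rfl, e3,
      scalarOp_apply, inner_smul_right, hφ, inner_self_eq_norm_sq_to_K,
      real_inner_self_eq_norm_sq]
    push_cast
    rfl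
  have h3 := hdiv φ
  rw [integral_finsetSum _ fun j _ => hint j] at h3
  simp only [h1]
  rw [h2, ← h3]
  push_cast
  ring

/-- The operator `p_j (H₀ + c)^{-1/2}`. -/
abbrev momentumFactor (F : Type) [NormedAddCommGroup F] [InnerProductSpace ℂ F] [CompleteSpace F]
    (m c : ℝ) (j : Fin ν) : L2 ν F →L[ℂ] L2 ν F :=
  fmul fun ξ => momentum j ξ * sqrtResolventSymbol m c ξ

/-- This is `∑ p_j A_j = ∑ A_j p_j - i D` in weak form. The diagonal case on Schwartz functions says
that a bounded operator `Y` has vanishing quadratic form; over `ℂ` this forces `Y = 0`, which is the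
identity for all pairs. -/
theorem Admissible.divergence_identity (h : Admissible m A Z A₀) (hc : 0 < c)
    (hD : MemLp D ∞ volume) (hdiv : IsDiv A D) (f g : L2 ν F) :
    ∑ j, inner ℂ (momentumFactor F m c j f)
        (componentMul A j (fmul (sqrtResolventSymbol m c) g)) =
      ∑ j, inner ℂ (fmul (sqrtResolventSymbol m c) f)
        (componentMul A j (momentumFactor F m c j g)) -
      Complex.I * inner ℂ (fmul (sqrtResolventSymbol m c) f)
        (pmul (scalarOp F D) 1 (fmul (sqrtResolventSymbol m c) g)) := by
  have hm := h.pos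
  have hSb := bddSymbol_sqrtResolvent (ν := ν) hm hc
  have hPb := fun j => bddSymbol_momentum_mul_sqrtResolvent (ν := ν) hm hc j
  set S : L2 ν F →L[ℂ] L2 ν F := fmul (sqrtResolventSymbol m c)
  set MD : L2 ν F →L[ℂ] L2 ν F := pmul (scalarOp F D) 1
  have hS : IsSelfAdjoint S := isSelfAdjoint_fmul hSb
  have hP : ∀ j, IsSelfAdjoint (momentumFactor F m c j) := fun j => isSelfAdjoint_fmul (hPb j)
  set Y : L2 ν F →L[ℂ] L2 ν F := ∑ j, ((-Complex.I) • (momentumFactor F m c j ∘L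
    componentMul A j ∘L S) + Complex.I • (S ∘L componentMul A j ∘L momentumFactor F m c j)) +
    S ∘L MD ∘L S
  have hY : ∀ f g : L2 ν F, inner ℂ f (Y g) =
      ∑ j, (-Complex.I * inner ℂ (momentumFactor F m c j f) (componentMul A j (S g)) +
        Complex.I * inner ℂ (S f) (componentMul A j (momentumFactor F m c j g))) +
      inner ℂ (S f) (MD (S g)) := by
    intro f g
    have h1 : Y g = ∑ j, ((-Complex.I) • momentumFactor F m c j (componentMul A j (S g)) +
        Complex.I • S (componentMul A j (momentumFactor F m c j g))) + S (MD (S g)) := by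
      simp [Y]
    rw [h1]
    simp only [inner_add_right, inner_sum, inner_smul_right,
      ← inner_apply_eq_of_isSelfAdjoint hS, ← inner_apply_eq_of_isSelfAdjoint (hP _)]
  have hzero : ∀ f : L2 ν F, inner ℂ f (Y f) = 0 := by
    refine schwartz_induction hm hc (isClosed_eq (by fun_prop) continuous_const) ?_
    intro f η hη
    have hd : ∀ j, momentumFactor F m c j (f.toLp 2 volume) = -Complex.I •
        (∂_{EuclideanSpace.single j (1 : ℝ)} η : 𝓢(Pos ν, F)).toLp 2 volume := by
      intro j
      rw [← partialL2_toLp, ← hη, partialL2_fmul j hSb (hPb j), smul_smul]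
      simp
    rw [hY, show S (f.toLp 2 volume) = η.toLp 2 volume from hη]
    refine Eq.trans ?_ (h.divergence_toLp hD hdiv η)
    congr 1
    refine Finset.sum_congr rfl fun j _ => ?_
    rw [hd, inner_smul_left, map_smul, inner_smul_right, ← mul_assoc, ← mul_assoc]
    simp
  have hY0 : Y = 0 := by
    have h1 : (Y : L2 ν F →ₗ[ℂ] L2 ν F) = 0 := by
      refine (inner_map_self_eq_zero _).1 fun x => ?_
      rw [← inner_conj_symm]
      change (starRingEnd ℂ) (inner ℂ x (Y x)) = 0
      rw [hzero, map_zero]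
    exact ContinuousLinearMap.coe_injective h1
  have h2 := hY f g
  rw [hY0, zero_apply, inner_zero_right, Finset.sum_add_distrib,
    ← Finset.mul_sum, ← Finset.mul_sum] at h2
  linear_combination (-Complex.I) * h2 + (∑ j, inner ℂ (momentumFactor F m c j f)
    (componentMul A j (S g)) - ∑ j, inner ℂ (S f) (componentMul A j (momentumFactor F m c j g))) *
    Complex.I_mul_I

/-! ### The expanded expression as an operator -/

/-- The expanded Hamiltonian after `(H₀ + c)⁻¹`. -/
def expandedOp (m c : ℝ) (A : Pos ν → Pos ν) (D : Pos ν → ℝ) (Z : Pos ν → F →L[ℂ] F)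
    (A₀ : Pos ν → ℝ) : L2 ν F →L[ℂ] L2 ν F :=
  ((1 / (2 * m) : ℝ) : ℂ) •
    (fmul (fun ξ => (2 * Real.pi * ‖ξ‖) ^ 2 * resolventSymbol m c ξ) -
      (2 : ℂ) • ∑ j, componentMul A j ∘L fmul (fun ξ => momentum j ξ * resolventSymbol m c ξ) +
      Complex.I • pmul (scalarOp F D) 1 ∘L fmul (resolventSymbol m c) +
      pmul (scalarOp F fun x => ‖A x‖ ^ 2) 1 ∘L fmul (resolventSymbol m c)) +
  pmul (potentialOp m Z A₀) (fmul (resolventSymbol m c))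

theorem expandedOp_apply (g : L2 ν F) :
    expandedOp m c A D Z A₀ g = ((1 / (2 * m) : ℝ) : ℂ) •
      (fmul (fun ξ => (2 * Real.pi * ‖ξ‖) ^ 2 * resolventSymbol m c ξ) g -
        (2 : ℂ) • ∑ j, componentMul A j (fmul (fun ξ => momentum j ξ * resolventSymbol m c ξ) g) +
        Complex.I • pmul (scalarOp F D) 1 (fmul (resolventSymbol m c) g) +
        pmul (scalarOp F fun x => ‖A x‖ ^ 2) 1 (fmul (resolventSymbol m c) g)) +
    pmul (potentialOp m Z A₀) (fmul (resolventSymbol m c)) g := by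
  simp [expandedOp]

theorem Admissible.pointwiseBound_norm_sq (h : Admissible m A Z A₀) {C : ℝ}
    (hC : ∀ x, ‖A x‖ ≤ C) (T : L2 ν F →L[ℂ] L2 ν F) :
    PointwiseBound (scalarOp F fun x => ‖A x‖ ^ 2) T (C ^ 2 * ‖T‖) := by
  refine pointwiseBound_scalarOp ?_ (fun x => ?_) T
  · have := h.continuous
    exact (show Continuous fun x => ‖A x‖ ^ 2 by fun_prop).measurable.aemeasurable
  · rw [abs_of_nonneg (by positivity)]
    exact pow_le_pow_left₀ (norm_nonneg _) (hC x) 2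

theorem Admissible.pointwiseBound_potentialOp (h : Admissible m A Z A₀)
    {T : L2 ν F →L[ℂ] L2 ν F} {C : ℝ}
    (hL : PointwiseBound (scalarOp F (potentialBound m Z A₀)) T C) :
    PointwiseBound (potentialOp m Z A₀) T C where
  nonneg := hL.nonneg
  aestronglyMeasurable := h.aestronglyMeasurable_potentialOp
  bound f := by
    refine le_trans (eLpNorm_mono fun x => ?_) (hL.bound f)
    rw [scalarOp_apply, norm_smul, Complex.norm_real,
      Real.norm_of_nonneg (potentialBound_nonneg h.pos x)]
    exact (potentialOp m Z A₀ x).le_of_opNorm_le (norm_potentialOp_le h.pos x) _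

theorem Admissible.sum_componentMul_sq (h : Admissible m A Z A₀) (u : L2 ν F) :
    ∑ j, componentMul A j (componentMul A j u) =
      pmul (scalarOp F fun x => ‖A x‖ ^ 2) 1 u := by
  obtain ⟨C, hC⟩ := h.bounded
  refine Lp.ext ?_
  have h1 := ae_all_iff.2 fun j => h.coeFn_componentMul j u
  have h2 := ae_all_iff.2 fun j => h.coeFn_componentMul j (componentMul A j u)
  filter_upwards [Lp.coeFn_finsetSum Finset.univ fun j => componentMul A j (componentMul A j u),
    h1, h2, (h.pointwiseBound_norm_sq hC 1).coeFn_pmul u] with x e1 e2 e3 e4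
  rw [e1, e4, Finset.sum_apply, scalarOp_apply]
  simp only [e3, e2, smul_smul, ← Finset.sum_smul]
  rw [EuclideanSpace.norm_sq_eq]
  congr 1
  push_cast
  refine Finset.sum_congr rfl fun j _ => ?_
  norm_cast
  rw [Real.norm_eq_abs, sq_abs, sq]

/-- Multiplying out `⟪(p - A) S f, (p - A) R g⟫` gives two cross terms. One is already `-A·p`; the
divergence identity turns the other into `-A·p + i div A`. -/
theorem Admissible.sesqForm_resolvent (h : Admissible m A Z A₀) {C : ℝ}
    (hL : LargeShift m Z A₀ c C) (hD : MemLp D ∞ volume) (hdiv : IsDiv A D) (f g : L2 ν F) :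
    sesqForm m A Z A₀ (fmul (sqrtResolventSymbol m c) f) (fmul (resolventSymbol m c) g) =
      inner ℂ (fmul (sqrtResolventSymbol m c) f) (expandedOp m c A D Z A₀ g) := by
  have hm := h.pos
  have hc := hL.1
  obtain ⟨B, hB⟩ := h.bounded
  have hSb := bddSymbol_sqrtResolvent (ν := ν) hm hc
  have hPb := fun j => bddSymbol_momentum_mul_sqrtResolvent (ν := ν) hm hc j
  have hQb := fun j => bddSymbol_momentum_mul_resolvent (ν := ν) hm hc j
  set S : L2 ν F →L[ℂ] L2 ν F := fmul (sqrtResolventSymbol m c)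
  set R : L2 ν F →L[ℂ] L2 ν F := fmul (resolventSymbol m c)
  set P : Fin ν → L2 ν F →L[ℂ] L2 ν F := fun j => momentumFactor F m c j
  set Q : Fin ν → L2 ν F →L[ℂ] L2 ν F := fun j =>
    fmul (fun ξ => momentum j ξ * resolventSymbol m c ξ)
  have hS : IsSelfAdjoint S := isSelfAdjoint_fmul hSb
  have hP : ∀ j, IsSelfAdjoint (P j) := fun j => isSelfAdjoint_fmul (hPb j)
  have hSS : S (S g) = R g := fmul_sqrtResolvent_sqrtResolvent hm hc g
  have hPS : ∀ j, P j (S g) = Q j g := by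
    intro j
    simp only [P, S, Q]
    rw [fmul_fmul (hPb j) hSb]
    simp only [mul_assoc, sqrtResolventSymbol_mul_self hm hc]
  have hT : ∀ j u, kineticFactor m c A j u = P j u - componentMul A j (S u) := by
    intro j u
    change P j u - pmul (scalarOp F fun x => A x j) S u = _
    rw [pmul_apply_eq (h.pointwiseBound_component hB j S) (h.pointwiseBound_component hB j 1)]
    rfl
  have hkin : ∑ j, inner ℂ (P j f) (Q j g) = inner ℂ (S f)
      (fmul (fun ξ => (2 * Real.pi * ‖ξ‖) ^ 2 * resolventSymbol m c ξ) g) := by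
    have hb : ∀ j : Fin ν, BddSymbol fun ξ => momentum j ξ ^ 2 * resolventSymbol m c ξ := by
      intro j
      have := (hPb j).mul (hPb j)
      convert this using 2 with ξ
      rw [← sqrtResolventSymbol_mul_self hm hc]
      ring
    have h1 : ∀ j, inner ℂ (P j f) (Q j g) = inner ℂ (S f)
        (fmul (fun ξ => momentum j ξ ^ 2 * resolventSymbol m c ξ) g) := by
      intro j
      rw [inner_apply_eq_of_isSelfAdjoint (hP j), inner_apply_eq_of_isSelfAdjoint hS]
      congr 1
      simp only [P, Q, S]
      rw [fmul_fmul (hPb j) (hQb j), fmul_fmul hSb (hb j)]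
      congr 2 with ξ
      ring
    simp only [h1]
    rw [← inner_sum, fmul_sum _ hb]
    simp only [← Finset.sum_mul, sum_momentum_sq]
  have hdv := h.divergence_identity hc hD hdiv f (S g)
  change ∑ j, inner ℂ (P j f) (componentMul A j (S (S g))) =
    ∑ j, inner ℂ (S f) (componentMul A j (P j (S g))) -
      Complex.I * inner ℂ (S f) (pmul (scalarOp F D) 1 (S (S g))) at hdv
  simp only [hSS, hPS] at hdv
  have hpot : inner ℂ (potentialFactor m c Z A₀ f)
      (pmul (potentialPhase m Z A₀) 1 (potentialFactor m c Z A₀ (S g))) =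
      inner ℂ (S f) (pmul (potentialOp m Z A₀) R g) := by
    rw [L2_inner_eq, L2_inner_eq]
    refine integral_congr_ae ((h.inner_potential_ae hL f (S g)).trans ?_)
    filter_upwards [(h.pointwiseBound_potentialOp hL.2.2).coeFn_pmul g] with x hx
    rw [hx]
    change inner ℂ (S f x) (potential m Z A₀ x (S (S g) x)) = _
    rw [hSS, potentialOp_apply]
  rw [← hSS, ← h.inner_formOp_eq_sesqForm hL, inner_formOp, hpot, expandedOp_apply]
  simp only [hT, hSS, hPS, inner_sub_left, inner_sub_right,
    inner_apply_eq_of_isSelfAdjoint (h.isSelfAdjoint_componentMul _), Finset.sum_sub_distrib]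
  rw [hkin, hdv]
  simp only [inner_add_right, inner_smul_right, inner_sub_right, inner_sum]
  rw [← h.sum_componentMul_sq, inner_sum]
  ring

theorem Admissible.coeFn_expandedOp (h : Admissible m A Z A₀) (hc : 0 < c) {C : ℝ}
    (hL : PointwiseBound (scalarOp F (potentialBound m Z A₀)) (fmul (resolventSymbol m c)) C)
    (hD : MemLp D ∞ volume) (g : L2 ν F) :
    expandedOp m c A D Z A₀ g =ᵐ[volume]
      expandedHamiltonian m A D Z A₀ (fmul (resolventSymbol m c) g) := by
  have hm := h.pos
  obtain ⟨B, hB⟩ := h.bounded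
  obtain ⟨C', hC0, hC'⟩ := exists_ae_bound_of_memLp_top hD
  have hQb := fun j => bddSymbol_momentum_mul_resolvent (ν := ν) hm hc j
  have hlap := laplacianL2_fmul (bddSymbol_resolvent (ν := ν) hm hc)
    (bddSymbol_laplacian_mul_resolvent hm hc) g
  have hpart := fun j => partialL2_fmul j (bddSymbol_resolvent (ν := ν) hm hc) (hQb j) g
  rw [expandedOp_apply]
  set R : L2 ν F →L[ℂ] L2 ν F := fmul (resolventSymbol m c)
  set l : L2 ν F := fmul (fun ξ => (2 * Real.pi * ‖ξ‖) ^ 2 * resolventSymbol m c ξ) g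
  set q : Fin ν → L2 ν F := fun j => fmul (fun ξ => momentum j ξ * resolventSymbol m c ξ) g
  set s : L2 ν F := ∑ j, componentMul A j (q j)
  set d : L2 ν F := pmul (scalarOp F D) 1 (R g)
  set a : L2 ν F := pmul (scalarOp F fun x => ‖A x‖ ^ 2) 1 (R g)
  set w : L2 ν F := pmul (potentialOp m Z A₀) R g
  filter_upwards [Lp.coeFn_add (((1 / (2 * m) : ℝ) : ℂ) •
      (l - (2 : ℂ) • s + Complex.I • d + a)) w,
    Lp.coeFn_smul ((1 / (2 * m) : ℝ) : ℂ) (l - (2 : ℂ) • s + Complex.I • d + a),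
    Lp.coeFn_add (l - (2 : ℂ) • s + Complex.I • d) a,
    Lp.coeFn_add (l - (2 : ℂ) • s) (Complex.I • d), Lp.coeFn_sub l ((2 : ℂ) • s),
    Lp.coeFn_smul (2 : ℂ) s, Lp.coeFn_smul Complex.I d,
    Lp.coeFn_finsetSum Finset.univ fun j => componentMul A j (q j),
    ae_all_iff.2 fun j => h.coeFn_componentMul j (q j),
    ae_all_iff.2 fun j => Lp.coeFn_smul Complex.I (q j),
    Lp.coeFn_neg l, (pointwiseBound_of_memLp_top (F := F) hD hC' hC0 1).coeFn_pmul (R g),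
    (h.pointwiseBound_norm_sq hB 1).coeFn_pmul (R g),
    (h.pointwiseBound_potentialOp hL).coeFn_pmul g]
    with x e1 e2 e3 e4 e5 e6 e7 e8 e9 e10 e11 e12 e13 e14
  rw [e1, Pi.add_apply, e2, Pi.smul_apply, e3, Pi.add_apply, e4, Pi.add_apply, e5, Pi.sub_apply,
    e6, e7, Pi.smul_apply, Pi.smul_apply, show s x = _ from e8, Finset.sum_apply,
    show d x = _ from e12, show a x = _ from e13, show w x = _ from e14,
    show (1 : L2 ν F →L[ℂ] L2 ν F) (R g) = R g from rfl, potentialOp_apply, potential,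
    expandedHamiltonian, hlap, e11, Pi.neg_apply, neg_neg]
  have hsum : ∑ j, (componentMul A j (q j)) x = ∑ j, (A x j : ℂ) •
      (-Complex.I • partialL2 j (R g) x) := by
    refine Finset.sum_congr rfl fun j _ => ?_
    rw [e9 j, hpart j, e10 j, Pi.smul_apply, smul_smul (-Complex.I) Complex.I, neg_mul,
      Complex.I_mul_I, neg_neg, one_smul]
  rw [hsum, scalarOp_apply, scalarOp_apply]
  module

variable [FiniteDimensional ℂ F]

/-- Thus `H` extends the expanded expression from `W^2`; only the reverse inclusion of domains
remains. -/
theorem Admissible.resolvent_mem_graph (h : Admissible m A Z A₀) {C : ℝ}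
    (hL : LargeShift m Z A₀ c C) (hD : MemLp D ∞ volume) (hdiv : IsDiv A D)
    {H : L2 ν F →ₗ.[ℂ] L2 ν F} (hH : IsHamiltonian m A Z A₀ H) (g : L2 ν F) :
    (fmul (resolventSymbol m c) g, expandedOp m c A D Z A₀ g) ∈ H.graph := by
  refine (h.mem_graph_iff hH).2 ⟨?_, fun φ hφ => ?_⟩
  · exact (mem_sobolev_one_iff h.pos hL.1).2
      ⟨_, fmul_sqrtResolvent_sqrtResolvent h.pos hL.1 g⟩
  · obtain ⟨f, rfl⟩ := (mem_sobolev_one_iff h.pos hL.1).1 hφ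
    exact h.sesqForm_resolvent hL hD hdiv f g

/-- The decay in `c` is what makes the first-order term `A·p` negligible for large shifts. -/
theorem norm_momentum_resolvent_le (hm : 0 < m) (hc : 0 < c) (j : Fin ν) :
    ‖(fmul (fun ξ => momentum j ξ * resolventSymbol m c ξ) : L2 ν F →L[ℂ] L2 ν F)‖ ≤
      √(2 * m * c⁻¹) := by
  refine ContinuousLinearMap.opNorm_le_bound _ (Real.sqrt_nonneg _) fun f =>
    norm_fmul_apply_le' (bddSymbol_momentum_mul_resolvent hm hc j) (fun ξ => ?_) f
  refine Real.abs_le_sqrt ?_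
  have h1 := momentum_sq_le hm j ξ
  have h2 := kinetic_mul_resolventSymbol_le hm hc ξ
  have h3 := resolventSymbol_le hm hc ξ
  have h4 := resolventSymbol_pos hm hc ξ
  calc (momentum j ξ * resolventSymbol m c ξ) ^ 2
      = momentum j ξ ^ 2 * (resolventSymbol m c ξ * resolventSymbol m c ξ) := by ring
    _ ≤ 2 * m * kinetic m ξ * (resolventSymbol m c ξ * resolventSymbol m c ξ) := by gcongr
    _ = 2 * m * ((kinetic m ξ * resolventSymbol m c ξ) * resolventSymbol m c ξ) := by ring
    _ ≤ 2 * m * (1 * c⁻¹) := by gcongr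
    _ = 2 * m * c⁻¹ := by ring

theorem norm_resolvent_le (hm : 0 < m) (hc : 0 < c) :
    ‖(fmul (resolventSymbol m c) : L2 ν F →L[ℂ] L2 ν F)‖ ≤ c⁻¹ := by
  refine ContinuousLinearMap.opNorm_le_bound _ (inv_nonneg.2 hc.le) fun f =>
    norm_fmul_apply_le' (bddSymbol_resolvent hm hc) (fun ξ => ?_) f
  rw [abs_of_pos (resolventSymbol_pos hm hc ξ)]
  exact resolventSymbol_le hm hc ξ

theorem laplacian_resolvent_add (hm : 0 < m) (hc : 0 < c) (f : L2 ν F) :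
    ((1 / (2 * m) : ℝ) : ℂ) •
      fmul (fun ξ => (2 * Real.pi * ‖ξ‖) ^ 2 * resolventSymbol m c ξ) f +
        (c : ℂ) • fmul (resolventSymbol m c) f = f := by
  have hlap := bddSymbol_laplacian_mul_resolvent (ν := ν) hm hc
  have hb := (⟨measurable_const, |1 / (2 * m)|, fun _ => le_rfl⟩ :
    BddSymbol fun _ : Pos ν => 1 / (2 * m)).mul hlap
  have hb' := (⟨measurable_const, |c|, fun _ => le_rfl⟩ :
    BddSymbol fun _ : Pos ν => c).mul (bddSymbol_resolvent hm hc)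
  rw [← fmul_const_mul hlap, ← fmul_const_mul (bddSymbol_resolvent hm hc), fmul_add hb hb']
  conv_rhs => rw [← fmul_one f]
  congr 2 with ξ
  have h2 : (kinetic m ξ + c) * resolventSymbol m c ξ = 1 :=
    mul_inv_cancel₀ (kinetic_add_pos hm hc ξ).ne'
  rw [kinetic] at h2
  linear_combination h2

/-- The Laplacian and the shift together give the identity, so only lower-order terms are left. -/
theorem expandedOp_add_resolvent_sub_one (hm : 0 < m) (hc : 0 < c) :
    expandedOp m c A D Z A₀ + (c : ℂ) • fmul (resolventSymbol m c) - 1 =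
      ((1 / (2 * m) : ℝ) : ℂ) • (-((2 : ℂ) • ∑ j, componentMul A j ∘L
        fmul (fun ξ => momentum j ξ * resolventSymbol m c ξ)) +
      Complex.I • pmul (scalarOp F D) 1 ∘L fmul (resolventSymbol m c) +
      pmul (scalarOp F fun x => ‖A x‖ ^ 2) 1 ∘L fmul (resolventSymbol m c)) +
      pmul (potentialOp m Z A₀) (fmul (resolventSymbol m c)) := by
  set R : L2 ν F →L[ℂ] L2 ν F := fmul (resolventSymbol m c) with hR
  set Λ : L2 ν F →L[ℂ] L2 ν F :=
    fmul (fun ξ => (2 * Real.pi * ‖ξ‖) ^ 2 * resolventSymbol m c ξ) with hΛ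
  have h1 : ((1 / (2 * m) : ℝ) : ℂ) • Λ + (c : ℂ) • R = 1 :=
    ContinuousLinearMap.ext fun f => laplacian_resolvent_add hm hc f
  rw [expandedOp, ← hR, ← hΛ]
  linear_combination (norm := module) h1

theorem Admissible.norm_expandedOp_sub_one_le (h : Admissible m A Z A₀) (hc : 0 < c) {a B C : ℝ}
    (hL : PointwiseBound (scalarOp F (potentialBound m Z A₀)) (fmul (resolventSymbol m c)) a)
    (hB : ∀ x, ‖A x‖ ≤ B) (hD : MemLp D ∞ volume) (hC0 : 0 ≤ C) (hC : ∀ᵐ x, ‖D x‖ ≤ C) :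
    ‖expandedOp m c A D Z A₀ + (c : ℂ) • fmul (resolventSymbol m c) - 1‖ ≤
      1 / (2 * m) * (2 * (ν * (B * √(2 * m * c⁻¹))) + C * c⁻¹ + B ^ 2 * c⁻¹) + a := by
  have hm := h.pos
  have hB0 : 0 ≤ B := (norm_nonneg _).trans (hB 0)
  set R : L2 ν F →L[ℂ] L2 ν F := fmul (resolventSymbol m c)
  have h2 := expandedOp_add_resolvent_sub_one (A := A) (D := D) (Z := Z) (A₀ := A₀) hm hc
  have hone : ‖(1 : L2 ν F →L[ℂ] L2 ν F)‖ ≤ 1 := ContinuousLinearMap.norm_id_le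
  have hR := norm_resolvent_le (F := F) (ν := ν) hm hc
  have hcomp : ∀ (L : L2 ν F →L[ℂ] L2 ν F) (T : L2 ν F →L[ℂ] L2 ν F) {x y : ℝ},
      0 ≤ x → ‖L‖ ≤ x * ‖(1 : L2 ν F →L[ℂ] L2 ν F)‖ → ‖T‖ ≤ y → ‖L ∘L T‖ ≤ x * y := by
    intro L T x y hx hL hT
    refine (ContinuousLinearMap.opNorm_comp_le _ _).trans ?_
    have : ‖L‖ ≤ x := hL.trans (mul_le_of_le_one_right hx hone)
    exact mul_le_mul this hT (norm_nonneg _) hx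
  rw [h2]
  refine (norm_add_le _ _).trans (add_le_add ?_ (h.pointwiseBound_potentialOp hL).norm_pmul_le)
  rw [norm_smul, Complex.norm_real, Real.norm_of_nonneg (by positivity)]
  refine mul_le_mul_of_nonneg_left ?_ (by positivity)
  refine (norm_add_le _ _).trans (add_le_add ((norm_add_le _ _).trans (add_le_add ?_ ?_)) ?_)
  · rw [norm_neg, norm_smul, Complex.norm_ofNat]
    refine mul_le_mul_of_nonneg_left ?_ zero_le_two
    refine (norm_sum_le _ _).trans ?_
    have := Finset.sum_le_sum fun (j : Fin ν) (_ : j ∈ Finset.univ) =>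
      hcomp (componentMul A j) _ hB0 (h.pointwiseBound_component hB j 1).norm_pmul_le
        (norm_momentum_resolvent_le (F := F) hm hc j)
    refine this.trans ?_
    rw [Finset.sum_const, Finset.card_univ, Fintype.card_fin, nsmul_eq_mul]
  · rw [norm_smul, Complex.norm_I, one_mul]
    exact hcomp _ _ hC0 (pointwiseBound_of_memLp_top (F := F) hD hC hC0 1).norm_pmul_le hR
  · exact hcomp _ _ (sq_nonneg B) (h.pointwiseBound_norm_sq hB 1).norm_pmul_le hR

/-- As `c → ∞`, all terms from `A` and `D` tend to `0` and the potential contributes `a + b / c → a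
< 1`. A large `c` also exceeds the lower bound `c'`. -/
theorem Admissible.exists_shift (h : Admissible m A Z A₀) (hD : MemLp D ∞ volume) (c' : ℝ) :
    ∃ c C, c' < c ∧ LargeShift m Z A₀ c C ∧
      ‖expandedOp m c A D Z A₀ + (c : ℂ) • fmul (resolventSymbol m c) - 1‖ < 1 := by
  obtain ⟨a, b, ha, hab⟩ := h.relBounded
  obtain ⟨B, hB⟩ := h.bounded
  obtain ⟨C, hC0, hC⟩ := exists_ae_bound_of_memLp_top hD
  have hinv : Tendsto (fun c : ℝ => c⁻¹) atTop (𝓝 0) := tendsto_inv_atTop_zero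
  have h1 : Tendsto (fun c : ℝ => a + b * c⁻¹) atTop (𝓝 a) := by
    simpa using (hinv.const_mul b).const_add a
  have h2 : Tendsto (fun c : ℝ => 1 / (2 * m) * (2 * (ν * (B * √(2 * m * c⁻¹))) + C * c⁻¹ +
      B ^ 2 * c⁻¹) + (a + b * c⁻¹)) atTop (𝓝 a) := by
    have h3 : Tendsto (fun c : ℝ => √(2 * m * c⁻¹)) atTop (𝓝 0) := by
      simpa using (hinv.const_mul (2 * m)).sqrt
    have h4 := ((((((h3.const_mul B).const_mul (ν : ℝ)).const_mul 2).add
      (hinv.const_mul C)).add (hinv.const_mul (B ^ 2))).const_mul (1 / (2 * m))).add h1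
    simpa using h4
  obtain ⟨c, hc1, hc2, hc3, hc4⟩ := ((h1.eventually_lt_const ha).and
    ((h2.eventually_lt_const ha).and ((eventually_gt_atTop c').and
      (eventually_gt_atTop 0)))).exists
  have hL := hab.pointwiseBound_resolvent (F := F) h.pos hc4
  exact ⟨c, _, hc3, ⟨hc4, hc1, hL⟩,
    (h.norm_expandedOp_sub_one_le hc4 hL hB hD hC0 hC).trans_lt hc2⟩

theorem Admissible.expanded (h : Admissible m A Z A₀) (hD : MemLp D ∞ volume) (hdiv : IsDiv A D)
    {H : L2 ν F →ₗ.[ℂ] L2 ν F} (hH : IsHamiltonian m A Z A₀ H) :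
    (H.domain : Set (L2 ν F)) = sobolev ν F 2 ∧
      ∀ ψ : H.domain, (H ψ : L2 ν F) =ᵐ[volume] expandedHamiltonian m A D Z A₀ (ψ : L2 ν F) := by
  obtain ⟨c', hc'⟩ := h.exists_lower_bound
  obtain ⟨c, C, hcc, hL, hnorm⟩ := h.exists_shift hD c'
  set R : L2 ν F →L[ℂ] L2 ν F := fmul (resolventSymbol m c)
  set E : L2 ν F →L[ℂ] L2 ν F := expandedOp m c A D Z A₀
  -- Neumann series around the identity.
  have hunit : IsUnit (E + (c : ℂ) • R) := by
    have := (Units.oneSub (-(E + (c : ℂ) • R - 1)) (by rwa [norm_neg])).isUnit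
    rw [Units.val_oneSub] at this
    convert this using 1
    abel
  obtain ⟨X, hX⟩ := hunit
  have hdom : ∀ ψ : H.domain, ∃ g, R g = ψ := by
    intro ψ
    -- Solving `(H + c) R g = (H + c) ψ` leaves `R g - ψ` in the kernel of `H + c`, which is trivial
    -- since `H ≥ -c' > -c`.
    set g : L2 ν F := (↑X⁻¹ : L2 ν F →L[ℂ] L2 ν F) (H ψ + (c : ℂ) • (ψ : L2 ν F))
    have hg : E g + (c : ℂ) • R g = H ψ + (c : ℂ) • (ψ : L2 ν F) := by
      have h1 : (X : L2 ν F →L[ℂ] L2 ν F) g = H ψ + (c : ℂ) • (ψ : L2 ν F) :=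
        congrArg (fun T : L2 ν F →L[ℂ] L2 ν F => T (H ψ + (c : ℂ) • (ψ : L2 ν F)))
          (Units.mul_inv X)
      rw [hX] at h1
      exact h1
    refine ⟨g, ?_⟩
    have h1 := H.graph.sub_mem (h.resolvent_mem_graph hL hD hdiv hH g) (H.mem_graph ψ)
    have h2 := hc' H hH _ _ h1
    have h3 : E g - H ψ = -(c : ℂ) • (R g - ψ) := by
      rw [neg_smul, smul_sub, neg_sub, sub_eq_sub_iff_add_eq_add, hg]
      abel
    change 0 ≤ (inner ℂ (R g - ψ) (E g - H ψ)).re + c' * ‖R g - ψ‖ ^ 2 at h2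
    rw [h3, inner_smul_right, inner_self_eq_norm_sq_to_K] at h2
    have h4 : (-(c : ℂ) * ((‖R g - ψ‖ : ℂ)) ^ 2).re = -c * ‖R g - ψ‖ ^ 2 := by
      norm_cast
    simp only [RCLike.ofReal_eq_complex_ofReal] at h2
    rw [h4] at h2
    have h5 : ‖R g - ψ‖ ^ 2 = 0 := by
      have := sq_nonneg ‖R g - ψ‖
      nlinarith
    exact sub_eq_zero.1 (norm_eq_zero.1 (pow_eq_zero_iff two_ne_zero |>.1 h5))
  refine ⟨?_, fun ψ => ?_⟩
  · ext ψ
    rw [mem_sobolev_two_iff h.pos hL.1]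
    constructor
    · exact fun hψ => hdom ⟨ψ, hψ⟩
    · rintro ⟨g, rfl⟩
      exact LinearPMap.mem_domain_of_mem_graph (h.resolvent_mem_graph hL hD hdiv hH g)
  · obtain ⟨g, hg⟩ := hdom ψ
    have h1 := H.mem_graph_snd_inj (H.mem_graph ψ) (h.resolvent_mem_graph hL hD hdiv hH g) hg.symm
    rw [h1, ← hg]
    exact h.coeFn_expandedOp hL.1 hL.2.2 hD g

end

noncomputable section

variable {ν : ℕ} {F : Type} [NormedAddCommGroup F] [InnerProductSpace ℂ F] [CompleteSpace F]

open FourierTransform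

/-! ### The Sobolev embedding of `W^2` into `L^∞` -/

section Embedding

variable {m c : ℝ}

/-- The square decays like `‖ξ‖⁻⁴`, which is integrable at infinity exactly for `ν < 4`. -/
theorem memLp_resolventSymbol (hν : ν < 4) (hm : 0 < m) (hc : 0 < c) :
    MemLp (resolventSymbol m c : Pos ν → ℝ) 2 volume := by
  have hmeas := (bddSymbol_resolvent (ν := ν) hm hc).measurable
  rw [memLp_two_iff_integrable_sq hmeas.aestronglyMeasurable]
  set K : ℝ := c⁻¹ + 2 * m / (2 * Real.pi) ^ 2
  have h1 : Integrable (fun ξ : Pos ν => (1 + ‖ξ‖ ^ 2) ^ (-(4 : ℝ) / 2)) volume :=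
    integrable_rpow_neg_one_add_norm_sq (by simpa using hν)
  refine (h1.const_mul (K ^ 2)).mono' (hmeas.pow_const 2).aestronglyMeasurable
    (Eventually.of_forall fun ξ => ?_)
  have hpos : (0 : ℝ) < 1 + ‖ξ‖ ^ 2 := by positivity
  have h2 : resolventSymbol m c ξ ≤ K * (1 + ‖ξ‖ ^ 2)⁻¹ := by
    rw [resolventSymbol, ← div_eq_mul_inv, le_div_iff₀ hpos, inv_mul_le_iff₀
      (kinetic_add_pos hm hc ξ), mul_comm]
    exact one_add_norm_sq_le hm hc ξ
  have h3 : (1 + ‖ξ‖ ^ 2) ^ (-(4 : ℝ) / 2) = ((1 + ‖ξ‖ ^ 2)⁻¹) ^ 2 := by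
    rw [show -(4 : ℝ) / 2 = -((2 : ℕ) : ℝ) by norm_num, Real.rpow_neg hpos.le, Real.rpow_natCast,
      inv_pow]
  rw [h3, ← mul_pow, Real.norm_of_nonneg (sq_nonneg _)]
  exact pow_le_pow_left₀ (resolventSymbol_pos hm hc ξ).le h2 2

theorem hasTemperateGrowth_resolvent (hm : 0 < m) (hc : 0 < c) :
    (resolventSymbol m c : Pos ν → ℝ).HasTemperateGrowth := by
  have h1 := (hasTemperateGrowth_sqrtResolvent (ν := ν) hm hc).mul
    (hasTemperateGrowth_sqrtResolvent hm hc)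
  rwa [show (resolventSymbol m c : Pos ν → ℝ) = sqrtResolventSymbol m c * sqrtResolventSymbol m c
    from funext fun ξ => (sqrtResolventSymbol_mul_self hm hc ξ).symm]

theorem norm_schwartz_le_integral_fourier (η : 𝓢(Pos ν, F)) (x : Pos ν) :
    ‖η x‖ₑ ≤ eLpNorm (𝓕 η : 𝓢(Pos ν, F)) 1 volume := by
  have h1 : η x = ∫ ξ, Real.fourierChar (inner ℝ ξ x) • (𝓕 η : 𝓢(Pos ν, F)) ξ := by
    rw [← Real.fourierInv_eq, ← SchwartzMap.fourierInv_coe, FourierTransform.fourierInv_fourier_eq]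
  rw [h1, eLpNorm_one_eq_lintegral_enorm]
  refine (enorm_integral_le_lintegral_enorm _).trans (le_of_eq ?_)
  refine lintegral_congr fun ξ => ?_
  rw [← ofReal_norm, Circle.norm_smul, ofReal_norm]

/-- On Schwartz functions this is Fourier inversion and Cauchy–Schwarz. In general, an
`L²`-convergent sequence has an almost everywhere convergent subsequence, which preserves the bound.
-/
theorem ae_norm_fmul_resolvent_le (hν : ν < 4) (hm : 0 < m) (hc : 0 < c) (f : L2 ν F) :
    ∀ᵐ x, ‖fmul (resolventSymbol m c) f x‖ₑ ≤
      eLpNorm (resolventSymbol m c : Pos ν → ℝ) 2 volume * ENNReal.ofReal ‖f‖ := by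
  have hb := bddSymbol_resolvent (ν := ν) hm hc
  have hr := memLp_resolventSymbol (ν := ν) hν hm hc
  refine DenseRange.induction_on (p := fun f : L2 ν F =>
    ∀ᵐ x, ‖fmul (resolventSymbol m c) f x‖ₑ ≤
      eLpNorm (resolventSymbol m c : Pos ν → ℝ) 2 volume * ENNReal.ofReal ‖f‖)
    (SchwartzMap.denseRange_toLpCLM (F := F)
    (μ := (volume : Measure (Pos ν))) (p := 2) ENNReal.ofNat_ne_top) f ?_ fun φ => ?_
  · refine IsSeqClosed.isClosed fun u f hu huf => ?_
    have h1 : Tendsto (fun n => fmul (resolventSymbol m c) (u n)) atTop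
        (𝓝 (fmul (resolventSymbol m c) f)) :=
      ((fmul (resolventSymbol m c)).continuous.tendsto f).comp huf
    obtain ⟨k, hk, hlim⟩ := (tendstoInMeasure_of_tendsto_Lp h1).exists_seq_tendsto_ae
    filter_upwards [hlim, ae_all_iff.2 hu] with x hx hbound
    refine le_of_tendsto_of_tendsto hx.enorm ?_ (Eventually.of_forall fun n => hbound (k n))
    exact ENNReal.Tendsto.const_mul (ENNReal.tendsto_ofReal
      ((continuous_norm.tendsto f).comp (huf.comp hk.tendsto_atTop))) (Or.inr hr.2.ne)
  · change ∀ᵐ x, ‖fmul (resolventSymbol m c) (φ.toLp 2 volume) x‖ₑ ≤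
      eLpNorm (resolventSymbol m c : Pos ν → ℝ) 2 volume * ENNReal.ofReal ‖φ.toLp 2 volume‖
    obtain ⟨η, hη⟩ := fmul_toLp hb (hasTemperateGrowth_resolvent hm hc) φ
    have h1 := hb.coeFn_fourier_fmul (φ.toLp 2 volume)
    rw [hη, SchwartzMap.toLp_fourier_eq] at h1
    have h2 : eLpNorm (𝓕 η : 𝓢(Pos ν, F)) 1 volume ≤
        eLpNorm (resolventSymbol m c : Pos ν → ℝ) 2 volume *
          ENNReal.ofReal ‖φ.toLp 2 volume‖ := by
      rw [← Lp.norm_fourier_eq, ofReal_norm_L2]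
      have h3 : (𝓕 η : 𝓢(Pos ν, F)) =ᵐ[volume]
          (resolventSymbol m c : Pos ν → ℝ) • (𝓕 (φ.toLp 2 volume) : L2 ν F) := by
        filter_upwards [(𝓕 η : 𝓢(Pos ν, F)).coeFn_toLp 2 volume, h1] with ξ e1 e2
        rw [← e1, e2, Pi.smul_apply', Complex.coe_smul]
      rw [eLpNorm_congr_ae h3]
      exact eLpNorm_smul_le_mul_eLpNorm (Lp.aestronglyMeasurable _) hr.1
    rw [hη]
    filter_upwards [η.coeFn_toLp 2 volume] with x hx
    rw [hx]
    exact (norm_schwartz_le_integral_fourier η x).trans h2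

theorem exists_eLpNorm_top_le (hν : ν < 4) (hm : 0 < m) : ∃ K : ℝ, 0 ≤ K ∧
    ∀ ψ ∈ sobolev ν F 2, eLpNorm ψ ∞ volume ≤
      ENNReal.ofReal (K * (‖freeHamiltonian m ψ‖ + ‖ψ‖)) := by
  have hr := memLp_resolventSymbol (ν := ν) hν hm one_pos
  refine ⟨(eLpNorm (resolventSymbol m 1 : Pos ν → ℝ) 2 volume).toReal, ENNReal.toReal_nonneg,
    fun ψ hψ => ?_⟩
  obtain ⟨f, rfl⟩ := (mem_sobolev_two_iff hm one_pos).1 hψ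
  have h1 : freeHamiltonian m (fmul (resolventSymbol m 1) f) + fmul (resolventSymbol m 1) f = f := by
    have hb := bddSymbol_resolvent (ν := ν) hm one_pos
    rw [freeHamiltonian_fmul_resolvent hm one_pos,
      fmul_add (bddSymbol_kinetic_mul_resolvent hm one_pos) hb]
    conv_rhs => rw [← fmul_one f]
    congr 2 with ξ
    have h2 : (kinetic m ξ + 1) * resolventSymbol m 1 ξ = 1 :=
      mul_inv_cancel₀ (kinetic_add_pos hm one_pos ξ).ne'
    linear_combination h2
  have h2 : ‖f‖ ≤ ‖freeHamiltonian m (fmul (resolventSymbol m 1) f)‖ +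
      ‖fmul (resolventSymbol m 1) f‖ := by
    conv_lhs => rw [← h1]
    exact norm_add_le _ _
  rw [eLpNorm_exponent_top, ENNReal.ofReal_mul ENNReal.toReal_nonneg, ENNReal.ofReal_toReal hr.2.ne]
  refine essSup_le_of_ae_le _ ?_
  filter_upwards [ae_norm_fmul_resolvent_le hν hm one_pos f] with x hx
  refine hx.trans ?_
  gcongr

end Embedding

/-! ### Relative bounds -/

section RelativeBound

variable {m : ℝ}

/-- For `p = ∞` the set is eventually null. Otherwise `{1 ≤ ‖g‖}` has finite measure, so `g` is in
`L²` on it, and uniform integrability of a single `L²` function applies. -/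
theorem exists_large_part_le {g : Pos ν → ℝ} {p : ℝ≥0∞} (hp : 2 ≤ p) (hg : MemLp g p volume)
    (hmeas : StronglyMeasurable g) {ε : ℝ} (hε : 0 < ε) :
    ∃ M : ℝ, 0 ≤ M ∧ eLpNorm ({x | M ≤ ‖g x‖}.indicator g) 2 volume ≤ ENNReal.ofReal ε := by
  rcases eq_or_ne p ∞ with rfl | hpt
  · obtain ⟨M, hM0, hM⟩ := exists_ae_bound_of_memLp_top hg
    refine ⟨M + 1, by positivity, ?_⟩
    have h1 : {x | M + 1 ≤ ‖g x‖}.indicator g =ᵐ[volume] 0 := by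
      filter_upwards [hM] with x hx
      refine Set.indicator_of_notMem (fun h => ?_) g
      have : M + 1 ≤ ‖g x‖ := h
      linarith
    rw [eLpNorm_congr_ae h1, eLpNorm_zero]
    exact zero_le
  · set S : Set (Pos ν) := {x | 1 ≤ ‖g x‖}
    have hS : MeasurableSet S := measurableSet_le measurable_const hmeas.norm.measurable
    have hSfin : volume S < ∞ := by
      have h1 := hg.meas_ge_lt_top (ε := 1) (two_pos.trans_le hp).ne' hpt one_ne_zero
      exact h1
    have : IsFiniteMeasure (volume.restrict S) := ⟨by simpa using hSfin⟩
    have h2 : MemLp (S.indicator g) 2 volume :=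
      (memLp_indicator_iff_restrict hS).2 ((hg.mono_measure Measure.restrict_le_self).mono_exponent
        hp)
    obtain ⟨M, hM0, hM⟩ := h2.eLpNorm_indicator_norm_ge_pos_le (hmeas.indicator hS) hε
    refine ⟨max M 1, by positivity, le_trans (eLpNorm_mono fun x => ?_) hM⟩
    by_cases hx : max M 1 ≤ ‖g x‖
    · have h3 : x ∈ S := (le_max_right _ _).trans hx
      have h4 : S.indicator g x = g x := Set.indicator_of_mem h3 g
      have h5 : x ∈ {x | M ≤ ‖S.indicator g x‖₊} := by
        change M ≤ ‖S.indicator g x‖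
        rw [h4]
        exact (le_max_left _ _).trans hx
      rw [Set.indicator_of_mem (show x ∈ {x | max M 1 ≤ ‖g x‖} from hx), Set.indicator_of_mem h5,
        h4]
    · rw [Set.indicator_of_notMem (show x ∉ {x | max M 1 ≤ ‖g x‖} from hx), norm_zero]
      exact norm_nonneg _

/-- The large part of `g` has small `L²` norm and multiplies `ψ ∈ L^∞`; the rest is bounded by `M`
and only enters `b`. Hence the relative bound can be made arbitrarily small. -/
theorem relBounded_of_memLp (hν : ν < 4) (hm : 0 < m) {g : Pos ν → ℝ} {p : ℝ≥0∞} (hp : 2 ≤ p)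
    (hg : MemLp g p volume) {a : ℝ} (ha : 0 < a) : ∃ b, RelBounded m g a b := by
  obtain ⟨K, hK0, hK⟩ := exists_eLpNorm_top_le (F := ℂ) hν hm
  obtain ⟨g', hg'm, hgg'⟩ := hg.1
  -- Here `K` is the embedding constant, and `K a / (K + 1) ≤ a`.
  obtain ⟨M, hM0, hM⟩ := exists_large_part_le hp ((memLp_congr_ae hgg').1 hg) hg'm
    (ε := a / (K + 1)) (by positivity)
  refine ⟨a + M, ha.le, by positivity, hg.1.aemeasurable, fun ψ hψ => ?_⟩
  set S : Set (Pos ν) := {x | M ≤ ‖g' x‖}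
  have hS : MeasurableSet S := measurableSet_le measurable_const hg'm.norm.measurable
  have hψm := Lp.aestronglyMeasurable ψ
  have h1 : (fun x => g x • ψ x) =ᵐ[volume] S.indicator g' • (ψ : Pos ν → ℂ) +
      Sᶜ.indicator g' • (ψ : Pos ν → ℂ) := by
    filter_upwards [hgg'] with x hx
    rw [hx, Pi.add_apply, Pi.smul_apply', Pi.smul_apply', ← add_smul]
    congr 1
    exact (congrFun (Set.indicator_self_add_compl S g') x).symm
  have h2 : eLpNorm (S.indicator g' • (ψ : Pos ν → ℂ)) 2 volume ≤
      ENNReal.ofReal (a * (‖freeHamiltonian m ψ‖ + ‖ψ‖)) := by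
    refine (eLpNorm_smul_le_eLpNorm_mul_eLpNorm_top 2 _
      (hg'm.indicator hS).aestronglyMeasurable).trans ?_
    refine (mul_le_mul' hM (hK ψ hψ)).trans ?_
    rw [← ENNReal.ofReal_mul (by positivity)]
    refine ENNReal.ofReal_le_ofReal ?_
    rw [← mul_assoc]
    refine mul_le_mul_of_nonneg_right ?_ (by positivity)
    rw [div_mul_eq_mul_div, div_le_iff₀ (by positivity)]
    nlinarith
  have h3 : eLpNorm (Sᶜ.indicator g' • (ψ : Pos ν → ℂ)) 2 volume ≤ ENNReal.ofReal (M * ‖ψ‖) := by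
    rw [ENNReal.ofReal_mul hM0, ofReal_norm_L2]
    refine eLpNorm_le_mul_eLpNorm_of_ae_le_mul (Eventually.of_forall fun x => ?_) 2
    rw [Pi.smul_apply', norm_smul]
    refine mul_le_mul_of_nonneg_right ?_ (norm_nonneg _)
    by_cases hx : x ∈ S
    · rw [Set.indicator_of_notMem (Set.notMem_compl_iff.2 hx), norm_zero]
      exact hM0
    · rw [Set.indicator_of_mem (show x ∈ Sᶜ from hx)]
      exact (not_le.1 hx).le
  rw [eLpNorm_congr_ae h1]
  refine (eLpNorm_add_le ((hg'm.indicator hS).aestronglyMeasurable.smul hψm)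
    ((hg'm.indicator hS.compl).aestronglyMeasurable.smul hψm) one_le_two).trans ?_
  refine (add_le_add h2 h3).trans (le_of_eq ?_)
  rw [← ENNReal.ofReal_add (by positivity) (by positivity)]
  congr 1
  ring

theorem RelBounded.add {v w : Pos ν → ℝ} {a b a' b' : ℝ} (hv : RelBounded m v a b)
    (hw : RelBounded m w a' b') : RelBounded m (fun x => v x + w x) (a + a') (b + b') where
  nonneg_left := add_nonneg hv.nonneg_left hw.nonneg_left
  nonneg_right := add_nonneg hv.nonneg_right hw.nonneg_right
  aemeasurable := hv.aemeasurable.add hw.aemeasurable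
  bound ψ hψ := by
    have ha := hv.nonneg_left
    have hb := hv.nonneg_right
    have ha' := hw.nonneg_left
    have hb' := hw.nonneg_right
    have hψm := Lp.aestronglyMeasurable ψ
    have h1 : (fun x => (v x + w x) • ψ x) = (fun x => v x • ψ x) + fun x => w x • ψ x := by
      ext1 x
      exact add_smul _ _ _
    rw [h1]
    refine (eLpNorm_add_le (hv.aemeasurable.aestronglyMeasurable.smul hψm)
      (hw.aemeasurable.aestronglyMeasurable.smul hψm) one_le_two).trans ?_
    refine (add_le_add (hv.bound ψ hψ) (hw.bound ψ hψ)).trans (le_of_eq ?_)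
    rw [← ENNReal.ofReal_add (by positivity) (by positivity)]
    congr 1
    ring

theorem ShortRange.exists_relBounded {A₀ : Pos ν → ℝ} (h : ShortRange m A₀) :
    ∃ a b, a < 1 ∧ RelBounded m (fun x => |A₀ x|) a b := by
  obtain ⟨a, b, ha0, ha, hb0, hab⟩ := h.kato
  refine ⟨a, b, ha, ha0, hb0, measurable_norm.comp_aemeasurable h.measurable, fun ψ hψ => ?_⟩
  refine le_trans (eLpNorm_mono fun x => ?_) (hab ψ hψ)
  rw [norm_smul, norm_smul, Real.norm_eq_abs, Real.norm_eq_abs, abs_abs]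

end RelativeBound

/-! ### Potentials of medium and short range -/

/-- Continuity controls the unit ball, where the decay bound may blow up, and decay controls the
outside. -/
theorem MediumRange.bounded {A : Pos ν → Pos ν} (h : MediumRange A) : ∃ C, ∀ x, ‖A x‖ ≤ C := by
  obtain ⟨C, μ, hμ, hC⟩ := h.decay
  obtain ⟨K, hK⟩ := (isCompact_closedBall (0 : Pos ν) 1).exists_bound_of_continuousOn
    h.continuous.continuousOn
  refine ⟨max K |C|, fun x => ?_⟩
  rcases le_or_gt ‖x‖ 1 with hx | hx
  · exact (hK x (by simpa using hx)).trans (le_max_left _ _)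
  · refine le_trans ?_ (le_max_right _ _)
    have hx0 : x ≠ 0 := norm_pos_iff.1 (one_pos.trans hx)
    have h1 : ‖x‖ ^ (-μ) ≤ 1 := Real.rpow_le_one_of_one_le_of_nonpos hx.le (by linarith)
    have h2 : 0 ≤ ‖x‖ ^ (-μ) := Real.rpow_nonneg (norm_nonneg x) _
    calc ‖A x‖ ≤ C * ‖x‖ ^ (-μ) := hC x hx0
      _ ≤ |C| * ‖x‖ ^ (-μ) := mul_le_mul_of_nonneg_right (le_abs_self C) h2
      _ ≤ |C| * 1 := mul_le_mul_of_nonneg_left h1 (abs_nonneg C)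
      _ = |C| := mul_one _

variable {m : ℝ} {A : Pos ν → Pos ν} {Z : Pos ν → F →L[ℂ] F} {A₀ : Pos ν → ℝ}

theorem Admissible.of_memLp (hν : ν < 4) (hm : 0 < m) {p : ℝ≥0∞} (hp : 2 ≤ p)
    (hZ : MemLp Z p volume) (hZs : ∀ x, IsSelfAdjoint (Z x)) (hA : MediumRange A)
    (hA₀ : ShortRange m A₀) : Admissible m A Z A₀ where
  pos := hm
  continuous := hA.continuous
  bounded := hA.bounded
  measurable_spin := hZ.1
  selfAdjoint_spin := hZs
  measurable_scalar := hA₀.measurable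
  relBounded := by
    obtain ⟨a, b, ha, hab⟩ := hA₀.exists_relBounded
    -- The spin term takes half of the gap `1 - a`, so the total relative bound is `(1 + a) / 2 <
    -- 1`.
    obtain ⟨b', hb'⟩ := relBounded_of_memLp hν hm hp (hZ.norm.const_mul (1 / (2 * m)))
      (a := (1 - a) / 2) (by linarith)
    exact ⟨_, _, by linarith, hb'.add hab⟩

theorem hamiltonianAssertions_of_memLp [FiniteDimensional ℂ F] (hν : ν < 4) (hm : 0 < m)
    {p : ℝ≥0∞} (hp : 2 ≤ p) (hZ : MemLp Z p volume) (hZs : ∀ x, IsSelfAdjoint (Z x))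
    (hA : MediumRange A) (hA₀ : ShortRange m A₀) : HamiltonianAssertions m A Z A₀ := by
  have h := Admissible.of_memLp hν hm hp hZ hZs hA hA₀
  exact ⟨fun _ hψ => h.form_wellDefined hψ, h.existsUnique,
    fun lam A' hG hA' H H' hH hH' =>
      h.gauge (Admissible.of_memLp hν hm hp hZ hZs hA' hA₀) hG hH hH',
    fun D hD hdiv H hH => h.expanded hD hdiv hH⟩

/-! ### Pauli matrices -/

theorem isSelfAdjoint_pauli (i : Fin 3) :
    IsSelfAdjoint (Matrix.toEuclideanCLM (n := Fin 2) (𝕜 := ℂ) (pauli i)) := by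
  refine IsSelfAdjoint.map (Matrix.ext fun j k => ?_) _
  fin_cases i <;> fin_cases j <;> fin_cases k <;> simp [pauli, Matrix.star_apply]

theorem memLp_pauli {b : Pos ν → ℝ} {p : ℝ≥0∞} (hb : MemLp b p volume) (i : Fin 3) :
    MemLp (fun x => (b x : ℂ) • Matrix.toEuclideanCLM (n := Fin 2) (𝕜 := ℂ) (pauli i)) p
      volume := by
  refine hb.of_le_mul (c := ‖Matrix.toEuclideanCLM (n := Fin 2) (𝕜 := ℂ) (pauli i)‖)
    ((Complex.continuous_ofReal.comp_aestronglyMeasurable hb.1).smul_const _)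
    (Eventually.of_forall fun x => ?_)
  rw [norm_smul, Complex.norm_real, mul_comm]

theorem isSelfAdjoint_real_smul_pauli (a : ℝ) (i : Fin 3) :
    IsSelfAdjoint ((a : ℂ) • Matrix.toEuclideanCLM (n := Fin 2) (𝕜 := ℂ) (pauli i)) := by
  rw [isSelfAdjoint_iff, star_smul, (isSelfAdjoint_pauli i).star_eq]
  simp

theorem spin2_eq (B : Pos 2 → ℝ) : spin2 B = fun x =>
    (B x : ℂ) • Matrix.toEuclideanCLM (n := Fin 2) (𝕜 := ℂ) (pauli 2) :=
  funext fun _ => map_smul _ _ _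

theorem spin3_eq (B : Pos 3 → Pos 3) : spin3 B = fun x =>
    ∑ i, (B x i : ℂ) • Matrix.toEuclideanCLM (n := Fin 2) (𝕜 := ℂ) (pauli i) :=
  funext fun x => by simp only [spin3, map_sum, map_smul]

end

end MagneticHamiltonian

/-! ### The Pauli and Schrödinger operators -/

open MagneticHamiltonian
theorem mainTheorem8 (m : ℝ) (hm : 0 < m) :
    -- the Pauli operator in two dimensions
    (∀ (B : Pos 2 → ℝ) (A : Pos 2 → Pos 2) (A₀ : Pos 2 → ℝ),
      MediumDecay2 B → MediumRange A → IsCurl2 A B → ShortRange m A₀ →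
        HamiltonianAssertions (F := Spinor) m A (spin2 B) A₀) ∧
    -- the Pauli operator in three dimensions
    (∀ (B : Pos 3 → Pos 3) (A : Pos 3 → Pos 3) (A₀ : Pos 3 → ℝ),
      MediumDecay3 B → MediumRange A → IsCurl3 A B → ShortRange m A₀ →
        HamiltonianAssertions (F := Spinor) m A (spin3 B) A₀) ∧
    -- the Schrödinger operator in two and three dimensions, for arbitrary curl A
    (∀ ν : ℕ, ν = 2 ∨ ν = 3 → ∀ (A : Pos ν → Pos ν) (A₀ : Pos ν → ℝ),
      MediumRange A → ShortRange m A₀ →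
        HamiltonianAssertions (F := ℂ) m A (fun _ => 0) A₀) := by
  refine ⟨fun B A A₀ hB hA _ hA₀ => ?_, fun B A A₀ hB hA _ hA₀ => ?_, fun ν hν A A₀ hA hA₀ => ?_⟩
  · obtain ⟨p, hp, hBp⟩ := hB.memLp
    rw [spin2_eq]
    exact hamiltonianAssertions_of_memLp (by norm_num) hm hp.le (memLp_pauli hBp 2)
      (fun x => isSelfAdjoint_real_smul_pauli _ _) hA hA₀
  · obtain ⟨p, hp, hBp⟩ := hB.1.memLp
    have hp2 : (2 : ℝ≥0∞) ≤ p := le_trans (by norm_num) hp.le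
    have hcomp : ∀ i, MemLp (fun x => B x i) p volume := fun i =>
      hBp.of_le ((EuclideanSpace.proj i : Pos 3 →L[ℝ] ℝ).continuous.comp_aestronglyMeasurable
        hBp.1) (Eventually.of_forall fun x => PiLp.norm_apply_le (B x) i)
    rw [spin3_eq]
    exact hamiltonianAssertions_of_memLp (by norm_num) hm hp2
      (memLp_finsetSum _ fun i _ => memLp_pauli (hcomp i) i)
      (fun x => isSelfAdjoint_sum _ fun i _ => isSelfAdjoint_real_smul_pauli _ _) hA hA₀
  -- The Schrödinger operator is the case of vanishing spin term, with `p = 2`.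
  · exact hamiltonianAssertions_of_memLp (by omega) hm le_rfl MemLp.zero
      (fun _ => IsSelfAdjoint.zero _) hA hA₀
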